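/- **Conventions.** Fix a commutative ring $R$. For a small category $\mathcal{C}$, let $|\mathcal{C}|$ be the geometric realization of its nerve, and let $R\mathcal{C}\text{-mod}$ be the category of covariant functors from $\mathcal{C}$ to $R$-modules. For a group $G$, let $\mathcal{B}(G)$ be the category with one object whose endomorphism group is $G$; thus $R\mathcal{B}(\pi)$-modules are $R\pi$-modules. A group $G$ is $R$-*perfect* if $H_1(G;R)=0$. A *category over a group* $\pi$ is a pair $(\mathcal{C},\theta)$, where $\mathcal{C}$ is a nonempty connected small category and $\theta\colon\mathcal{C}\to\mathcal{B}(\pi)$ is a functor such that $\pi_1(|\theta|)\colon\pi_1(|\mathcal{C}|)\to\pi_1(|\mathcal{B}(\pi)|)\cong\pi$ is surjective. Let $\theta^*\colon R\pi\text{-mod}\to R\mathcal{C}\text{-mod}$ be composition with $\theta$, let $\theta_*\colon R\mathcal{C}\text{-mod}\to R\pi\text{-mod}$ be left Kan extension along $\theta$, and let $L_1\theta_*$ be the first left derived functor of $\theta_*$. An $\Omega$-*system* is a pair of additive functors $\theta_*\colon\mathcal{A}\to\mathcal{B}$ and $\theta^*\colon\mathcal{B}\to\mathcal{A}$ between abelian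 categories such that $\theta_*$ is left adjoint to $\theta^*$, the counit $\theta_*\theta^*\to\mathrm{Id}_{\mathcal{B}}$ is an isomorphism, and $\theta^*$ preserves epimorphisms. An $\Omega$-*resolution* of a projective object $X$ of $\mathcal{B}$ is a chain complex $\mathbf{R}=(\cdots\to P_2\to P_1\to P_0\xrightarrow{\varepsilon}\theta^*(X)\to0)$ in $\mathcal{A}$ such that every $P_n$ is projective, $\theta_*(\mathbf{R})$ is exact, every $H_n(P_*)$ is isomorphic to an object of $\theta^*(\mathcal{B})$, and $\varepsilon$ induces an isomorphism $H_0(P_*)\cong\theta^*(X)$. We say that $\theta^*(\mathcal{B})$ is *closed under subobjects* if, for each monomorphism $A_1\to A_2$ in $\mathcal{A}$, $A_1$ is isomorphic to an object of $\theta^*(\mathcal{B})$ whenever $A_2$ is; and *closed under extensions* if, for each short exact sequence $0\to M'\to M\to M''\to0$ in $\mathcal{A}$, $M$ is isomorphic to an object of $\theta^*(\mathcal{B})$ whenever $M'$ and $M''$ are. **Proposition.** Let $(\mathcal{C},\theta)$ be a category over a group $\pi$, and set $H=\mathrm{Ker}\bigl[\pi_1(|\theta|)\colon\pi_1(|\mathcal{C}|)\to\pi\bigr]$.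 Then $(\theta_*,\theta^*)$ is an $\Omega$-system between $R\mathcal{C}\text{-mod}$ and $R\pi\text{-mod}$, and the following hold. (a) If $H$ is $R$-perfect, then $(L_1\theta_*)(\theta^*X)=0$ for every $R\pi$-module $X$, and $\theta^*(R\pi\text{-mod})$ is closed under extensions in $R\mathcal{C}\text{-mod}$. If, moreover, $\mathcal{C}$ is equal (or just equivalent) to $\mathcal{B}(G)$ for a group $G$, then every projective $R\pi$-module has an $\Omega$-resolution. (b) Whether or not $H$ is $R$-perfect: if $\mathcal{C}$ is equal (or just equivalent) to $\mathcal{B}(G)$ for a group $G$, then $\theta^*(R\pi\text{-mod})$ is closed under subobjects in $R\mathcal{C}\text{-mod}$. If $R\neq0$ and $\mathcal{C}$ is an EI-category (all endomorphisms are automorphisms) with more than one isomorphism class of objects, then $\theta^*(R\pi\text{-mod})$ is not closed under subobjects in $R\mathcal{C}\text{-mod}$. (c) If $H$ is not $R$-perfect, then $\theta^*(R\pi\text{-mod})$ is not closed under extensions in $R\mathcal{C}\text{-mod}$, and the projective $R\pi$-module $R\pi$ has no $\Omega$-resolution. More generally, no nonzero projective $R\pi$-module that is free as an $R$-module has an $\Omega$-resolution.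 -/

import Mathlib

open CategoryTheory CategoryTheory.Limits
open scoped Simplicial

universe u

noncomputable section

namespace OmegaRes

/-- The category `B(π)` of a group: one object, with endomorphism group `π`. (This is
`SingleObj π`, except that the type of objects lives in the same universe as `π`.) -/
def BCat (_π : Type u) : Type u := PUnit

/-- The unique object of `B(π)`. -/
def BCat.star (π : Type u) : BCat π := PUnit.unit

instance BCat.category (π : Type u) [Group π] : SmallCategory (BCat π) where
  Hom _ _ := π
  id _ := 1
  comp f g := g * f
  id_comp f := mul_one f
  comp_id f := one_mul f
  assoc f g h := (mul_assoc h g f).symm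

/-! ### Fundamental groups of small categories -/

/-- The geometric realization `|C|` of the nerve of a small category. -/
abbrev geomReal (C : Type u) [SmallCategory C] : TopCat.{u} :=
  SSet.toTop.obj (nerve C)

/-- The continuous map `|θ| : |C| → |D|` induced by a functor. -/
def geomRealMap {C D : Type u} [SmallCategory C] [SmallCategory D] (θ : C ⥤ D) :
    C(geomReal C, geomReal D) :=
  (SSet.toTop.map (nerveMap θ)).hom

/-- The point of `|C|` given by an object `c`: the image of the unique point of `|Δ[0]|` under
the realization of the map `Δ[0] ⟶ nerve C` classifying the `0`-simplex `c`. -/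
def vertex {C : Type u} [SmallCategory C] (c : C) : geomReal C :=
  SSet.toTop.map ((SSet.yonedaEquiv (X := nerve C) (n := ⦋0⦌)).symm (ComposableArrows.mk₀ c))
    (default : SSet.toTop.obj (Δ[0] : SSet.{u}))

/-- The homomorphism `π₁(|θ|) : π₁(|C|, c) → π₁(|D|, θ c)` induced by a functor. -/
def piOneMap {C D : Type u} [SmallCategory C] [SmallCategory D] (θ : C ⥤ D) (c : C) :
    FundamentalGroup (geomReal C) (vertex c) →*
      FundamentalGroup (geomReal D) (geomRealMap θ (vertex c)) :=
  FundamentalGroup.map (geomRealMap θ) (vertex c)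

/-- `(C, θ)` is a category over the group `π`: `C` is a nonempty connected small category, and
`θ : C ⥤ B(π)` is surjective on fundamental groups. Here `π` is identified with the
fundamental group of `|B(π)|`. -/
structure IsCategoryOver {C : Type u} [SmallCategory C] {π : Type u} [Group π]
    (θ : C ⥤ BCat π) : Prop where
  isConnected : IsConnected C
  surjective (c : C) : Function.Surjective (piOneMap θ c)

/-- A group `G` is `R`-perfect if `H₁(G; R) = 0`, for the trivial action of `G` on `R`. -/
def IsPerfectOver (R : Type u) [CommRing R] (G : Type u) [Group G] : Prop :=
  IsZero (groupHomology (Rep.trivial R G R) 1)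

/-- An EI-category: every endomorphism is an isomorphism. -/
def IsEI (C : Type u) [SmallCategory C] : Prop :=
  ∀ (c : C) (f : c ⟶ c), IsIso f

/-! ### Omega-systems and Omega-resolutions -/

section Omega

universe v₁ u₁ v₂ u₂

variable {A : Type u₁} [Category.{v₁} A] [Abelian A] {B : Type u₂} [Category.{v₂} B] [Abelian B]

/-- An `Ω`-system: additive functors `F : A ⥤ B` (playing the role of `θ_*`) and `G : B ⥤ A`
(playing the role of `θ^*`) between abelian categories, where `F` is left adjoint to `G`, the
counit is an isomorphism, and `G` preserves epimorphisms. -/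
structure IsOmegaSystem {F : A ⥤ B} {G : B ⥤ A} (adj : F ⊣ G) : Prop where
  additive_left : F.Additive
  additive_right : G.Additive
  isIso_counit : IsIso adj.counit
  preservesEpimorphisms : G.PreservesEpimorphisms

/-- The morphism `H₀(P) ⟶ Y` induced by an augmentation `ε : P₀ ⟶ Y` of a chain complex. -/
def homologyZeroDesc (P : ChainComplex A ℕ) {Y : A} (ε : P.X 0 ⟶ Y) (w : P.d 1 0 ≫ ε = 0) :
    P.homology 0 ⟶ Y :=
  P.homologyι 0 ≫ P.descOpcycles ε 1 (by simp) w

/-- `⋯ → P₂ → P₁ → P₀ → G X → 0` (with augmentation `ε`) is an `Ω`-resolution of `X`. -/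
structure IsOmegaResolution (F : A ⥤ B) (G : B ⥤ A) [F.Additive] (X : B)
    (P : ChainComplex A ℕ) (ε : P.X 0 ⟶ G.obj X) (w : P.d 1 0 ≫ ε = 0) : Prop where
  projective (n : ℕ) : Projective (P.X n)
  /-- The image under `F` of the whole augmented complex is exact. -/
  exact_map :
    ((F.mapHomologicalComplex (ComplexShape.down ℕ)).obj (P.augment ε w)).Acyclic
  homology_mem (n : ℕ) : G.essImage (P.homology n)
  isIso_homologyZero : IsIso (homologyZeroDesc P ε w)

/-- The object `X` has an `Ω`-resolution with respect to `F` and `G`. -/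
def HasOmegaResolution (F : A ⥤ B) (G : B ⥤ A) [F.Additive] (X : B) : Prop :=
  ∃ (P : ChainComplex A ℕ) (ε : P.X 0 ⟶ G.obj X) (w : P.d 1 0 ≫ ε = 0),
    IsOmegaResolution F G X P ε w

end Omega

/-! ### Modules over small categories -/

/-- `R C`-modules: covariant functors from `C` to `R`-modules. For `C = BCat π` these are
the left modules over the group ring `R π`. -/
abbrev CatMod (R : Type u) [CommRing R] (C : Type u) [SmallCategory C] :=
  C ⥤ ModuleCat.{u} R

section

variable (R : Type u) [CommRing R] {C D : Type u} [SmallCategory C] [SmallCategory D] (θ : C ⥤ D)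

/-- `θ^*`: composition with `θ`. -/
abbrev upperStar : CatMod R D ⥤ CatMod R C :=
  (Functor.whiskeringLeft C D (ModuleCat.{u} R)).obj θ

/-- `θ_*`: left Kan extension along `θ`. -/
abbrev lowerStar : CatMod R C ⥤ CatMod R D :=
  θ.lan

/-- `θ_*` is left adjoint to `θ^*`. -/
abbrev starAdj : lowerStar R θ ⊣ upperStar R θ :=
  θ.lanAdjunction (ModuleCat.{u} R)

instance upperStar_additive : (upperStar R θ).Additive where

instance lowerStar_additive : (lowerStar R θ).Additive :=
  (starAdj R θ).left_adjoint_additive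

/-- The category of `R C`-modules has enough projectives, so that left derived functors on it
are defined. -/
instance catMod_enoughProjectives : EnoughProjectives (CatMod R C) where
  presentation M := by
    let Q : C → CatMod R C := fun c =>
      (evaluationLeftAdjoint (ModuleCat.{u} R) c).obj (Projective.over (M.obj c))
    have hQ : ∀ c, Projective (Q c) := fun c =>
      (evaluationAdjunctionRight (ModuleCat.{u} R) c).map_projective _ inferInstance
    let q : ∀ c, Q c ⟶ M := fun c =>
      ((evaluationAdjunctionRight (ModuleCat.{u} R) c).homEquiv _ _).symm
        (Projective.π (M.obj c))
    have hq : ∀ c, Epi ((q c).app c) := fun c => by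
      have h : (evaluationAdjunctionRight (ModuleCat.{u} R) c).unit.app _ ≫ (q c).app c =
          Projective.π (M.obj c) := by
        have := ((evaluationAdjunctionRight (ModuleCat.{u} R) c).homEquiv _ _).apply_symm_apply
          (Projective.π (M.obj c))
        rwa [Adjunction.homEquiv_unit] at this
      have : Epi ((evaluationAdjunctionRight (ModuleCat.{u} R) c).unit.app
          (Projective.over (M.obj c)) ≫ (q c).app c) := by
        rw [h]; exact Projective.π_epi _
      exact epi_of_epi ((evaluationAdjunctionRight (ModuleCat.{u} R) c).unit.app _) ((q c).app c)
    have key : ∀ c, Epi ((Limits.Sigma.desc q).app c) := fun c => by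
      have h : (Limits.Sigma.ι Q c).app c ≫ (Limits.Sigma.desc q).app c = (q c).app c := by
        rw [← NatTrans.comp_app, Limits.Sigma.ι_desc]
      have : Epi ((Limits.Sigma.ι Q c).app c ≫ (Limits.Sigma.desc q).app c) := by
        rw [h]; exact hq c
      exact epi_of_epi ((Limits.Sigma.ι Q c).app c) _
    have hepi : Epi (Limits.Sigma.desc q) := NatTrans.epi_of_epi_app _
    exact ⟨{ p := ∐ Q, f := Limits.Sigma.desc q }⟩

/-- The free module `R π` of rank one over the group ring of `π`: the free `R`-module on `π`,
with `π` acting by left multiplication. -/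
def groupRing (π : Type u) [Group π] : CatMod R (BCat π) :=
  coyoneda.obj (Opposite.op (BCat.star π)) ⋙ ModuleCat.free R

end

end OmegaRes

end

/-! Let Γ be the vertex group at `c₀` of the free groupoid on C. The proof has a topological half,
identifying Γ with π₁(|C|), and an algebraic half, working with Γ-modules.

Topology. Edges of |C| define `zigzagFunctor` from the free groupoid to the fundamental groupoid of
|C|. Both of its properties come from reading a point s of a simplex as the step function on [0, 1)
that takes the value i on an interval of length s i, a description natural in all simplicial
operators. Every path between vertices is a zigzag (`exists_zigzag_eq_pathArrow`): |C| is covered by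
open sets, each of which some homotopy of |C| carries to a vertex, and the path is subdivided along
this cover. Distinct zigzags stay distinct (`lift_map_eq_one`): a functor from C to B(G) maps |C| to
G-valued step functions modulo G. The projection of step functions onto this quotient is a covering,
and its monodromy recovers the value of a zigzag in G. Consequently θ is the composite of C → B(Γ),
a localization at all morphisms, with the functor of a surjection p : Γ → π whose kernel is
isomorphic to H (`exists_isLocalization_comp`).

Algebra. So θ^* is fully faithful, and its image consists of the functors that invert every morphism
and on which, as Γ-modules, ker p acts trivially. Perfectness of H means that H has no nontrivial
homomorphism to an R-module (`isPerfectOver_iff`). On an extension of two modules in the image, h ↦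
hn − n is such a homomorphism, hence closure under extensions. Conversely a nontrivial u : H → V is
built into an extension `twist` that lies outside the image.

Resolutions. Closure under extensions makes θ_* preserve monomorphisms whose cokernel is in the
image (`mono_map_of_isClosedUnderExtensions`). This gives L₁θ_* = 0 on the image. If the image is
also closed under subobjects, a resolution is built step by step: the kernel of each projective
cover is cut down by a quotient in the image, so that θ_* becomes exact (`exists_resolutionStep`).
Conversely an Ω-resolution of X puts every extension of θ^*X by θ^* of an injective into the image
(`HasOmegaResolution.essImage_of_shortExact`), which `twist` contradicts when V is chosen injective.
-/

noncomputable section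

namespace OmegaRes

/-! ### Simplices of the geometric realization -/

section Realization

/-- The standard topological simplex attached to an object of the simplex category. -/
abbrev TopSimplex (n : SimplexCategory) : Type := stdSimplex ℝ (Fin (n.len + 1))

/-- The affine map of topological simplices induced by a morphism of the simplex category. -/
abbrev topSimplexMap {n m : SimplexCategory} (f : n ⟶ m) : TopSimplex n → TopSimplex m :=
  stdSimplex.map f

variable {X : SSet.{u}}

/-- The map from the topological simplex to the realization given by a simplex. -/
def simplexMap {n : SimplexCategory} (σ : X.obj (Opposite.op n)) :
    C(TopSimplex n, SSet.toTop.obj X) :=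
  (SSet.toTop.map (SSet.yonedaEquiv.symm σ)).hom.comp
    ⟨n.toTopHomeo.symm, n.toTopHomeo.symm.continuous⟩

lemma simplexMap_apply {n : SimplexCategory} (σ : X.obj (Opposite.op n)) (s : TopSimplex n) :
    simplexMap σ s = SSet.toTop.map (SSet.yonedaEquiv.symm σ) (n.toTopHomeo.symm s) := rfl

lemma simplexMap_map {n m : SimplexCategory} (f : n ⟶ m) (σ : X.obj (Opposite.op m))
    (s : TopSimplex n) :
    simplexMap (X.map f.op σ) s = simplexMap σ (topSimplexMap f s) := by
  rw [simplexMap_apply, simplexMap_apply, SimplexCategory.toTopHomeo_symm_naturality_apply,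
    ← SSet.yonedaEquiv_symm_naturality_left, Functor.map_comp]
  rfl

lemma simplexMap_toTop_map {Y : SSet.{u}} (φ : X ⟶ Y) {n : SimplexCategory}
    (σ : X.obj (Opposite.op n)) (s : TopSimplex n) :
    (SSet.toTop.map φ) (simplexMap σ s) = simplexMap (φ.app _ σ) s := by
  rw [simplexMap_apply, simplexMap_apply, ← SSet.yonedaEquiv_symm_comp, Functor.map_comp]
  rfl

/-- A natural family of continuous maps on simplices descends to the realization. -/
theorem exists_desc {Y : Type u} [TopologicalSpace Y]
    (g : ∀ (n : SimplexCategory) (_ : X.obj (Opposite.op n)), C(TopSimplex n, Y))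
    (hg : ∀ {n m : SimplexCategory} (f : n ⟶ m) (σ : X.obj (Opposite.op m)) (s : TopSimplex n),
      g n (X.map f.op σ) s = g m σ (topSimplexMap f s)) :
    ∃ G : C(SSet.toTop.obj X, Y), ∀ (n : SimplexCategory) (σ : X.obj (Opposite.op n))
      (s : TopSimplex n), G (simplexMap σ s) = g n σ s := by
  let φ : X ⟶ TopCat.toSSet.obj (TopCat.of Y) :=
    { app := fun n => TypeCat.ofHom fun σ => (TopCat.toSSetObjEquiv (TopCat.of Y) n).symm (g _ σ)
      naturality := by
        rintro ⟨m⟩ ⟨n⟩ f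
        ext σ
        apply (TopCat.toSSetObjEquiv (TopCat.of Y) _).injective
        ext s
        exact hg f.unop σ s }
  let G := (sSetTopAdj.homEquiv X (TopCat.of Y)).symm φ
  refine ⟨G.hom, fun n σ s => ?_⟩
  have h : sSetTopAdj.unit.app X ≫ TopCat.toSSet.map G = φ := by
    exact (Adjunction.homEquiv_unit ..).symm.trans (Equiv.apply_symm_apply _ _)
  have h2 := congrArg (fun ψ => TopCat.toSSetObjEquiv (TopCat.of Y) _ (ψ.app (Opposite.op n) σ) s) h
  refine Eq.trans ?_ h2
  rfl

theorem realization_hom_ext {Y : Type u} [TopologicalSpace Y] {F G : C(SSet.toTop.obj X, Y)}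
    (h : ∀ (n : SimplexCategory) (σ : X.obj (Opposite.op n)) (s : TopSimplex n),
      F (simplexMap σ s) = G (simplexMap σ s)) : F = G := by
  have : (TopCat.ofHom F : SSet.toTop.obj X ⟶ TopCat.of Y) = TopCat.ofHom G := by
    apply (sSetTopAdj.homEquiv X (TopCat.of Y)).injective
    ext ⟨n⟩ σ
    apply (TopCat.toSSetObjEquiv (TopCat.of Y) _).injective
    ext s
    rw [Adjunction.homEquiv_unit, Adjunction.homEquiv_unit]
    exact h n σ s
  exact congrArg TopCat.Hom.hom this

theorem exists_simplexMap_eq (x : SSet.toTop.obj X) :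
    ∃ (n : SimplexCategory) (σ : X.obj (Opposite.op n)) (s : TopSimplex n), simplexMap σ s = x := by
  -- For the indiscrete topology every predicate is continuous, so uniqueness of maps out of the
  -- realization applies to the predicate "lies in the image of some simplex".
  let : TopologicalSpace (ULift.{u} Prop) := ⊤
  let F : C(SSet.toTop.obj X, ULift.{u} Prop) := ⟨fun _ => ⟨True⟩, continuous_top⟩
  let G : C(SSet.toTop.obj X, ULift.{u} Prop) :=
    ⟨fun x => ⟨∃ (n : SimplexCategory) (σ : X.obj (Opposite.op n)) (s : TopSimplex n),
      simplexMap σ s = x⟩, continuous_top⟩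
  have h : F = G := realization_hom_ext fun n σ s => by
    simp only [F, G, ContinuousMap.coe_mk, ULift.up.injEq, eq_iff_iff, true_iff]
    exact ⟨n, σ, s, rfl⟩
  have h2 := congrArg ULift.down (DFunLike.congr_fun h x)
  exact cast h2 trivial

/-- Open sets are continuous maps to the Sierpinski space `Prop`, and such maps glue from simplices.
-/
theorem isOpen_of_isOpen_preimage_simplexMap {U : Set (SSet.toTop.obj X)}
    (h : ∀ (n : SimplexCategory) (σ : X.obj (Opposite.op n)), IsOpen (simplexMap σ ⁻¹' U)) :
    IsOpen U := by
  obtain ⟨G, hG⟩ := exists_desc (X := X) (Y := ULift.{u} Prop)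
    (fun n σ => ⟨fun s => ⟨simplexMap σ s ∈ U⟩,
      continuous_uliftUp.comp (isOpen_iff_continuous_mem.1 (h n σ))⟩)
    (fun f σ s => by simp [simplexMap_map])
  rw [isOpen_iff_continuous_mem]
  refine (continuous_uliftDown.comp G.continuous).congr fun x => ?_
  obtain ⟨n, σ, s, rfl⟩ := exists_simplexMap_eq x
  simp [hG]

end Realization

/-! ### Vertices and simplices of the nerve -/

section Nerve

variable {C : Type u} [SmallCategory C]

/-- The type of simplices of the nerve, seen as functors from finite linear orders. -/
abbrev NerveSimplex (C : Type u) [SmallCategory C] (n : SimplexCategory) : Type u :=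
  (nerve C).obj (Opposite.op n)

lemma nerve_map_obj {n m : SimplexCategory} (f : n ⟶ m) (σ : NerveSimplex C m)
    (i : Fin (n.len + 1)) :
    ((nerve C).map f.op σ).obj i = σ.obj (f.toOrderHom i) := rfl

lemma nerve_map_map {n m : SimplexCategory} (f : n ⟶ m) (σ : NerveSimplex C m)
    {i j : Fin (n.len + 1)} (hij : i ≤ j) :
    ((nerve C).map f.op σ).map (homOfLE hij) =
      σ.map (homOfLE (f.toOrderHom.monotone hij)) := rfl

/-- The `0`-simplex of the nerve given by an object. -/
def nerveZero (c : C) : NerveSimplex C ⦋0⦌ := ComposableArrows.mk₀ c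

lemma simplexMap_nerveZero (c : C) (s : TopSimplex ⦋0⦌) :
    simplexMap (nerveZero c) s = vertex c := by
  refine (simplexMap_apply _ _).trans ?_
  rw [vertex]
  congr 1
  exact Subsingleton.elim _ _

lemma simplexMap_vertex {n : SimplexCategory} (σ : NerveSimplex C n) (i : Fin (n.len + 1)) :
    simplexMap σ (stdSimplex.vertex i) = vertex (σ.obj i) := by
  have h := simplexMap_map (X := nerve C) (SimplexCategory.const ⦋0⦌ n i) σ (stdSimplex.vertex 0)
  rw [topSimplexMap, stdSimplex.map_vertex] at h
  refine h.symm.trans ?_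
  rw [← simplexMap_nerveZero (σ.obj i) (stdSimplex.vertex 0)]
  congr 2
  exact ComposableArrows.ext₀ rfl

lemma geomRealMap_simplexMap {D : Type u} [SmallCategory D] (θ : C ⥤ D) {n : SimplexCategory}
    (σ : NerveSimplex C n) (s : TopSimplex n) :
    geomRealMap θ (simplexMap σ s) = simplexMap (X := nerve D) ((nerveMap θ).app _ σ) s :=
  simplexMap_toTop_map (nerveMap θ) σ s

lemma geomRealMap_vertex {D : Type u} [SmallCategory D] (θ : C ⥤ D) (c : C) :
    geomRealMap θ (vertex c) = vertex (θ.obj c) := by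
  rw [← simplexMap_nerveZero c (stdSimplex.vertex 0), geomRealMap_simplexMap, simplexMap_vertex]
  rfl

end Nerve

end OmegaRes

end
noncomputable section

namespace OmegaRes

/-! ### Step functions attached to points of a simplex -/

section StepIndex

open MeasureTheory Set

variable {n m : SimplexCategory}

/-- The partial sums of the barycentric coordinates. -/
def partialSum (s : TopSimplex n) (i : Fin (n.len + 1)) : ℝ := ∑ j ∈ Finset.Iic i, s j

lemma partialSum_last (s : TopSimplex n) : partialSum s (Fin.last _) = 1 := by
  have : Finset.Iic (Fin.last n.len) = Finset.univ := by
    ext; simp [Fin.le_last]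
  rw [partialSum, this]
  exact stdSimplex.sum_eq_one s

lemma continuous_partialSum (i : Fin (n.len + 1)) :
    Continuous fun s : TopSimplex n => partialSum s i :=
  continuous_finsetSum _ fun j _ => (continuous_apply j).comp continuous_subtype_val

lemma topSimplexMap_apply (f : n ⟶ m) (s : TopSimplex n) (k : Fin (m.len + 1)) :
    topSimplexMap f s k = ∑ j with f.toOrderHom j = k, s j := by
  rw [topSimplexMap, stdSimplex.map_coe, FunOnFinite.linearMap_apply_apply]
  rfl

lemma partialSum_map (f : n ⟶ m) (s : TopSimplex n) (k : Fin (m.len + 1)) :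
    partialSum (topSimplexMap f s) k = ∑ j with f.toOrderHom j ≤ k, s j := by
  simp only [partialSum, topSimplexMap_apply]
  rw [← Finset.sum_fiberwise_of_maps_to (s := Finset.univ.filter fun j => f.toOrderHom j ≤ k)
    (t := Finset.Iic k) (g := f.toOrderHom) (by simp)]
  refine Finset.sum_congr rfl fun i hi => Finset.sum_congr ?_ fun _ _ => rfl
  ext j
  simp only [Finset.mem_filter, Finset.mem_univ, true_and, Finset.mem_Iic] at hi ⊢
  exact ⟨fun h => ⟨h ▸ hi, h⟩, fun h => h.2⟩

open Classical in
/-- The value at `x` of the step function on `[0, 1)` whose value is `i` on an interval of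
length `s i`. -/
def stepIndex (s : TopSimplex n) (x : ℝ) : Fin (n.len + 1) :=
  if h : (Finset.univ.filter fun i => x < partialSum s i).Nonempty then Finset.min' _ h else 0

lemma stepIndex_eq_iff (s : TopSimplex n) {x : ℝ} (hx : x < 1) (i : Fin (n.len + 1)) :
    stepIndex s x = i ↔ x < partialSum s i ∧ ∀ j < i, partialSum s j ≤ x := by
  -- The last partial sum is 1, so for x < 1 the default value 0 of `stepIndex` is never reached.
  have h : (Finset.univ.filter fun i => x < partialSum s i).Nonempty :=
    ⟨Fin.last _, by simpa [partialSum_last] using hx⟩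
  rw [stepIndex, dif_pos h]
  constructor
  · rintro rfl
    refine ⟨by simpa using Finset.min'_mem _ h, fun j hj => ?_⟩
    by_contra! hlt
    exact hj.not_ge (Finset.min'_le _ _ (by simpa using hlt))
  · rintro ⟨h1, h2⟩
    refine le_antisymm (Finset.min'_le _ _ (by simpa using h1)) ?_
    refine Finset.le_min' _ _ _ fun j hj => ?_
    by_contra! hlt
    exact (h2 j hlt).not_gt (by simpa using hj)

/-- A monotone f merges consecutive intervals and inserts empty ones, so the step function is simply
composed with f. -/
lemma stepIndex_map (f : n ⟶ m) (s : TopSimplex n) {x : ℝ} (hx₀ : 0 ≤ x) (hx : x < 1) :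
    stepIndex (topSimplexMap f s) x = f.toOrderHom (stepIndex s x) := by
  obtain ⟨h1, h2⟩ := (stepIndex_eq_iff s hx _).1 rfl
  rw [stepIndex_eq_iff _ hx]
  simp only [partialSum_map]
  refine ⟨h1.trans_le (Finset.sum_le_sum_of_subset_of_nonneg (fun j hj => ?_) fun j _ _ => by simp),
    fun k hk => ?_⟩
  · simpa using f.toOrderHom.monotone (Finset.mem_Iic.1 hj)
  · by_cases h : (Finset.univ.filter fun j => f.toOrderHom j ≤ k).Nonempty
    · set j₀ := Finset.max' _ h
      have hj₀ : f.toOrderHom j₀ ≤ k := by simpa using Finset.max'_mem _ h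
      refine le_trans ?_ (h2 j₀ ?_)
      · refine Finset.sum_le_sum_of_subset_of_nonneg (fun j hj => ?_) fun j _ _ => by simp
        exact Finset.mem_Iic.2 (Finset.le_max' _ _ hj)
      · by_contra! hle
        exact (hk.trans_le (f.toOrderHom.monotone hle)).not_ge hj₀
    -- No vertex maps to k or below: the partial sum is 0, and 0 ≤ x is what is needed.
    · rw [Finset.not_nonempty_iff_eq_empty.1 h, Finset.sum_empty]
      exact hx₀

lemma measurableSet_stepIndex_eq (s : TopSimplex n) {b : ℝ} (hb : b ≤ 1) (i : Fin (n.len + 1)) :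
    MeasurableSet (Ico (0 : ℝ) b ∩ stepIndex s ⁻¹' {i}) := by
  have : (Ico (0 : ℝ) b ∩ stepIndex s ⁻¹' {i}) =
      Ico 0 b ∩ (Iio (partialSum s i) ∩ ⋂ j < i, Ici (partialSum s j)) := by
    ext x
    simp only [mem_preimage, mem_singleton_iff, mem_inter_iff, mem_Iio, mem_iInter, mem_Ici,
      and_congr_right_iff]
    exact fun hx => stepIndex_eq_iff s (hx.2.trans_le hb) i
  rw [this]
  exact measurableSet_Ico.inter (measurableSet_Iio.inter
    (MeasurableSet.iInter fun j => MeasurableSet.iInter fun _ => measurableSet_Ici))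

/-- The set where the step functions of two points differ. -/
def stepNe (s s' : TopSimplex n) : Set ℝ := Set.ofPred fun x => stepIndex s x ≠ stepIndex s' x

/-- The measure of the set where the step functions of two points of a simplex differ is controlled
by the partial sums. -/
lemma volume_stepIndex_ne_le (s s' : TopSimplex n) :
    volume (Ico (0 : ℝ) 1 ∩ stepNe s s') ≤
      ∑ k, ENNReal.ofReal (abs (partialSum s' k - partialSum s k)) := by
  have hsub : (Ico (0 : ℝ) 1 ∩ stepNe s s') ⊆
      ⋃ k ∈ Finset.univ, uIcc (partialSum s k) (partialSum s' k) := by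
    rintro x ⟨hx, hne⟩
    obtain ⟨h1, h2⟩ := (stepIndex_eq_iff s hx.2 _).1 rfl
    obtain ⟨h1', h2'⟩ := (stepIndex_eq_iff s' hx.2 _).1 rfl
    simp only [mem_iUnion, Finset.mem_univ, exists_true_left]
    -- At the smaller of the two indices one partial sum has already passed x and the other has not.
    rcases hne.lt_or_gt with h | h
    · exact ⟨_, mem_uIcc.2 (Or.inr ⟨h2' _ h, h1.le⟩)⟩
    · exact ⟨_, mem_uIcc.2 (Or.inl ⟨h2 _ h, h1'.le⟩)⟩
  refine (measure_mono hsub).trans ((measure_biUnion_finset_le _ _).trans ?_)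
  simp [Real.volume_interval]

lemma tendsto_volume_stepIndex_ne (s : TopSimplex n) :
    Filter.Tendsto (fun s' : TopSimplex n =>
      volume (Ico (0 : ℝ) 1 ∩ stepNe s s')) (nhds s) (nhds 0) := by
  refine tendsto_of_tendsto_of_tendsto_of_le_of_le tendsto_const_nhds ?_ (fun _ => zero_le)
    (fun s' => volume_stepIndex_ne_le s s')
  have : Continuous fun s' : TopSimplex n =>
      ∑ k, ENNReal.ofReal (abs (partialSum s' k - partialSum s k)) :=
    continuous_finsetSum _ fun k _ => ENNReal.continuous_ofReal.comp
      ((continuous_partialSum k).sub continuous_const).abs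
  simpa using this.tendsto s

/-- The distribution of the values of the step function of `s` on `[0, b)`. -/
def initialLaw {b : ℝ} (hb₀ : 0 < b) (hb : b ≤ 1) (s : TopSimplex n) : TopSimplex n :=
  ⟨fun i => volume.real (Ico (0 : ℝ) b ∩ stepIndex s ⁻¹' {i}) / b,
    fun i => div_nonneg measureReal_nonneg hb₀.le, by
    rw [← Finset.sum_div, ← measureReal_biUnion_finset (h := fun i _ =>
      ((measure_mono inter_subset_left).trans_lt measure_Ico_lt_top).ne)]
    · have : (⋃ i ∈ (Finset.univ : Finset (Fin (n.len + 1))),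
          (Ico (0 : ℝ) b ∩ stepIndex s ⁻¹' {i})) = Ico 0 b := by
        ext x; simp
      rw [this, Real.volume_real_Ico_of_le hb₀.le, sub_zero, div_self hb₀.ne']
    · intro i _ j _ hij
      exact Set.disjoint_left.2 fun x hx hx' => hij (hx.2.symm.trans hx'.2)
    · exact fun i _ => measurableSet_stepIndex_eq s hb i⟩

lemma initialLaw_apply {b : ℝ} (hb₀ : 0 < b) (hb : b ≤ 1) (s : TopSimplex n)
    (i : Fin (n.len + 1)) :
    initialLaw hb₀ hb s i = volume.real (Ico (0 : ℝ) b ∩ stepIndex s ⁻¹' {i}) / b := rfl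

lemma initialLaw_map {b : ℝ} (hb₀ : 0 < b) (hb : b ≤ 1) (f : n ⟶ m) (s : TopSimplex n) :
    initialLaw hb₀ hb (topSimplexMap f s) = topSimplexMap f (initialLaw hb₀ hb s) := by
  ext k
  rw [topSimplexMap_apply]
  simp only [initialLaw_apply]
  rw [← Finset.sum_div, ← measureReal_biUnion_finset (h := fun i _ =>
      ((measure_mono inter_subset_left).trans_lt measure_Ico_lt_top).ne)]
  · congr 2
    ext x
    simp only [mem_inter_iff, mem_preimage, mem_singleton_iff, Finset.mem_filter, Finset.mem_univ,
      true_and, mem_iUnion, exists_prop]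
    constructor
    · rintro ⟨hx, h⟩
      exact ⟨_, by rwa [← stepIndex_map f s hx.1 (hx.2.trans_le hb)], hx, rfl⟩
    · rintro ⟨j, rfl, hx, rfl⟩
      exact ⟨hx, stepIndex_map f s hx.1 (hx.2.trans_le hb)⟩
  · intro i _ j _ hij
    exact Set.disjoint_left.2 fun x hx hx' => hij (hx.2.symm.trans hx'.2)
  · exact fun i _ => measurableSet_stepIndex_eq s hb i

lemma continuous_initialLaw {b : ℝ} (hb₀ : 0 < b) (hb : b ≤ 1) :
    Continuous (initialLaw (n := n) hb₀ hb) := by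
  refine Continuous.subtype_mk (continuous_pi fun i => Continuous.div_const ?_ b) _
  rw [continuous_iff_continuousAt]
  intro s
  rw [ContinuousAt, tendsto_iff_dist_tendsto_zero]
  have h := (ENNReal.tendsto_toReal ENNReal.zero_ne_top).comp (tendsto_volume_stepIndex_ne s)
  rw [ENNReal.toReal_zero] at h
  refine squeeze_zero (fun _ => dist_nonneg) (fun s' => ?_) h
  rw [Real.dist_eq]
  refine (abs_measureReal_sub_le_measureReal_symmDiff'
    (measurableSet_stepIndex_eq s' hb i).nullMeasurableSet
    (measurableSet_stepIndex_eq s hb i).nullMeasurableSet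
    ((measure_mono inter_subset_left).trans_lt measure_Ico_lt_top).ne
    ((measure_mono inter_subset_left).trans_lt measure_Ico_lt_top).ne).trans ?_
  refine measureReal_mono ?_ ((measure_mono inter_subset_left).trans_lt measure_Ico_lt_top).ne
  rintro x (⟨⟨hx, h1⟩, h2⟩ | ⟨⟨hx, h1⟩, h2⟩)
  · exact ⟨⟨hx.1, hx.2.trans_le hb⟩, fun h => h2 ⟨hx, h.trans h1⟩⟩
  · exact ⟨⟨hx.1, hx.2.trans_le hb⟩, fun h => h2 ⟨hx, h.symm.trans h1⟩⟩

/-- When i is the first vertex carrying mass, the step function is constantly i on [0, s i). Taking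
b = s i therefore sends the point to a vertex. -/
lemma initialLaw_eq_vertex {b : ℝ} (hb₀ : 0 < b) (hb : b ≤ 1) (s : TopSimplex n)
    (i : Fin (n.len + 1)) (h : s i = b) (h₀ : ∀ j < i, s j = 0) :
    initialLaw hb₀ hb s = stdSimplex.vertex i := by
  have key : initialLaw hb₀ hb s i = 1 := by
    rw [initialLaw_apply]
    have : (Ico (0 : ℝ) b ∩ stepIndex s ⁻¹' {i}) = Ico 0 b := by
      refine inter_eq_left.2 fun x hx => ?_
      rw [mem_preimage, mem_singleton_iff, stepIndex_eq_iff s (hx.2.trans_le hb)]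
      refine ⟨?_, fun j hj => ?_⟩
      · refine hx.2.trans_le (h ▸ ?_)
        exact Finset.single_le_sum (f := fun j => s j) (fun j _ => by simp)
          (Finset.mem_Iic.2 le_rfl)
      · rw [partialSum, Finset.sum_eq_zero fun k hk => h₀ k ((Finset.mem_Iic.1 hk).trans_lt hj)]
        exact hx.1
    rw [this, Real.volume_real_Ico_of_le hb₀.le, sub_zero, div_self hb₀.ne']
  have hsum := stdSimplex.sum_eq_one (initialLaw hb₀ hb s)
  rw [← Finset.add_sum_erase _ _ (Finset.mem_univ i), key, add_eq_left,
    Finset.sum_eq_zero_iff_of_nonneg (fun i _ => by simp)] at hsum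
  ext j
  rw [stdSimplex.vertex_coe]
  by_cases hj : j = i
  · rw [hj, key, Pi.single_eq_same]
  · rw [Pi.single_eq_of_ne hj]
    exact hsum j (by simpa using hj)

end StepIndex

end OmegaRes

end
noncomputable section

namespace OmegaRes

/-! ### Collapsing the dominant part of a simplex of the nerve -/

section Collapse

variable {C : Type u} [SmallCategory C] {n m : SimplexCategory}

/-- Two vertices of a simplex of the nerve are related if the edge between them is an identity. -/
def IdRel (σ : NerveSimplex C n) (i j : Fin (n.len + 1)) : Prop :=
  ∃ h : σ.obj i = σ.obj j, (∀ hij : i ≤ j, σ.map (homOfLE hij) = eqToHom h) ∧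
    ∀ hji : j ≤ i, σ.map (homOfLE hji) = eqToHom h.symm

lemma IdRel.of_le {σ : NerveSimplex C n} {i j : Fin (n.len + 1)} (hij : i ≤ j)
    (h : σ.obj i = σ.obj j) (hm : σ.map (homOfLE hij) = eqToHom h) : IdRel σ i j := by
  refine ⟨h, fun _ => hm, fun hji => ?_⟩
  obtain rfl := le_antisymm hij hji
  exact hm

lemma IdRel.refl (σ : NerveSimplex C n) (i : Fin (n.len + 1)) : IdRel σ i i :=
  .of_le le_rfl rfl (σ.map_id i)

lemma IdRel.symm {σ : NerveSimplex C n} {i j : Fin (n.len + 1)} (h : IdRel σ i j) :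
    IdRel σ j i :=
  ⟨h.1.symm, h.2.2, h.2.1⟩

lemma IdRel.map_eq_of_le {σ : NerveSimplex C n} {i j k : Fin (n.len + 1)} (hij : IdRel σ i j)
    (hjk : IdRel σ j k) (hik : i ≤ k) :
    σ.map (homOfLE hik) = eqToHom (hij.1.trans hjk.1) := by
  obtain ⟨h₁, h₁l, h₁r⟩ := hij
  obtain ⟨h₂, h₂l, h₂r⟩ := hjk
  rcases le_total i j with hij | hji
  · rcases le_total j k with hjk | hkj
    · rw [← homOfLE_comp hij hjk, σ.map_comp, h₁l, h₂l, eqToHom_trans]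
    · have h := h₁l hij
      rw [← homOfLE_comp hik hkj, σ.map_comp, h₂r] at h
      rw [← cancel_mono (eqToHom h₂.symm), h, eqToHom_trans]
  · have h := h₂l (hji.trans hik)
    rw [← homOfLE_comp hji hik, σ.map_comp, h₁r] at h
    rw [← cancel_epi (eqToHom h₁.symm), h, eqToHom_trans]

lemma IdRel.trans {σ : NerveSimplex C n} {i j k : Fin (n.len + 1)} (hij : IdRel σ i j)
    (hjk : IdRel σ j k) : IdRel σ i k :=
  ⟨hij.1.trans hjk.1, fun h => hij.map_eq_of_le hjk h, fun h => hjk.symm.map_eq_of_le hij.symm h⟩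

/-- The edge between i and j of the pulled back simplex is the edge between f i and f j of σ.
Vertices that a degeneracy identifies are joined by identities, so classes of vertices, unlike
single vertices, behave well under all operators. -/
lemma idRel_map_iff (f : n ⟶ m) (σ : NerveSimplex C m) (i j : Fin (n.len + 1)) :
    IdRel ((nerve C).map f.op σ) i j ↔ IdRel σ (f.toOrderHom i) (f.toOrderHom j) := by
  constructor
  · rintro ⟨h, hl, hr⟩
    rcases le_total i j with hij | hji
    · exact .of_le (f.toOrderHom.monotone hij) h (hl hij)
    · exact .symm (.of_le (f.toOrderHom.monotone hji) h.symm (hr hji))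
  · rintro ⟨h, hl, hr⟩
    exact ⟨h, fun hij => hl (f.toOrderHom.monotone hij), fun hji => hr (f.toOrderHom.monotone hji)⟩

lemma sum_topSimplexMap_mul (f : n ⟶ m) (s : TopSimplex n) (φ : Fin (m.len + 1) → ℝ) :
    ∑ k, topSimplexMap f s k * φ k = ∑ j, s j * φ (f.toOrderHom j) := by
  simp only [topSimplexMap_apply, Finset.sum_mul]
  rw [← Finset.sum_fiberwise_of_maps_to (s := Finset.univ) (t := Finset.univ) (g := f.toOrderHom)
    (by simp)]
  refine Finset.sum_congr rfl fun k _ => Finset.sum_congr rfl fun j hj => ?_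
  rw [(Finset.mem_filter.1 hj).2]

open Classical in
/-- The total mass of the vertices related to a given one. -/
def classMass (σ : NerveSimplex C n) (s : TopSimplex n) (i : Fin (n.len + 1)) : ℝ :=
  ∑ j, s j * if IdRel σ j i then 1 else 0

/-- The mean value of the class mass. -/
def meanMass (σ : NerveSimplex C n) (s : TopSimplex n) : ℝ := ∑ j, s j * classMass σ s j

/-- The factor by which a barycentric coordinate is rescaled. -/
def collapseWeight (σ : NerveSimplex C n) (s : TopSimplex n) (i : Fin (n.len + 1)) : ℝ :=
  max 0 (2 * classMass σ s i - meanMass σ s)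

/-- The normalization constant for the rescaled coordinates. -/
def collapseTotal (σ : NerveSimplex C n) (s : TopSimplex n) : ℝ :=
  ∑ j, s j * collapseWeight σ s j

lemma classMass_map (f : n ⟶ m) (σ : NerveSimplex C m) (s : TopSimplex n) (i : Fin (n.len + 1)) :
    classMass σ (topSimplexMap f s) (f.toOrderHom i) = classMass ((nerve C).map f.op σ) s i := by
  classical
  simp only [classMass, sum_topSimplexMap_mul]
  exact Finset.sum_congr rfl fun j _ => by rw [if_congr (idRel_map_iff f σ j i).symm rfl rfl]

lemma meanMass_map (f : n ⟶ m) (σ : NerveSimplex C m) (s : TopSimplex n) :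
    meanMass σ (topSimplexMap f s) = meanMass ((nerve C).map f.op σ) s := by
  simp only [meanMass, sum_topSimplexMap_mul, classMass_map]

lemma collapseWeight_map (f : n ⟶ m) (σ : NerveSimplex C m) (s : TopSimplex n)
    (i : Fin (n.len + 1)) :
    collapseWeight σ (topSimplexMap f s) (f.toOrderHom i) =
      collapseWeight ((nerve C).map f.op σ) s i := by
  simp only [collapseWeight, classMass_map, meanMass_map]

lemma collapseTotal_map (f : n ⟶ m) (σ : NerveSimplex C m) (s : TopSimplex n) :
    collapseTotal σ (topSimplexMap f s) = collapseTotal ((nerve C).map f.op σ) s := by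
  simp only [collapseTotal, sum_topSimplexMap_mul, collapseWeight_map]

lemma le_classMass (σ : NerveSimplex C n) (s : TopSimplex n) (i : Fin (n.len + 1)) :
    s i ≤ classMass σ s i := by
  classical
  refine le_trans (by simp [IdRel.refl]) (Finset.single_le_sum (f := fun j =>
    s j * if IdRel σ j i then (1 : ℝ) else 0) (fun j _ => ?_) (Finset.mem_univ i))
  have := stdSimplex.zero_le s j
  positivity

lemma classMass_nonneg (σ : NerveSimplex C n) (s : TopSimplex n) (i : Fin (n.len + 1)) :
    0 ≤ classMass σ s i :=
  (stdSimplex.zero_le s i).trans (le_classMass σ s i)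

lemma meanMass_pos (σ : NerveSimplex C n) (s : TopSimplex n) : 0 < meanMass σ s := by
  obtain ⟨i, hi⟩ : ∃ i, 0 < s i := by
    by_contra! h
    have := stdSimplex.sum_eq_one s
    rw [Finset.sum_eq_zero fun i _ => le_antisymm (h i) (stdSimplex.zero_le s i)] at this
    exact zero_ne_one this
  refine (mul_pos hi (hi.trans_le (le_classMass σ s i))).trans_le ?_
  exact Finset.single_le_sum (f := fun j => s j * classMass σ s j)
    (fun j _ => mul_nonneg (stdSimplex.zero_le s j) (classMass_nonneg σ s j)) (Finset.mem_univ i)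

lemma collapseTotal_pos (σ : NerveSimplex C n) (s : TopSimplex n) : 0 < collapseTotal σ s := by
  refine (meanMass_pos σ s).trans_le ?_
  -- Without the truncation at 0 the weights would average to 2 · mean − mean = mean.
  calc meanMass σ s = ∑ j, s j * (2 * classMass σ s j - meanMass σ s) := by
        simp only [mul_sub, Finset.sum_sub_distrib, ← Finset.sum_mul, stdSimplex.sum_eq_one]
        simp only [mul_left_comm _ (2 : ℝ), ← Finset.mul_sum]
        have h : ∑ j, s j * classMass σ s j = meanMass σ s := rfl
        rw [h]
        ring
    _ ≤ _ := Finset.sum_le_sum fun j _ =>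
        mul_le_mul_of_nonneg_left (le_max_right _ _) (stdSimplex.zero_le s j)

/-- The self-map of a simplex of the nerve that concentrates the mass on dominant classes. -/
def collapse (σ : NerveSimplex C n) (s : TopSimplex n) : TopSimplex n :=
  ⟨fun i => s i * collapseWeight σ s i / collapseTotal σ s,
    fun i => div_nonneg (mul_nonneg (stdSimplex.zero_le s i) (le_max_left _ _))
      (collapseTotal_pos σ s).le, by
    rw [← Finset.sum_div]; exact div_self (collapseTotal_pos σ s).ne'⟩

lemma collapse_apply (σ : NerveSimplex C n) (s : TopSimplex n) (i : Fin (n.len + 1)) :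
    collapse σ s i = s i * collapseWeight σ s i / collapseTotal σ s := rfl

lemma collapse_map (f : n ⟶ m) (σ : NerveSimplex C m) (s : TopSimplex n) :
    collapse σ (topSimplexMap f s) = topSimplexMap f (collapse ((nerve C).map f.op σ) s) := by
  ext k
  rw [topSimplexMap_apply, collapse_apply, collapseTotal_map, topSimplexMap_apply, Finset.sum_mul,
    Finset.sum_div]
  refine Finset.sum_congr rfl fun j hj => ?_
  rw [collapse_apply, ← (Finset.mem_filter.1 hj).2, collapseWeight_map]

lemma continuous_coord (i : Fin (n.len + 1)) : Continuous fun s : TopSimplex n => s i :=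
  (continuous_apply i).comp continuous_subtype_val

lemma continuous_classMass (σ : NerveSimplex C n) (i : Fin (n.len + 1)) :
    Continuous fun s => classMass σ s i :=
  continuous_finsetSum _ fun j _ => (continuous_coord j).mul continuous_const

lemma continuous_meanMass (σ : NerveSimplex C n) : Continuous fun s => meanMass σ s :=
  continuous_finsetSum _ fun j _ => (continuous_coord j).mul (continuous_classMass σ j)

lemma continuous_collapseWeight (σ : NerveSimplex C n) (i : Fin (n.len + 1)) :
    Continuous fun s => collapseWeight σ s i :=
  continuous_const.max ((continuous_const.mul (continuous_classMass σ i)).sub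
    (continuous_meanMass σ))

lemma continuous_collapse (σ : NerveSimplex C n) : Continuous (collapse σ) :=
  Continuous.subtype_mk (continuous_pi fun i =>
    ((continuous_coord i).mul (continuous_collapseWeight σ i)).div
      (continuous_finsetSum _ fun j _ => (continuous_coord j).mul (continuous_collapseWeight σ j))
      fun s => (collapseTotal_pos σ s).ne') _

lemma classMass_congr {σ : NerveSimplex C n} (s : TopSimplex n) {i j : Fin (n.len + 1)}
    (h : IdRel σ i j) : classMass σ s i = classMass σ s j := by
  classical
  refine Finset.sum_congr rfl fun k _ => ?_
  rw [if_congr ⟨fun hk => hk.trans h, fun hk => hk.trans h.symm⟩ rfl rfl]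

lemma classMass_add_le {σ : NerveSimplex C n} (s : TopSimplex n) {i j : Fin (n.len + 1)}
    (h : ¬ IdRel σ i j) : classMass σ s i + classMass σ s j ≤ 1 := by
  classical
  rw [classMass, classMass, ← Finset.sum_add_distrib, ← stdSimplex.sum_eq_one s]
  refine Finset.sum_le_sum fun k _ => ?_
  have := stdSimplex.zero_le s k
  by_cases hi : IdRel σ k i
  · have hj : ¬ IdRel σ k j := fun hj => h (hi.symm.trans hj)
    simp [hi, hj]
  · rw [if_neg hi]
    split_ifs <;> simp [this]

/-- The class of i alone contributes the square of its mass to the mean. -/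
lemma sq_classMass_le_meanMass (σ : NerveSimplex C n) (s : TopSimplex n) (i : Fin (n.len + 1)) :
    classMass σ s i * classMass σ s i ≤ meanMass σ s := by
  classical
  conv_lhs => rw [classMass, Finset.sum_mul]
  refine Finset.sum_le_sum fun j _ => ?_
  have h1 := stdSimplex.zero_le s j
  have h2 := classMass_nonneg σ s j
  by_cases h : IdRel σ j i
  · simp only [if_pos h, mul_one, classMass_congr s h]; exact le_rfl
  · simp only [if_neg h, mul_zero, zero_mul]; positivity

/-- A class of mass above 3/4 makes the mean exceed 9/16, while any other class has mass below 1/4,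
so its weight before truncation is below 1/2 − 9/16 < 0. Thus a whole open set of points, and not
just the vertices, has its mass moved into a single class. -/
lemma collapse_apply_eq_zero {σ : NerveSimplex C n} {s : TopSimplex n} {i j : Fin (n.len + 1)}
    (hi : 3 / 4 < classMass σ s i) (h : ¬ IdRel σ i j) : collapse σ s j = 0 := by
  have h1 := classMass_add_le s h
  have h2 := sq_classMass_le_meanMass σ s i
  have : collapseWeight σ s j = 0 := max_eq_left (by nlinarith)
  rw [collapse_apply, this, mul_zero, zero_div]

/-- All edges are identities, so σ is a degeneracy of a 0-simplex. -/
lemma simplexMap_eq_vertex_of_forall_idRel (σ : NerveSimplex C n) (h : ∀ i j, IdRel σ i j)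
    (s : TopSimplex n) (i : Fin (n.len + 1)) : simplexMap σ s = vertex (σ.obj i) := by
  have hσ : σ = (nerve C).map (SimplexCategory.const n ⦋0⦌ 0).op (nerveZero (σ.obj i)) := by
    refine CategoryTheory.Functor.ext (fun j => (h j i).1) fun j k f => ?_
    rw [Subsingleton.elim f (homOfLE (leOfHom f)), (h j k).2.1]
    have : ((nerve C).map (SimplexCategory.const n ⦋0⦌ 0).op (nerveZero (σ.obj i))).map
        (homOfLE (leOfHom f)) = 𝟙 (σ.obj i) := (nerveZero (σ.obj i)).map_id (0 : Fin 1)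
    rw [this]
    refine (eqToHom_trans (h j i).1 (h k i).1.symm).symm.trans ?_
    exact congrArg (_ ≫ ·) (Category.id_comp _).symm
  rw [hσ, simplexMap_map, simplexMap_nerveZero]
  rfl

open Classical in
/-- A monotone retraction of a finite linear order onto a nonempty subset. -/
lemma exists_monotone_retraction {N : ℕ} (S : Finset (Fin (N + 1))) (hS : S.Nonempty) :
    ∃ β : Fin (N + 1) →o Fin (N + 1), (∀ j, β j ∈ S) ∧ ∀ j ∈ S, β j = j := by
  let g : Fin (N + 1) → Fin (N + 1) := fun j =>
    if h : (S.filter (· ≤ j)).Nonempty then (S.filter (· ≤ j)).max' h else S.min' hS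
  have hg : ∀ j (h : (S.filter (· ≤ j)).Nonempty), g j = (S.filter (· ≤ j)).max' h :=
    fun j h => dif_pos h
  have hg' : ∀ j, ¬ (S.filter (· ≤ j)).Nonempty → g j = S.min' hS := fun j h => dif_neg h
  have hmem : ∀ j, g j ∈ S := fun j => by
    by_cases h : (S.filter (· ≤ j)).Nonempty
    · rw [hg j h]
      exact (Finset.mem_filter.1 (Finset.max'_mem _ h)).1
    · rw [hg' j h]
      exact Finset.min'_mem _ _
  have hmono : Monotone g := fun j k hjk => by
    have hsub : S.filter (· ≤ j) ⊆ S.filter (· ≤ k) := fun i hi =>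
      Finset.mem_filter.2 ⟨(Finset.mem_filter.1 hi).1, (Finset.mem_filter.1 hi).2.trans hjk⟩
    by_cases hj : (S.filter (· ≤ j)).Nonempty
    · rw [hg j hj, hg k (hj.mono hsub)]
      exact Finset.max'_subset _ hsub
    · rw [hg' j hj]
      exact Finset.min'_le _ _ (hmem k)
  refine ⟨⟨g, hmono⟩, hmem, fun j hj => ?_⟩
  have hne : (S.filter (· ≤ j)).Nonempty := ⟨j, by simp [hj]⟩
  refine (hg j hne).trans (le_antisymm (Finset.mem_filter.1 (Finset.max'_mem _ hne)).2
    (Finset.le_max' _ _ (by simp [hj])))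

/-- A monotone retraction onto the class of i fixes s, and pulling σ back along it gives a totally
degenerate simplex. -/
lemma simplexMap_eq_vertex_of_support (σ : NerveSimplex C n) (s : TopSimplex n)
    (i : Fin (n.len + 1)) (h : ∀ j, ¬ IdRel σ i j → s j = 0) :
    simplexMap σ s = vertex (σ.obj i) := by
  classical
  obtain ⟨β, hβ, hβ'⟩ := exists_monotone_retraction (Finset.univ.filter fun j => IdRel σ i j)
    ⟨i, by simp [IdRel.refl]⟩
  simp only [Finset.mem_filter, Finset.mem_univ, true_and] at hβ hβ'
  let f : n ⟶ n := SimplexCategory.Hom.mk β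
  have hs : topSimplexMap f s = s := by
    ext k
    rw [topSimplexMap_apply, Finset.sum_filter]
    rw [Finset.sum_congr rfl (g := fun j => if j = k then s j else 0)]
    · simp
    · intro j _
      by_cases hj : IdRel σ i j
      · have : f.toOrderHom j = j := hβ' j hj
        rw [this]
      · simp [h j hj]
  rw [← hs, ← simplexMap_map, simplexMap_eq_vertex_of_forall_idRel _ (fun j k => ?_) s i]
  · rw [nerve_map_obj]
    exact congrArg vertex ((hβ i).1).symm
  · rw [idRel_map_iff]
    exact (hβ j).symm.trans (hβ k)

end Collapse

end OmegaRes

end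
noncomputable section

namespace OmegaRes

/-! ### Paths in a space that factor through a simply connected space -/

section PathArrow

variable {S Y : Type*} [TopologicalSpace S] [TopologicalSpace Y]

/-- The morphism of the fundamental groupoid given by a path. -/
def pathArrow {x y : Y} (P : Path x y) :
    @Quiver.Hom (FundamentalGroupoid Y) CategoryStruct.toQuiver (FundamentalGroupoid.mk x)
      (FundamentalGroupoid.mk y) :=
  Path.Homotopic.Quotient.mk P

lemma pathArrow_trans {x y z : Y} (P : Path x y) (Q : Path y z) :
    pathArrow (P.trans Q) = pathArrow P ≫ pathArrow Q := rfl

lemma pathArrow_refl (x : Y) : pathArrow (Path.refl x) = 𝟙 _ := rfl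

lemma pathArrow_symm {x y : Y} (P : Path x y) :
    pathArrow P.symm = Groupoid.inv (pathArrow P) := rfl

lemma exists_pathArrow_eq {x y : Y} (p : @Quiver.Hom (FundamentalGroupoid Y)
    CategoryStruct.toQuiver (FundamentalGroupoid.mk x) (FundamentalGroupoid.mk y)) :
    ∃ P : Path x y, pathArrow P = p :=
  Path.Homotopic.Quotient.mk_surjective p

/-- The path `P` is the image of the path `Q` under the map `F`. -/
def IsImagePath (F : C(S, Y)) {a b : S} (Q : Path a b) {x y : Y} (P : Path x y) : Prop :=
  ∀ t, P t = F (Q t)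

namespace IsImagePath

variable {F : C(S, Y)} {a b c : S} {x y z : Y}

lemma source_eq {Q : Path a b} {P : Path x y} (h : IsImagePath F Q P) : x = F a := by
  simpa using h 0

lemma target_eq {Q : Path a b} {P : Path x y} (h : IsImagePath F Q P) : y = F b := by
  simpa using h 1

lemma trans {Q : Path a b} {P : Path x y} (h : IsImagePath F Q P) {Q' : Path b c} {P' : Path y z}
    (h' : IsImagePath F Q' P') : IsImagePath F (Q.trans Q') (P.trans P') := by
  intro t
  rw [Path.trans_apply, Path.trans_apply]
  split_ifs
  exacts [h _, h' _]

lemma symm {Q : Path a b} {P : Path x y} (h : IsImagePath F Q P) :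
    IsImagePath F Q.symm P.symm :=
  fun t => h (unitInterval.symm t)

/-- Paths with the same ends in a simply connected S are homotopic there. Applied to simplices and
to squares, this replaces all explicit homotopies below. -/
lemma pathArrow_eq [SimplyConnectedSpace S] {Q Q' : Path a b} {P P' : Path x y}
    (h : IsImagePath F Q P) (h' : IsImagePath F Q' P') : pathArrow P = pathArrow P' := by
  obtain rfl := h.source_eq
  obtain rfl := h.target_eq
  have hP : P = Q.map F.continuous := Path.ext (funext h)
  have hP' : P' = Q'.map F.continuous := Path.ext (funext h')
  rw [hP, hP']
  exact Quotient.sound ((SimplyConnectedSpace.paths_homotopic Q Q').map F)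

lemma pathArrow_comp [SimplyConnectedSpace S] {Q : Path a b} {Q' : Path b c} {Q'' : Path a c}
    {P : Path x y} {P' : Path y z} {P'' : Path x z}
    (h : IsImagePath F Q P) (h' : IsImagePath F Q' P') (h'' : IsImagePath F Q'' P'') :
    pathArrow P ≫ pathArrow P' = pathArrow P'' :=
  (h.trans h').pathArrow_eq h''

end IsImagePath

end PathArrow

instance : ContractibleSpace unitInterval :=
  (convex_Icc (0 : ℝ) 1).contractibleSpace ⟨0, by simp⟩

/-! ### The functor from the free groupoid to the fundamental groupoid -/

section EdgePath

variable {n m : SimplexCategory}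

instance (n : SimplexCategory) : ContractibleSpace (TopSimplex n) :=
  (convex_stdSimplex ℝ _).contractibleSpace ⟨_, (stdSimplex.vertex (0 : Fin (n.len + 1))).2⟩

/-- The straight path between two points of a simplex. -/
def simplexLine (s s' : TopSimplex n) : Path s s' where
  toFun u := ⟨fun i => (1 - (u : ℝ)) * s i + u * s' i,
    convex_stdSimplex ℝ _ s.2 s'.2 (sub_nonneg.2 u.2.2) u.2.1 (by ring)⟩
  continuous_toFun := Continuous.subtype_mk (by fun_prop) _
  source' := by ext i; simp; rfl
  target' := by ext i; simp; rfl

lemma simplexLine_apply (s s' : TopSimplex n) (u : unitInterval) (i : Fin (n.len + 1)) :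
    simplexLine s s' u i = (1 - (u : ℝ)) * s i + u * s' i := rfl

lemma topSimplexMap_simplexLine (f : n ⟶ m) (s s' : TopSimplex n) (u : unitInterval) :
    topSimplexMap f (simplexLine s s' u) =
      simplexLine (topSimplexMap f s) (topSimplexMap f s') u := by
  ext k
  simp only [topSimplexMap_apply, simplexLine_apply, Finset.sum_add_distrib, Finset.mul_sum]

variable {C : Type u} [SmallCategory C]

/-- The `1`-simplex of the nerve given by a morphism. -/
def nerveOne {c d : C} (f : c ⟶ d) : NerveSimplex C ⦋1⦌ := ComposableArrows.mk₁ f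

/-- The path in the realization given by a morphism. -/
def edgePath {c d : C} (f : c ⟶ d) : Path (vertex c) (vertex d) :=
  ((simplexLine (n := ⦋1⦌) (stdSimplex.vertex 0) (stdSimplex.vertex 1)).map
    (simplexMap (nerveOne f)).continuous).cast
      (simplexMap_vertex (nerveOne f) 0).symm (simplexMap_vertex (nerveOne f) 1).symm

lemma isImagePath_edgePath {c d : C} (f : c ⟶ d) :
    IsImagePath (simplexMap (nerveOne f))
      (simplexLine (n := ⦋1⦌) (stdSimplex.vertex 0) (stdSimplex.vertex 1)) (edgePath f) :=
  fun _ => rfl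

/-- The path in the realization given by two vertices of a simplex. -/
def simplexEdge (σ : NerveSimplex C n) (i j : Fin (n.len + 1)) :
    Path (vertex (σ.obj i)) (vertex (σ.obj j)) :=
  ((simplexLine (stdSimplex.vertex i) (stdSimplex.vertex j)).map
    (simplexMap σ).continuous).cast (simplexMap_vertex σ i).symm (simplexMap_vertex σ j).symm

lemma isImagePath_simplexEdge (σ : NerveSimplex C n) (i j : Fin (n.len + 1)) :
    IsImagePath (simplexMap σ) (simplexLine (stdSimplex.vertex i) (stdSimplex.vertex j))
      (simplexEdge σ i j) :=
  fun _ => rfl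

lemma simplexEdge_eq_edgePath (σ : NerveSimplex C n) {i j : Fin (n.len + 1)} (hij : i ≤ j) :
    simplexEdge σ i j = edgePath (σ.map (homOfLE hij)) := by
  let δ : ⦋1⦌ ⟶ n := SimplexCategory.mkOfLe i j hij
  have hδ : (nerve C).map δ.op σ = nerveOne (σ.map (homOfLE hij)) :=
    ComposableArrows.ext₁ rfl rfl ((Category.id_comp _).trans (Category.comp_id _)).symm
  ext u
  rw [isImagePath_simplexEdge, isImagePath_edgePath, ← hδ, simplexMap_map,
    topSimplexMap_simplexLine]
  have h0 : topSimplexMap δ (stdSimplex.vertex 0) = stdSimplex.vertex i := stdSimplex.map_vertex ..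
  have h1 : topSimplexMap δ (stdSimplex.vertex 1) = stdSimplex.vertex j := stdSimplex.map_vertex ..
  rw [h0, h1]

/-- The functor to the fundamental groupoid of the realization, sending a morphism to the class of
the corresponding edge. -/
def edgeFunctor (C : Type u) [SmallCategory C] : C ⥤ FundamentalGroupoid (geomReal C) where
  obj c := FundamentalGroupoid.mk (vertex c)
  map f := pathArrow (edgePath f)
  map_id c := by
    have h := simplexEdge_eq_edgePath (nerveZero c) (le_refl 0)
    have h1 : (nerveZero c).map (homOfLE (le_refl (0 : Fin 1))) = 𝟙 c := (nerveZero c).map_id _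
    rw [← pathArrow_refl]
    refine congrArg pathArrow ?_
    ext u
    have h2 := DFunLike.congr_fun h u
    rw [isImagePath_simplexEdge, simplexMap_nerveZero] at h2
    refine Eq.trans ?_ h2.symm
    exact (congrArg (fun f => edgePath f u) h1).symm
  map_comp {c d e} f g := by
    let σ : NerveSimplex C ⦋2⦌ := ComposableArrows.mk₂ f g
    have h01 : simplexEdge σ 0 1 = edgePath f := simplexEdge_eq_edgePath σ (by decide)
    have h12 : simplexEdge σ 1 2 = edgePath g := simplexEdge_eq_edgePath σ (by decide)
    have h02 : simplexEdge σ 0 2 = edgePath (f ≫ g) := simplexEdge_eq_edgePath σ (by decide)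
    have := (isImagePath_simplexEdge σ 0 1).pathArrow_comp (isImagePath_simplexEdge σ 1 2)
      (isImagePath_simplexEdge σ 0 2)
    rw [← h01, ← h12, ← h02]
    exact this.symm

/-- The functor from the free groupoid to the fundamental groupoid of the realization. -/
def zigzagFunctor (C : Type u) [SmallCategory C] :
    FreeGroupoid C ⥤ FundamentalGroupoid (geomReal C) :=
  FreeGroupoid.lift (edgeFunctor C)

lemma zigzagFunctor_map_homMk {c d : C} (f : c ⟶ d) :
    (zigzagFunctor C).map (FreeGroupoid.homMk f) = pathArrow (edgePath f) :=
  FreeGroupoid.lift_map_homMk _ f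

lemma exists_zigzag_simplexEdge (σ : NerveSimplex C n) (i j : Fin (n.len + 1)) :
    ∃ z : FreeGroupoid.mk (σ.obj i) ⟶ FreeGroupoid.mk (σ.obj j),
      (zigzagFunctor C).map z = pathArrow (simplexEdge σ i j) := by
  rcases le_total i j with h | h
  · exact ⟨FreeGroupoid.homMk (σ.map (homOfLE h)), by
      rw [simplexEdge_eq_edgePath σ h, zigzagFunctor_map_homMk]⟩
  · refine ⟨Groupoid.inv (FreeGroupoid.homMk (σ.map (homOfLE h))), ?_⟩
    rw [Groupoid.inv_eq_inv, Functor.map_inv, ← Groupoid.inv_eq_inv]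
    refine (congrArg Groupoid.inv (zigzagFunctor_map_homMk _)).trans ?_
    rw [← simplexEdge_eq_edgePath σ h]
    refine (pathArrow_symm _).symm.trans ?_
    exact (isImagePath_simplexEdge σ j i).symm.pathArrow_eq (isImagePath_simplexEdge σ i j)

end EdgePath

end OmegaRes

end
noncomputable section

namespace OmegaRes

/-! ### Contracting open sets of the realization of a nerve -/

section Contraction

variable {n m : SimplexCategory} {C : Type u} [SmallCategory C]

/-- The admissible lengths of initial segments. -/
structure InitialLength where
  /-- The length. -/
  val : ℝ
  pos : 0 < val
  le_one : val ≤ 1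

/-- The point of a simplex towards which the deformation moves. -/
def concentrate (b : InitialLength) (σ : NerveSimplex C n) (s : TopSimplex n) : TopSimplex n :=
  collapse σ (initialLaw b.pos b.le_one s)

lemma concentrate_map (b : InitialLength) (f : n ⟶ m) (σ : NerveSimplex C m) (s : TopSimplex n) :
    concentrate b σ (topSimplexMap f s) =
      topSimplexMap f (concentrate b ((nerve C).map f.op σ) s) := by
  rw [concentrate, initialLaw_map, collapse_map, concentrate]

lemma continuous_concentrate (b : InitialLength) (σ : NerveSimplex C n) :
    Continuous (concentrate b σ) :=
  (continuous_collapse σ).comp (continuous_initialLaw b.pos b.le_one)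

variable (C) in
/-- The straight-line deformation of the realization. -/
lemma exists_deformation (b : InitialLength) :
    ∃ H : C(geomReal C, C(unitInterval, geomReal C)), ∀ (n : SimplexCategory)
      (σ : NerveSimplex C n) (s : TopSimplex n) (u : unitInterval),
      H (simplexMap σ s) u = simplexMap σ (simplexLine s (concentrate b σ s) u) := by
  have hc : ∀ (n : SimplexCategory) (σ : NerveSimplex C n),
      Continuous fun p : TopSimplex n × unitInterval =>
        simplexLine p.1 (concentrate b σ p.1) p.2 := fun n σ => by
    refine Continuous.subtype_mk (continuous_pi fun i => ?_) _
    have h1 : Continuous fun p : TopSimplex n × unitInterval => p.1 i :=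
      (continuous_coord i).comp continuous_fst
    have h2 : Continuous fun p : TopSimplex n × unitInterval => concentrate b σ p.1 i :=
      (continuous_coord i).comp ((continuous_concentrate b σ).comp continuous_fst)
    have h3 : Continuous fun p : TopSimplex n × unitInterval => (p.2 : ℝ) :=
      continuous_subtype_val.comp continuous_snd
    exact ((continuous_const.sub h3).mul h1).add (h3.mul h2)
  -- Maps glue over simplices only out of the realization itself, not out of its product with the
  -- interval, so the homotopy is curried.
  obtain ⟨H, hH⟩ := exists_desc (X := nerve C) (Y := C(unitInterval, geomReal C))
    (fun n σ => ContinuousMap.curry ((simplexMap σ).comp ⟨_, hc n σ⟩)) (fun f σ s => by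
      ext u
      have h := topSimplexMap_simplexLine f s (concentrate b ((nerve C).map f.op σ) s) u
      rw [← concentrate_map] at h
      exact (simplexMap_map f σ _).trans (congrArg _ h))
  exact ⟨H, fun n σ s u => DFunLike.congr_fun (hH n σ s) u⟩

/-- The straight-line deformation of the realization. -/
def deformation (b : InitialLength) : C(geomReal C, C(unitInterval, geomReal C)) :=
  (exists_deformation C b).choose

lemma deformation_simplexMap (b : InitialLength) (σ : NerveSimplex C n) (s : TopSimplex n)
    (u : unitInterval) :
    deformation b (simplexMap σ s) u = simplexMap σ (simplexLine s (concentrate b σ s) u) :=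
  (exists_deformation C b).choose_spec n σ s u

lemma deformation_zero (b : InitialLength) (y : geomReal C) : deformation b y 0 = y := by
  obtain ⟨n, σ, s, rfl⟩ := exists_simplexMap_eq y
  rw [deformation_simplexMap, Path.source]

/-- A point of a simplex is dominated by `c` if a class of vertices at `c` has mass more than `3/4`
in the initial segment. -/
def IsDominated (b : InitialLength) (c : C) (σ : NerveSimplex C n) (s : TopSimplex n)
    (i : Fin (n.len + 1)) : Prop :=
  σ.obj i = c ∧ 3 / 4 < classMass σ (initialLaw b.pos b.le_one s) i

lemma exists_idRel_of_classMass_pos (f : n ⟶ m) (σ : NerveSimplex C m) (s : TopSimplex n)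
    (k : Fin (m.len + 1)) (h : 0 < classMass σ (topSimplexMap f s) k) :
    ∃ j, IdRel σ (f.toOrderHom j) k := by
  by_contra! hn
  rw [classMass, sum_topSimplexMap_mul, Finset.sum_eq_zero] at h
  · exact h.false
  · intro j _
    rw [if_neg (hn j), mul_zero]

/-- Mass pushed forward along f sits on the image of f, so a class with positive mass meets that
image. Domination is thus independent of the simplex used to represent a point. -/
lemma exists_isDominated_map_iff (b : InitialLength) (c : C) (f : n ⟶ m) (σ : NerveSimplex C m)
    (s : TopSimplex n) :
    (∃ i, IsDominated b c ((nerve C).map f.op σ) s i) ↔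
      ∃ k, IsDominated b c σ (topSimplexMap f s) k := by
  constructor
  · rintro ⟨i, hc, hi⟩
    refine ⟨f.toOrderHom i, hc, ?_⟩
    rwa [initialLaw_map, classMass_map]
  · rintro ⟨k, hc, hk⟩
    rw [initialLaw_map] at hk
    obtain ⟨j, hj⟩ := exists_idRel_of_classMass_pos f σ _ k (by linarith)
    refine ⟨j, hj.1.trans hc, ?_⟩
    rwa [← classMass_map, classMass_congr _ hj]

lemma isOpen_exists_isDominated (b : InitialLength) (c : C) (σ : NerveSimplex C n) :
    IsOpen (Set.ofPred fun s : TopSimplex n => ∃ i, IsDominated b c σ s i) := by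
  have : (Set.ofPred fun s : TopSimplex n => ∃ i, IsDominated b c σ s i) =
      ⋃ i, Set.ofPred fun s : TopSimplex n => IsDominated b c σ s i := by
    ext s; simp
  rw [this]
  refine isOpen_iUnion fun i => ?_
  by_cases h : σ.obj i = c
  · have hcont : Continuous fun s : TopSimplex n => classMass σ (initialLaw b.pos b.le_one s) i :=
      (continuous_classMass σ i).comp (continuous_initialLaw b.pos b.le_one)
    convert! isOpen_lt continuous_const hcont using 1
    ext s
    exact ⟨fun hs => hs.2, fun hs => ⟨h, hs⟩⟩
  · convert! isOpen_empty using 1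
    ext s
    exact ⟨fun hs => h hs.1, fun hs => hs.elim⟩

/-- The open set of points dominated by `c`. -/
def dominatedSet (b : InitialLength) (c : C) : Set (geomReal C) :=
  Set.ofPred fun y => ∃ (n : SimplexCategory) (σ : NerveSimplex C n) (s : TopSimplex n),
    simplexMap σ s = y ∧ ∃ i, IsDominated b c σ s i

lemma simplexMap_mem_dominatedSet (b : InitialLength) (c : C) (σ : NerveSimplex C n)
    (s : TopSimplex n) :
    simplexMap σ s ∈ dominatedSet b c ↔ ∃ i, IsDominated b c σ s i := by
  -- Being natural, the predicate descends to |C| as a map to an indiscrete space.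
  let : TopologicalSpace (ULift.{u} Prop) := ⊤
  obtain ⟨G, hG⟩ := exists_desc (X := nerve C) (Y := ULift.{u} Prop)
    (fun n σ => ⟨fun s => ⟨∃ i, IsDominated b c σ s i⟩, continuous_top⟩)
    (fun f σ s => congrArg ULift.up (propext (exists_isDominated_map_iff b c f σ s)))
  constructor
  · rintro ⟨n', σ', s', h, h'⟩
    have h1 := congrArg ULift.down (hG _ σ s)
    have h2 := congrArg ULift.down (hG _ σ' s')
    rw [h] at h2
    exact cast (h2.symm.trans h1) h'
  · exact fun h => ⟨n, σ, s, rfl, h⟩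

lemma isOpen_dominatedSet (b : InitialLength) (c : C) : IsOpen (dominatedSet b c) := by
  refine isOpen_of_isOpen_preimage_simplexMap fun n σ => ?_
  convert! isOpen_exists_isDominated b c σ using 1
  ext s
  exact simplexMap_mem_dominatedSet b c σ s

/-- Take b to be the first nonzero coordinate: the initial law is then concentrated at that vertex,
whose class has mass at least 1. The length b depends on the point, which is why the cover is
indexed by b as well as by objects. -/
lemma exists_mem_dominatedSet (y : geomReal C) : ∃ b c, y ∈ dominatedSet b c := by
  obtain ⟨n, σ, s, rfl⟩ := exists_simplexMap_eq y
  have hne : (Finset.univ.filter fun i => s i ≠ 0).Nonempty := by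
    by_contra h
    have h0 : ∀ i, s i = 0 := by simpa [Finset.not_nonempty_iff_eq_empty,
      Finset.filter_eq_empty_iff] using h
    have := stdSimplex.sum_eq_one s
    simp [h0] at this
  set i := Finset.min' _ hne
  have hi : s i ≠ 0 := (Finset.mem_filter.1 (Finset.min'_mem _ hne)).2
  have hi' : ∀ j < i, s j = 0 := fun j hj => by
    by_contra h
    exact hj.not_ge (Finset.min'_le _ _ (by simpa using h))
  let b : InitialLength :=
    ⟨s i, lt_of_le_of_ne (stdSimplex.zero_le s i) hi.symm, stdSimplex.le_one s i⟩
  refine ⟨b, σ.obj i, (simplexMap_mem_dominatedSet _ _ _ _).2 ⟨i, rfl, ?_⟩⟩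
  rw [initialLaw_eq_vertex b.pos b.le_one s i rfl hi']
  refine lt_of_lt_of_le ?_ (le_classMass _ _ _)
  rw [stdSimplex.vertex_coe, Pi.single_eq_same]
  norm_num

/-- Both ends of the segment are supported on the class of i, a face that |C| collapses to a point.
Hence the deformation ends at the vertex exactly. -/
lemma IsDominated.simplexMap_line {b : InitialLength} {c : C} {σ : NerveSimplex C n}
    {s : TopSimplex n} {i : Fin (n.len + 1)} (h : IsDominated b c σ s i) (u : unitInterval) :
    simplexMap σ (simplexLine (concentrate b σ s) (stdSimplex.vertex i) u) = vertex c := by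
  rw [simplexMap_eq_vertex_of_support σ _ i, h.1]
  intro j hj
  rw [simplexLine_apply, concentrate, collapse_apply_eq_zero h.2 hj, stdSimplex.vertex_coe,
    Pi.single_eq_of_ne, mul_zero, mul_zero, add_zero]
  rintro rfl
  exact hj (.refl _ _)

lemma deformation_one_of_mem {b : InitialLength} {c : C} {y : geomReal C}
    (h : y ∈ dominatedSet b c) : deformation b y 1 = vertex c := by
  obtain ⟨n, σ, s, rfl⟩ := exists_simplexMap_eq y
  obtain ⟨i, hi⟩ := (simplexMap_mem_dominatedSet _ _ _ _).1 h
  rw [deformation_simplexMap, Path.target, ← hi.simplexMap_line 0, Path.source]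

/-- The track of a dominated point under the deformation. -/
def track {b : InitialLength} {c : C} {y : geomReal C} (h : y ∈ dominatedSet b c) :
    Path y (vertex c) where
  toFun := deformation b y
  continuous_toFun := (deformation b y).continuous
  source' := deformation_zero b y
  target' := deformation_one_of_mem h

lemma isImagePath_track {b : InitialLength} {c : C} {σ : NerveSimplex C n} {s : TopSimplex n}
    (h : simplexMap σ s ∈ dominatedSet b c) :
    IsImagePath (simplexMap σ) (simplexLine s (concentrate b σ s)) (track h) :=
  deformation_simplexMap b σ s

/-- The path from a point of a simplex to a vertex. -/
def toVertex (σ : NerveSimplex C n) (s : TopSimplex n) (i : Fin (n.len + 1)) :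
    Path (simplexMap σ s) (vertex (σ.obj i)) :=
  ((simplexLine s (stdSimplex.vertex i)).map (simplexMap σ).continuous).cast
    rfl (simplexMap_vertex σ i).symm

lemma isImagePath_toVertex (σ : NerveSimplex C n) (s : TopSimplex n) (i : Fin (n.len + 1)) :
    IsImagePath (simplexMap σ) (simplexLine s (stdSimplex.vertex i)) (toVertex σ s i) :=
  fun _ => rfl

lemma IsDominated.pathArrow_track {b : InitialLength} {σ : NerveSimplex C n}
    {s : TopSimplex n} {i : Fin (n.len + 1)} (hi : IsDominated b (σ.obj i) σ s i)
    (h : simplexMap σ s ∈ dominatedSet b (σ.obj i)) :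
    pathArrow (track h) = pathArrow (toVertex σ s i) := by
  have h1 : IsImagePath (simplexMap σ) (simplexLine (concentrate b σ s) (stdSimplex.vertex i))
      (Path.refl (vertex (σ.obj i))) := fun u => (hi.simplexMap_line u).symm
  rw [← (isImagePath_track h).pathArrow_comp h1 (isImagePath_toVertex σ s i), pathArrow_refl,
    Category.comp_id]

/-- The point y lies in one simplex having both c and c' among its vertices. Inside that simplex the
two tracks are homotopic to straight lines and differ by an edge. -/
lemma exists_zigzag_track {b b' : InitialLength} {c c' : C} {y : geomReal C}
    (h : y ∈ dominatedSet b c) (h' : y ∈ dominatedSet b' c') :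
    ∃ z : FreeGroupoid.mk c ⟶ FreeGroupoid.mk c',
      pathArrow (track h) ≫ (zigzagFunctor C).map z = pathArrow (track h') := by
  obtain ⟨n, σ, s, rfl⟩ := exists_simplexMap_eq y
  obtain ⟨i, hi⟩ := (simplexMap_mem_dominatedSet _ _ _ _).1 h
  obtain ⟨i', hi'⟩ := (simplexMap_mem_dominatedSet _ _ _ _).1 h'
  obtain rfl := hi.1
  obtain rfl := hi'.1
  obtain ⟨z, hz⟩ := exists_zigzag_simplexEdge σ i i'
  refine ⟨z, ?_⟩
  rw [hi.pathArrow_track h, hi'.pathArrow_track h', hz]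
  exact (isImagePath_toVertex σ s i).pathArrow_comp (isImagePath_simplexEdge σ i i')
    (isImagePath_toVertex σ s i')

lemma exists_zigzag_track_vertex {b : InitialLength} {c d : C}
    (h : vertex d ∈ dominatedSet b c) :
    ∃ z : FreeGroupoid.mk d ⟶ FreeGroupoid.mk c,
      (zigzagFunctor C).map z = pathArrow (track h) := by
  have key : ∀ s : TopSimplex ⦋0⦌, simplexMap (nerveZero d) s = vertex d := simplexMap_nerveZero d
  obtain ⟨s⟩ : Nonempty (TopSimplex ⦋0⦌) := ⟨stdSimplex.vertex 0⟩
  have h2 := h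
  rw [← key s] at h2
  obtain ⟨i, hi⟩ := (simplexMap_mem_dominatedSet _ _ _ _).1 h2
  obtain rfl : d = c := hi.1
  refine ⟨𝟙 _, ?_⟩
  refine ((zigzagFunctor C).map_id _).trans (congrArg pathArrow (a₁ := Path.refl _) ?_)
  ext u
  refine (key _).symm.trans (Eq.trans (deformation_simplexMap b (nerveZero d) s u).symm ?_)
  rw [key]
  rfl

/-- Inside a dominated set, a path is homotopic to the composite of two tracks. -/
lemma pathArrow_comp_track {b : InitialLength} {c : C} {x y : geomReal C} (P : Path x y)
    (hP : ∀ t, P t ∈ dominatedSet b c) (hx : x ∈ dominatedSet b c) (hy : y ∈ dominatedSet b c) :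
    pathArrow P ≫ pathArrow (track hy) = pathArrow (track hx) := by
  -- The deformation of P is a square with bottom side P, vertical sides the two tracks and constant
  -- top side.
  let F : C(unitInterval × unitInterval, geomReal C) :=
    ⟨fun p => deformation b (P p.1) p.2, by fun_prop⟩
  let bot : Path ((0, 0) : unitInterval × unitInterval) (1, 0) :=
    { toFun := fun t => (t, 0), continuous_toFun := by fun_prop, source' := rfl, target' := rfl }
  let right : Path ((1, 0) : unitInterval × unitInterval) (1, 1) :=
    { toFun := fun t => (1, t), continuous_toFun := by fun_prop, source' := rfl, target' := rfl }
  let left : Path ((0, 0) : unitInterval × unitInterval) (0, 1) :=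
    { toFun := fun t => (0, t), continuous_toFun := by fun_prop, source' := rfl, target' := rfl }
  let top : Path ((0, 1) : unitInterval × unitInterval) (1, 1) :=
    { toFun := fun t => (t, 1), continuous_toFun := by fun_prop, source' := rfl, target' := rfl }
  have hbot : IsImagePath F bot P := fun t => (deformation_zero b (P t)).symm
  have hright : IsImagePath F right (track hy) := fun t => by
    change _ = deformation b (P 1) t
    rw [P.target]; rfl
  have hleft : IsImagePath F left (track hx) := fun t => by
    change _ = deformation b (P 0) t
    rw [P.source]; rfl
  have htop : IsImagePath F top (Path.refl (vertex c)) := fun t =>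
    (deformation_one_of_mem (hP t)).symm
  have := (hbot.trans hright).pathArrow_eq (hleft.trans htop)
  rwa [pathArrow_trans, pathArrow_trans, pathArrow_refl, Category.comp_id] at this

lemma comp_comp_eq_of_comp_eq {D : Type*} [Category* D] {X₀ X₁ X₂ Y Z : D} {q₀ : X₀ ⟶ X₁}
    {r : X₁ ⟶ X₂} {q : X₀ ⟶ X₂} {t₀ : X₁ ⟶ Y} {t₁ : X₂ ⟶ Y} {z : Y ⟶ Z} {t : X₂ ⟶ Z}
    (h₁ : r ≫ t₁ = t₀) (h₂ : t₁ ≫ z = t) (h₃ : q₀ ≫ r = q) :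
    (q₀ ≫ t₀) ≫ z = q ≫ t := by
  subst h₁ h₂ h₃
  simp

/-- Subdivide P so that each piece lies in one dominated set. There the piece is homotopic to the
track of its start followed by the reversed track of its end, and changing the track at a
subdivision point costs only an edge of a simplex. -/
theorem exists_zigzag_eq_pathArrow {c d : C} (P : Path (vertex c) (vertex d)) :
    ∃ z : FreeGroupoid.mk c ⟶ FreeGroupoid.mk d,
      (zigzagFunctor C).map z = pathArrow P := by
  obtain ⟨t, ht0, htm, ⟨N, hN⟩, ht⟩ := exists_monotone_Icc_subset_open_cover_unitInterval
    (c := fun e : InitialLength × C => P ⁻¹' dominatedSet e.1 e.2)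
    (fun e => (isOpen_dominatedSet e.1 e.2).preimage P.continuous)
    (fun u _ => by
      obtain ⟨b, c, h⟩ := exists_mem_dominatedSet (P u)
      exact Set.mem_iUnion.2 ⟨(b, c), h⟩)
  -- The initial part of P up to `t k` followed by any track is a zigzag. The initial part is
  -- represented by any Q that is the image under P of a path in the interval; all such Q are
  -- homotopic.
  have key : ∀ k : ℕ, ∀ (y : geomReal C) (_ : P (t k) = y) (Q : Path (vertex c) y)
      (Q' : Path (0 : unitInterval) (t k)) (_ : IsImagePath (P : C(unitInterval, geomReal C)) Q' Q)
      (b : InitialLength) (e : C) (hy : y ∈ dominatedSet b e),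
      ∃ z : FreeGroupoid.mk c ⟶ FreeGroupoid.mk e,
        (zigzagFunctor C).map z = pathArrow Q ≫ pathArrow (track hy) := by
    intro k
    induction k with
    | zero =>
      intro y hPy Q Q' hQ b e hy
      generalize t 0 = t₀ at *
      subst ht0
      obtain rfl : vertex c = y := P.source.symm.trans hPy
      have h1 : IsImagePath (P : C(unitInterval, geomReal C)) (Path.refl 0)
          (Path.refl (vertex c)) := fun _ => P.source.symm
      rw [hQ.pathArrow_eq h1, pathArrow_refl, Category.id_comp]
      exact exists_zigzag_track_vertex hy
    | succ k ih =>
      intro y hPy Q Q' hQ b e hy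
      obtain ⟨⟨b₀, e₀⟩, hsub⟩ := ht k
      have hle := htm k.le_succ
      have hy₀ : P (t k) ∈ dominatedSet b₀ e₀ := hsub (Set.left_mem_Icc.2 hle)
      have hy₁ : y ∈ dominatedSet b₀ e₀ := hPy ▸ hsub (Set.right_mem_Icc.2 hle)
      let Q₀' : Path 0 (t k) := PathConnectedSpace.somePath 0 (t k)
      let Q₀ : Path (vertex c) (P (t k)) := (Q₀'.map P.continuous).cast P.source.symm rfl
      have hQ₀ : IsImagePath (P : C(unitInterval, geomReal C)) Q₀' Q₀ := fun _ => rfl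
      obtain ⟨z₀, hz₀⟩ := ih _ rfl Q₀ Q₀' hQ₀ b₀ e₀ hy₀
      let R' : Path (t k) (t (k + 1)) :=
        { toFun := Set.Icc.convexComb (t k) (t (k + 1))
          continuous_toFun := by fun_prop
          source' := by simp
          target' := by simp }
      let R : Path (P (t k)) y := (R'.map P.continuous).cast rfl hPy.symm
      have hR : IsImagePath (P : C(unitInterval, geomReal C)) R' R := fun _ => rfl
      have hRV : ∀ u, R u ∈ dominatedSet b₀ e₀ := fun u =>
        hsub ⟨Set.Icc.le_convexComb hle u, Set.Icc.convexComb_le hle u⟩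
      obtain ⟨z₁, hz₁⟩ := exists_zigzag_track hy₁ hy
      refine ⟨z₀ ≫ z₁, ?_⟩
      have h₁ := pathArrow_comp_track R hRV hy₀ hy₁
      have h₂ := hQ₀.pathArrow_comp hR hQ
      refine ((zigzagFunctor C).map_comp z₀ z₁).trans ?_
      rw [hz₀]
      exact comp_comp_eq_of_comp_eq h₁ hz₁ h₂
  obtain ⟨b, e, h⟩ := exists_mem_dominatedSet (vertex d)
  have hN1 := hN N le_rfl
  let Q' : Path 0 (t N) :=
    { toFun := id, continuous_toFun := continuous_id, source' := rfl, target' := hN1.symm }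
  obtain ⟨z, hz⟩ := key N (vertex d) (by rw [hN1, P.target]) P Q' (fun _ => rfl) b e h
  obtain ⟨z', hz'⟩ := exists_zigzag_track_vertex h
  refine ⟨z ≫ inv z', ?_⟩
  rw [Functor.map_comp, Functor.map_inv]
  exact (IsIso.comp_inv_eq _).2 (hz.trans (congrArg (pathArrow P ≫ ·) hz'.symm))

end Contraction

end OmegaRes

end
noncomputable section

namespace OmegaRes

/-! ### The one-object groupoid of a group -/

instance BCat.groupoid (G : Type u) [Group G] : Groupoid (BCat G) where
  inv f := (show G from f)⁻¹
  inv_comp f := mul_inv_cancel (show G from f)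
  comp_inv f := inv_mul_cancel (show G from f)

/-- The group element given by a morphism of `B(G)`. -/
def BCat.val {G : Type u} [Group G] {a b : BCat G} (f : a ⟶ b) : G := f

namespace BCat

variable {G : Type u} [Group G] {a b c : BCat G}

@[simp] lemma val_id : val (𝟙 a) = (1 : G) := rfl

@[simp] lemma val_comp (f : a ⟶ b) (g : b ⟶ c) : val (f ≫ g) = val g * val f := rfl

@[simp] lemma val_groupoid_inv (f : a ⟶ b) : val (Groupoid.inv f) = (val f)⁻¹ := rfl

@[simp] lemma val_inv (f : a ⟶ b) : val (inv f) = (val f)⁻¹ := by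
  rw [← Groupoid.inv_eq_inv, val_groupoid_inv]

lemma val_injective {f g : a ⟶ b} (h : val f = val g) : f = g := h

end BCat

/-! ### Step functions with values in a group -/

/-- Functions from the unit interval to a group. Two functions are close if they agree outside a
set of small measure. -/
def StepFun (G : Type u) : Type u := Set.Ico (0 : ℝ) 1 → G

namespace StepFun

variable {G : Type u}

/-- The set of points where two functions differ. -/
def diffSet (f f' : StepFun G) : Set ℝ := Subtype.val '' (Set.ofPred fun x => f x ≠ f' x)

lemma mem_diffSet {f f' : StepFun G} {x : ℝ} :
    x ∈ diffSet f f' ↔ ∃ hx : x ∈ Set.Ico (0 : ℝ) 1, f ⟨x, hx⟩ ≠ f' ⟨x, hx⟩ := by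
  constructor
  · rintro ⟨y, hy, rfl⟩
    exact ⟨y.2, hy⟩
  · rintro ⟨hx, h⟩
    exact ⟨⟨x, hx⟩, h, rfl⟩

/-- No measurability is needed: monotonicity and subadditivity of outer measure suffice. -/
instance : PseudoEMetricSpace (StepFun G) where
  edist f f' := MeasureTheory.volume (diffSet f f')
  edist_self f := by
    have : diffSet f f = ∅ := by
      ext x
      simp [mem_diffSet]
    rw [this, MeasureTheory.measure_empty]
  edist_comm f f' := by
    congr 1
    ext x
    simp [mem_diffSet, ne_comm]
  edist_triangle f f' f'' := by
    refine (MeasureTheory.measure_mono ?_).trans (MeasureTheory.measure_union_le _ _)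
    intro x hx
    obtain ⟨hx, h⟩ := mem_diffSet.1 hx
    by_cases h' : f ⟨x, hx⟩ = f' ⟨x, hx⟩
    · exact Or.inr (mem_diffSet.2 ⟨hx, h' ▸ h⟩)
    · exact Or.inl (mem_diffSet.2 ⟨hx, h'⟩)

lemma edist_def (f f' : StepFun G) : edist f f' = MeasureTheory.volume (diffSet f f') := rfl

variable [Group G]

instance : MulAction G (StepFun G) where
  smul g f := fun x => g * f x
  one_smul f := funext fun x => one_mul (f x)
  mul_smul g h f := funext fun x => mul_assoc g h (f x)

lemma smul_apply (g : G) (f : StepFun G) (x : Set.Ico (0 : ℝ) 1) : (g • f) x = g * f x := rfl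

lemma edist_smul_smul (g : G) (f f' : StepFun G) : edist (g • f) (g • f') = edist f f' := by
  rw [edist_def, edist_def]
  congr 1
  ext x
  simp [mem_diffSet, smul_apply]

lemma edist_smul_self {g : G} (hg : g ≠ 1) (f : StepFun G) : edist (g • f) f = 1 := by
  rw [edist_def]
  have : diffSet (g • f) f = Set.Ico (0 : ℝ) 1 := by
    ext x
    simp [mem_diffSet, smul_apply, hg]
  rw [this]
  simp

instance : ContinuousConstSMul G (StepFun G) where
  continuous_const_smul g := by
    refine Isometry.continuous (fun f f' => edist_smul_smul g f f')

variable (G) in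
/-- The space of step functions modulo the group. -/
abbrev Quot : Type u := MulAction.orbitRel.Quotient G (StepFun G)

variable (G) in
/-- The projection from step functions. -/
def proj : C(StepFun G, Quot G) := ⟨Quotient.mk _, continuous_quotient_mk'⟩

lemma proj_smul (g : G) (f : StepFun G) : proj G (g • f) = proj G f :=
  Quotient.sound ⟨g, rfl⟩

variable (G) in
lemma isQuotientCoveringMap_proj : IsQuotientCoveringMap (proj G) G where
  toIsQuotientMap := isQuotientMap_quotient_mk'
  toContinuousConstSMul := inferInstance
  apply_eq_iff_mem_orbit {f f'} := Quotient.eq''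
  disjoint f := by
    -- A nontrivial g changes f at every point and so moves it by distance exactly 1; a ball of
    -- radius 1/2 cannot meet its translate.
    refine ⟨Metric.eball f (1 / 2), Metric.eball_mem_nhds _ (by norm_num), ?_⟩
    rintro g ⟨_, ⟨f', hf', rfl⟩, hg⟩
    by_contra hne
    have h1 : edist (g • f) f < 1 / 2 + 1 / 2 := by
      refine (edist_triangle _ (g • f') _).trans_lt (ENNReal.add_lt_add ?_ hg)
      rw [edist_smul_smul, edist_comm]
      exact hf'
    rw [edist_smul_self hne, ENNReal.add_halves] at h1
    exact h1.false

variable (G) in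
lemma isCoveringMap_proj : IsCoveringMap (proj G) := (isQuotientCoveringMap_proj G).isCoveringMap

variable (G) in
/-- The constant function with value `1`. -/
def unit : StepFun G := fun _ => 1

lemma smul_unit_injective : Function.Injective fun g : G => g • unit G := by
  intro g h hgh
  have := congrFun hgh ⟨0, by simp⟩
  simpa [smul_apply, unit] using this

end StepFun

/-! ### The covering of the realization given by a functor to a group -/

section Covering

variable {n m : SimplexCategory} {C : Type u} [SmallCategory C] {G : Type u} [Group G]
  (t : C ⥤ BCat G)

/-- The step function given by a point of a simplex. -/
def stepFun (σ : NerveSimplex C n) (s : TopSimplex n) : StepFun G := fun x =>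
  (BCat.val (t.map (σ.map (homOfLE (Fin.zero_le (stepIndex s (x : ℝ)))))))⁻¹

lemma stepFun_eq (σ : NerveSimplex C n) (s : TopSimplex n) (x : Set.Ico (0 : ℝ) 1)
    {i : Fin (n.len + 1)} (h : stepIndex s (x : ℝ) = i) :
    stepFun t σ s x = (BCat.val (t.map (σ.map (homOfLE (Fin.zero_le i)))))⁻¹ := by
  subst h; rfl

/-- The values are measured from the initial vertex of the simplex. An operator that does not
preserve it shifts the reference point, which is a left translation; only the class modulo G is
natural. -/
lemma stepFun_map (f : n ⟶ m) (σ : NerveSimplex C m) (s : TopSimplex n) :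
    stepFun t σ (topSimplexMap f s) =
      (BCat.val (t.map (σ.map (homOfLE (Fin.zero_le (f.toOrderHom 0))))))⁻¹ •
        stepFun t ((nerve C).map f.op σ) s := by
  funext x
  rw [stepFun_eq t σ _ x (stepIndex_map f s x.2.1 x.2.2), StepFun.smul_apply,
    stepFun, nerve_map_map, ← mul_inv_rev]
  refine congrArg (·⁻¹) (Eq.trans ?_ (BCat.val_comp _ _))
  exact congrArg BCat.val ((congrArg t.map (σ.map_comp _ _)).trans (t.map_comp _ _))

lemma continuous_stepFun (σ : NerveSimplex C n) : Continuous (stepFun t σ) := by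
  refine continuous_iff_continuousAt.2 fun s => ?_
  refine tendsto_iff_edist_tendsto_0.2 ?_
  refine tendsto_of_tendsto_of_tendsto_of_le_of_le tendsto_const_nhds
    (tendsto_volume_stepIndex_ne s) (fun _ => zero_le) fun s' => ?_
  rw [edist_comm]
  refine MeasureTheory.measure_mono fun x hx => ?_
  obtain ⟨hx, h⟩ := StepFun.mem_diffSet.1 hx
  refine ⟨hx, fun h' => h ?_⟩
  rw [stepFun_eq t σ s' ⟨x, hx⟩ rfl, stepFun_eq t σ s ⟨x, hx⟩ h']

lemma stepFun_vertex (σ : NerveSimplex C n) (i : Fin (n.len + 1)) :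
    stepFun t σ (stdSimplex.vertex i) =
      (BCat.val (t.map (σ.map (homOfLE (Fin.zero_le i)))))⁻¹ • StepFun.unit G := by
  funext x
  rw [stepFun_eq t σ _ x (i := i), StepFun.smul_apply, StepFun.unit, mul_one]
  rw [stepIndex_eq_iff _ x.2.2]
  constructor
  · rw [partialSum, Finset.sum_eq_single i]
    · simpa using x.2.2
    · intro j _ hj
      simp [stdSimplex.vertex, Pi.single_eq_of_ne hj]
    · simp
  · intro j hj
    rw [partialSum, Finset.sum_eq_zero]
    · exact x.2.1
    · intro k hk
      have : k ≠ i := (lt_of_le_of_lt (Finset.mem_Iic.1 hk) hj).ne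
      simp [stdSimplex.vertex, Pi.single_eq_of_ne this]

lemma exists_classify : ∃ q : C(geomReal C, StepFun.Quot G), ∀ (n : SimplexCategory)
    (σ : NerveSimplex C n) (s : TopSimplex n),
      q (simplexMap σ s) = StepFun.proj G (stepFun t σ s) :=
  exists_desc (X := nerve C) (Y := StepFun.Quot G)
    (fun _ σ => (StepFun.proj G).comp ⟨stepFun t σ, continuous_stepFun t σ⟩)
    (fun f σ s => by
      refine Eq.trans ?_ (congrArg (StepFun.proj G) (stepFun_map t f σ s)).symm
      exact (StepFun.proj_smul _ _).symm)

/-- The classifying map of a functor to a group. -/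
def classify : C(geomReal C, StepFun.Quot G) := (exists_classify t).choose

lemma classify_simplexMap (σ : NerveSimplex C n) (s : TopSimplex n) :
    classify t (simplexMap σ s) = StepFun.proj G (stepFun t σ s) :=
  (exists_classify t).choose_spec n σ s

lemma classify_vertex (c : C) :
    classify t (vertex c) = StepFun.proj G (StepFun.unit G) := by
  rw [← simplexMap_nerveZero c (stdSimplex.vertex 0), classify_simplexMap, stepFun_vertex,
    StepFun.proj_smul]

/-- The lift of the classifying map of an edge. -/
def edgeLift (g : G) {c d : C} (f : c ⟶ d) :
    Path (g • StepFun.unit G) ((g * (BCat.val (t.map f))⁻¹) • StepFun.unit G) where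
  toFun u := g • stepFun t (nerveOne f)
    (simplexLine (n := ⦋1⦌) (stdSimplex.vertex 0) (stdSimplex.vertex 1) u)
  continuous_toFun := ((continuous_stepFun t (nerveOne f)).comp (Path.continuous _)).const_smul g
  source' := by
    rw [Path.source, stepFun_vertex]
    have : t.map ((nerveOne f).map (homOfLE (Fin.zero_le (0 : Fin 2)))) = 𝟙 _ :=
      (congrArg t.map ((nerveOne f).map_id _)).trans (t.map_id _)
    rw [smul_smul]
    refine congrArg (· • StepFun.unit G) ?_
    refine (congrArg (fun z => g * (BCat.val z)⁻¹) this).trans ?_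
    rw [BCat.val_id, inv_one, mul_one]
  target' := by
    rw [Path.target, stepFun_vertex, smul_smul]
    rfl

/-- The action of `G` on itself by right multiplication, as a functor. -/
def rightMulFunctor (G : Type u) [Group G] : BCat G ⥤ Type u where
  obj _ := G
  map f := ↾(fun x : G => x * (BCat.val f)⁻¹)
  map_id _ := by ext x; simp
  map_comp f g := by ext x; simp [mul_assoc]

/-- The monodromy functor of the covering given by a functor to a group. -/
def monodromyAlong : FundamentalGroupoid (geomReal C) ⥤ Type u :=
  FundamentalGroupoid.map (classify t) ⋙ (StepFun.isCoveringMap_proj G).monodromyFunctor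

/-- The point of the fiber over a vertex given by a group element. -/
def fiberPoint (c : C) (g : G) : StepFun.proj G ⁻¹' {classify t (vertex c)} :=
  ⟨g • StepFun.unit G, (StepFun.proj_smul _ _).trans (classify_vertex t c).symm⟩

lemma monodromy_edgePath {c d : C} (f : c ⟶ d) (g : G) :
    (StepFun.isCoveringMap_proj G).monodromy
      (Path.Homotopic.Quotient.map (pathArrow (edgePath f)) (classify t)) (fiberPoint t c g) =
    fiberPoint t d (g * (BCat.val (t.map f))⁻¹) := by
  refine (StepFun.isCoveringMap_proj G).monodromy_eq_of_map_eq (ex := fiberPoint t c g)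
    (ey := fiberPoint t d (g * (BCat.val (t.map f))⁻¹))
    (Path.Homotopic.Quotient.mk (edgeLift t g f)) ?_
  refine congrArg Path.Homotopic.Quotient.mk (Path.ext (funext fun u => ?_))
  refine (StepFun.proj_smul _ _).trans ?_
  exact (classify_simplexMap t (nerveOne f) _).symm

/-- The comparison of right multiplication with the monodromy on the fibers. -/
def toMonodromy : t ⋙ rightMulFunctor G ⟶ edgeFunctor C ⋙ monodromyAlong t where
  app c := ↾(fiberPoint t c)
  naturality c d f := by
    ext g
    exact (monodromy_edgePath t f g).symm

/-- A functor on the free groupoid restricts to the functor it extends. -/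
def liftCompIso {D : Type*} [Groupoid D] {E : Type*} [Category E] (F : C ⥤ D) (K : D ⥤ E) :
    FreeGroupoid.of C ⋙ FreeGroupoid.lift F ⋙ K ≅ F ⋙ K :=
  NatIso.ofComponents (fun _ => Iso.refl _) fun f =>
    (Category.comp_id _).trans ((congrArg K.map (FreeGroupoid.lift_map_homMk F f)).trans
      (Category.id_comp _).symm)

/-- A zigzag that is trivial in the fundamental groupoid is mapped to `1` by every functor to a
group. -/
lemma lift_map_eq_one {c : C} (z : FreeGroupoid.mk c ⟶ FreeGroupoid.mk c)
    (hz : (zigzagFunctor C).map z = 𝟙 _) :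
    BCat.val ((FreeGroupoid.lift t).map z) = 1 := by
  let L := FreeGroupoid.of C
  let W : MorphismProperty C := ⊤
  let _ : Localization.Lifting L W (t ⋙ rightMulFunctor G)
    (FreeGroupoid.lift t ⋙ rightMulFunctor G) := ⟨liftCompIso t _⟩
  let _ : Localization.Lifting L W (edgeFunctor C ⋙ monodromyAlong t)
    (zigzagFunctor C ⋙ monodromyAlong t) := ⟨liftCompIso (edgeFunctor C) _⟩
  -- The comparison is checked on morphisms of C only and extends to zigzags because the free
  -- groupoid is a localization of C.
  let τ := Localization.liftNatTrans L W _ _ (FreeGroupoid.lift t ⋙ rightMulFunctor G)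
    (zigzagFunctor C ⋙ monodromyAlong t) (toMonodromy t)
  have hτ (g : G) : τ.app (FreeGroupoid.mk c) g = fiberPoint t c g := by
    refine (congrArg (fun z => z.hom g) (Localization.liftNatTrans_app L W _ _
      (FreeGroupoid.lift t ⋙ rightMulFunctor G) (zigzagFunctor C ⋙ monodromyAlong t)
      (toMonodromy t) c)).trans ?_
    rfl
  -- At z and 1 ∈ G, one side is right multiplication by the inverse of the value of z, the other is
  -- trivial monodromy.
  have h := congrArg (fun y => y.hom (1 : G)) (τ.naturality z)
  have h1 : (zigzagFunctor C ⋙ monodromyAlong t).map z = 𝟙 _ :=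
    (congrArg (monodromyAlong t).map hz).trans ((monodromyAlong t).map_id _)
  rw [h1, Category.comp_id] at h
  have h2 : fiberPoint t c (1 * (BCat.val ((FreeGroupoid.lift t).map z))⁻¹) = fiberPoint t c 1 :=
    (hτ _).symm.trans (h.trans (hτ _))
  have h3 := StepFun.smul_unit_injective (congrArg Subtype.val h2)
  simpa using h3

end Covering

end OmegaRes

end
noncomputable section

namespace OmegaRes

/-! ### A category over a group as a localization -/

lemma pathArrow_comp_eqToHom {Y : Type*} [TopologicalSpace Y] {a b a' b' : Y} (P : Path a b)
    (P' : Path a' b') (ha : a = a') (hb : b = b') (h : ∀ u, P u = P' u) :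
    pathArrow P ≫ eqToHom (congrArg FundamentalGroupoid.mk hb) =
      eqToHom (congrArg FundamentalGroupoid.mk ha) ≫ pathArrow P' := by
  subst ha hb
  obtain rfl : P = P' := Path.ext (funext h)
  simp

section

variable {C D : Type u} [SmallCategory C] [SmallCategory D] (θ : C ⥤ D)

lemma geomRealMap_edgePath {c d : C} (f : c ⟶ d) (u : unitInterval) :
    geomRealMap θ (edgePath f u) = edgePath (θ.map f) u := by
  refine (congrArg _ (isImagePath_edgePath f u)).trans ?_
  refine (geomRealMap_simplexMap θ _ _).trans ?_
  refine Eq.trans ?_ (isImagePath_edgePath (θ.map f) u).symm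
  refine congrArg (fun σ : NerveSimplex D ⦋1⦌ => simplexMap σ _) ?_
  exact ComposableArrows.ext₁ rfl rfl ((Category.id_comp _).trans (Category.comp_id _)).symm

end

section

variable {C : Type u} [SmallCategory C] {D : Type u} [Groupoid.{u} D] (θ : C ⥤ D)

/-- Compatibility of the fundamental groupoid of the realization with functors to groupoids. -/
def zigzagCompIso : zigzagFunctor C ⋙ FundamentalGroupoid.map (geomRealMap θ) ≅
    FreeGroupoid.lift θ ⋙ edgeFunctor D :=
  FreeGroupoid.liftNatIso _ _ (NatIso.ofComponents
    (fun c => eqToIso (congrArg FundamentalGroupoid.mk (geomRealMap_vertex θ c))) fun {c d} f => by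
      have h1 : (FundamentalGroupoid.map (geomRealMap θ)).map
          ((zigzagFunctor C).map (FreeGroupoid.homMk f)) =
          pathArrow ((edgePath f).map (geomRealMap θ).continuous) :=
        congrArg _ (zigzagFunctor_map_homMk f)
      have h2 : (edgeFunctor D).map ((FreeGroupoid.lift θ).map (FreeGroupoid.homMk f)) =
          pathArrow (edgePath (θ.map f)) :=
        congrArg _ (FreeGroupoid.lift_map_homMk θ f)
      refine (congrArg (· ≫ _) h1).trans (Eq.trans ?_ (congrArg (_ ≫ ·) h2).symm)
      exact pathArrow_comp_eqToHom _ _ (geomRealMap_vertex θ c) (geomRealMap_vertex θ d)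
        (geomRealMap_edgePath θ f))

end

/-- Apply `lift_map_eq_one` to the identity functor and the loop g followed by the inverse of h: π
embeds in π₁(|B(π)|). -/
lemma faithful_edgeFunctor {G : Type u} [Group G] {a b : BCat G} (g h : a ⟶ b)
    (hgh : (edgeFunctor (BCat G)).map g = (edgeFunctor (BCat G)).map h) : g = h := by
  have h1 : (zigzagFunctor (BCat G)).map (FreeGroupoid.homMk g ≫ inv (FreeGroupoid.homMk h)) =
      𝟙 _ := by
    rw [Functor.map_comp, Functor.map_inv, IsIso.comp_inv_eq, Category.id_comp,
      zigzagFunctor_map_homMk, zigzagFunctor_map_homMk]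
    exact hgh
  have h2 := lift_map_eq_one (𝟭 _) _ h1
  rw [Functor.map_comp, BCat.val_comp, Functor.map_inv, BCat.val_inv, inv_mul_eq_one] at h2
  have h3 := congrArg BCat.val (FreeGroupoid.lift_map_homMk (𝟭 (BCat G)) g)
  have h4 := congrArg BCat.val (FreeGroupoid.lift_map_homMk (𝟭 (BCat G)) h)
  exact BCat.val_injective (h3.symm.trans (h2.symm.trans h4))

section Retract

variable {E : Type u} [Groupoid.{u} E] {x₀ : E} (τ : ∀ a : E, x₀ ⟶ a)

/-- The functor to the vertex group given by a choice of morphisms from the base point. -/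
def retract : E ⥤ BCat (End x₀) where
  obj _ := BCat.star _
  map {a b} f := (τ a ≫ f ≫ inv (τ b) : x₀ ⟶ x₀)
  map_id a := (by simp : τ a ≫ 𝟙 a ≫ inv (τ a) = 𝟙 _)
  map_comp {a b c} f g :=
    (by simp : τ a ≫ (f ≫ g) ≫ inv (τ c) = (τ a ≫ f ≫ inv (τ b)) ≫ τ b ≫ g ≫ inv (τ c))

instance : (retract τ).IsEquivalence where
  faithful := ⟨fun {a b} f g h => by
    have : τ a ≫ f ≫ inv (τ b) = τ a ≫ g ≫ inv (τ b) := h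
    rw [← Category.assoc, ← Category.assoc] at this
    exact (cancel_epi (τ a)).1 ((cancel_mono (inv (τ b))).1 this)⟩
  full := ⟨fun {a b} g => ⟨inv (τ a) ≫ (show x₀ ⟶ x₀ from g) ≫ τ b, by
    have : τ a ≫ (inv (τ a) ≫ (show x₀ ⟶ x₀ from g) ≫ τ b) ≫ inv (τ b) = g := by simp
    exact this⟩⟩
  essSurj := ⟨fun _ => ⟨x₀, ⟨Iso.refl _⟩⟩⟩

end Retract

lemma nonempty_zigzag {C : Type u} [SmallCategory C] [IsConnected C] (c d : C) :
    Nonempty (FreeGroupoid.mk c ⟶ FreeGroupoid.mk d) := by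
  refine induct_on_objects (Set.ofPred fun d : C =>
    Nonempty (FreeGroupoid.mk c ⟶ FreeGroupoid.mk d)) (j₀ := c) ⟨𝟙 _⟩ (fun f => ?_) d
  exact ⟨fun ⟨z⟩ => ⟨z ≫ FreeGroupoid.homMk f⟩, fun ⟨z⟩ => ⟨z ≫ inv (FreeGroupoid.homMk f)⟩⟩

/-- Zigzags that agree in the fundamental groupoid are equal. -/
lemma zigzagFunctor_injective {C : Type u} [SmallCategory C] [IsConnected C] {c : C}
    (z : FreeGroupoid.mk c ⟶ FreeGroupoid.mk c) (hz : (zigzagFunctor C).map z = 𝟙 _) :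
    z = 𝟙 _ := by
  have τ (a : FreeGroupoid C) : FreeGroupoid.mk c ⟶ a := (nonempty_zigzag c a.as.as).some
  -- The retraction onto the vertex group is a functor to a group that loses nothing: it sends z to
  -- a conjugate of z.
  have h := lift_map_eq_one (FreeGroupoid.of C ⋙ retract τ) z hz
  rw [← FreeGroupoid.lift_unique _ (retract τ) rfl] at h
  have h' : τ _ ≫ z ≫ inv (τ _) = 𝟙 _ := h
  rw [← Category.assoc, IsIso.comp_inv_eq, Category.id_comp] at h'
  exact (cancel_epi (τ _)).1 (h'.trans (Category.comp_id _).symm)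

lemma conj_eq_conj_iff {E : Type*} [Category E] {a b : E} (e : a ≅ b) (f g : b ⟶ b) :
    e.hom ≫ f ≫ e.inv = e.hom ≫ g ≫ e.inv ↔ f = g := by
  rw [Iso.cancel_iso_hom_left, Iso.cancel_iso_inv_right]

lemma conj_eq_id_iff {E : Type*} [Category E] {a b : E} (e : a ≅ b) (f : b ⟶ b) :
    e.hom ≫ f ≫ e.inv = 𝟙 a ↔ f = 𝟙 b := by
  rw [← conj_eq_conj_iff e f, Category.id_comp, Iso.hom_inv_id]

/-- A category over a group `π` has a group as localization, which surjects onto `π` with the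
expected kernel. -/
theorem exists_isLocalization {C : Type u} [SmallCategory C] {π : Type u} [Group π]
    (θ : C ⥤ BCat π) (hθ : IsCategoryOver θ) (c₀ : C) :
    ∃ (Γ : Type u) (_ : Group Γ) (ι : C ⥤ BCat Γ) (p : Γ →* π), ι.IsLocalization ⊤ ∧
      Function.Surjective p ∧
      (∀ {c d : C} (f : c ⟶ d), p (BCat.val (ι.map f)) = BCat.val (θ.map f)) ∧
      Nonempty (p.ker ≃* (piOneMap θ c₀).ker) := by
  have := hθ.isConnected
  let x₀ := FreeGroupoid.mk c₀
  let p : End x₀ →* π := MonoidHom.mk' (fun z => BCat.val ((FreeGroupoid.lift θ).map z))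
    fun z w => congrArg BCat.val ((FreeGroupoid.lift θ).map_comp w z)
  let φ : End x₀ →* FundamentalGroup (geomReal C) (vertex c₀) := (zigzagFunctor C).mapEnd x₀
  have hφi : Function.Injective φ :=
    (injective_iff_map_eq_one φ).2 fun z hz => zigzagFunctor_injective z hz
  have hφs : Function.Surjective φ := fun a => by
    obtain ⟨P, rfl⟩ := exists_pathArrow_eq a
    exact exists_zigzag_eq_pathArrow P
  let e := (zigzagCompIso θ).app x₀
  -- Up to conjugation by the comparison of base points, π₁(|θ|) ∘ φ is p followed by the embedding
  -- of π in π₁(|B(π)|).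
  have he (z : End x₀) : piOneMap θ c₀ (φ z) =
      (e.hom ≫ (edgeFunctor (BCat π)).map ((FreeGroupoid.lift θ).map z) ≫ e.inv : _) := by
    refine ((NatIso.naturality_2 (zigzagCompIso θ) (X := x₀) (Y := x₀) z).symm).trans ?_
    rfl
  have hp : Function.Surjective p := fun g => by
    let g' : (FreeGroupoid.lift θ).obj x₀ ⟶ (FreeGroupoid.lift θ).obj x₀ := (g : π)
    obtain ⟨a, ha⟩ := hθ.surjective c₀ (e.hom ≫ (edgeFunctor (BCat π)).map g' ≫ e.inv : _)
    obtain ⟨z, rfl⟩ := hφs a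
    refine ⟨z, ?_⟩
    exact faithful_edgeFunctor _ _ ((conj_eq_conj_iff e _ _).1 ((he z).symm.trans ha))
  have hker (z : End x₀) : z ∈ p.ker ↔ φ z ∈ (piOneMap θ c₀).ker := by
    rw [MonoidHom.mem_ker, MonoidHom.mem_ker, he]
    refine Iff.trans ?_ (conj_eq_id_iff e _).symm
    constructor
    · intro h
      exact (congrArg (edgeFunctor (BCat π)).map (show (FreeGroupoid.lift θ).map z = 𝟙 _ from
        h)).trans ((edgeFunctor (BCat π)).map_id _)
    · intro h
      exact faithful_edgeFunctor _ (𝟙 _) (h.trans ((edgeFunctor (BCat π)).map_id _).symm)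
  -- Since p is onto, the morphisms from the base point can be corrected to have trivial image in π.
  -- Then θ is recovered on the nose, not just up to conjugation.
  have hτ (a : FreeGroupoid C) : ∃ w : x₀ ⟶ a, BCat.val ((FreeGroupoid.lift θ).map w) = 1 := by
    obtain ⟨w⟩ : Nonempty (x₀ ⟶ a) := nonempty_zigzag c₀ a.as.as
    obtain ⟨z, hz⟩ := hp (BCat.val ((FreeGroupoid.lift θ).map w))⁻¹
    let z' : x₀ ⟶ x₀ := z
    refine ⟨z' ≫ w, ?_⟩
    rw [Functor.map_comp, BCat.val_comp]
    exact mul_eq_one_iff_eq_inv'.2 hz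
  choose τ hτ using hτ
  refine ⟨End x₀, inferInstance, FreeGroupoid.of C ⋙ retract τ, p,
    Functor.IsLocalization.of_equivalence_target (FreeGroupoid.of C) ⊤ _
      (retract τ).asEquivalence (Iso.refl _), hp, fun {c d} f => ?_, ⟨?_⟩⟩
  · refine (congrArg BCat.val ((FreeGroupoid.lift θ).map_comp _ _)).trans ?_
    rw [BCat.val_comp, Functor.map_comp, BCat.val_comp, hτ, mul_one, Functor.map_inv,
      BCat.val_inv, hτ, inv_one, one_mul]
    exact congrArg BCat.val (FreeGroupoid.lift_map_homMk θ f)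
  · let ψ : End x₀ ≃* FundamentalGroup (geomReal C) (vertex c₀) :=
      MulEquiv.ofBijective φ ⟨hφi, hφs⟩
    refine (ψ.subgroupMap p.ker).trans (MulEquiv.subgroupCongr ?_)
    ext a
    obtain ⟨z, rfl⟩ := ψ.surjective a
    rw [← show φ z = ψ z from rfl, ← hker]
    exact Subgroup.mem_map_iff_mem ψ.injective

end OmegaRes

end
noncomputable section

namespace OmegaRes

/-! ### Perfect groups -/

section Perfect

variable {R : Type u} [CommRing R] {G : Type u} [Group G]

open TensorProduct in
lemma isPerfectOver_iff_subsingleton :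
    IsPerfectOver R G ↔ Subsingleton (Additive (Abelianization G) ⊗[ℤ] R) := by
  refine (ModuleCat.isZero_iff_subsingleton).trans ?_
  exact (groupHomology.H1AddEquivOfIsTrivial (Rep.trivial R G R)).toEquiv.subsingleton_congr

open TensorProduct in
/-- A group is perfect if and only if every homomorphism to a module is trivial. -/
theorem isPerfectOver_iff : IsPerfectOver R G ↔
    ∀ (V : Type u) [AddCommGroup V] [Module R V] (u : G →* Multiplicative V), u = 1 := by
  rw [isPerfectOver_iff_subsingleton]
  constructor
  · intro h V _ _ u
    let w : Additive (Abelianization G) →+ V := (Abelianization.lift u).toAdditiveLeft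
    let B : Additive (Abelianization G) ⊗[ℤ] R →+ V :=
      TensorProduct.liftAddHom ((AddMonoidHom.flip (smulAddHom R V)).comp w) fun k a r => by
        simp [mul_smul, Int.cast_smul_eq_zsmul]
    ext g
    have h1 : B (Additive.ofMul (Abelianization.of g) ⊗ₜ[ℤ] (1 : R)) = (u g).toAdd := by
      refine (TensorProduct.liftAddHom_tmul ..).trans ?_
      exact one_smul R _
    rw [Subsingleton.elim (Additive.ofMul (Abelianization.of g) ⊗ₜ[ℤ] (1 : R)) 0, map_zero] at h1
    exact h1.symm
  · intro h
    -- This is the universal homomorphism to an R-module; if it is trivial, the generators of the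
    -- tensor product vanish.
    let u : G →* Multiplicative (R ⊗[ℤ] Additive (Abelianization G)) :=
      MonoidHom.mk' (fun g => Multiplicative.ofAdd
        ((1 : R) ⊗ₜ[ℤ] Additive.ofMul (Abelianization.of g))) fun g g' => by
          rw [map_mul, ofMul_mul, TensorProduct.tmul_add]; rfl
    have hu := h _ u
    have h0 : ∀ x : R ⊗[ℤ] Additive (Abelianization G), x = 0 := fun x => by
      induction x with
      | zero => rfl
      | add x y hx hy => rw [hx, hy, add_zero]
      | tmul r a =>
        obtain ⟨g, hg⟩ := QuotientGroup.mk_surjective (Additive.toMul a)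
        have h1 : (1 : R) ⊗ₜ[ℤ] a = 0 := by
          have h2 : (1 : R) ⊗ₜ[ℤ] Additive.ofMul (Abelianization.of g) = 0 :=
            DFunLike.congr_fun hu g
          rwa [show Abelianization.of g = Additive.toMul a from hg] at h2
        rw [← mul_one r, ← smul_eq_mul, ← TensorProduct.smul_tmul', h1, smul_zero]
    refine ⟨fun x y => (TensorProduct.comm ℤ _ _).injective ?_⟩
    rw [h0 (TensorProduct.comm ℤ _ _ x), h0 (TensorProduct.comm ℤ _ _ y)]

end Perfect

/-! ### Modules over the category of a group -/

namespace BCat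

/-- A group element as a morphism. -/
def hom {G : Type u} [Group G] (g : G) : star G ⟶ star G := g

variable {R : Type u} [CommRing R] {G : Type u} [Group G]

lemma hom_one : hom (1 : G) = 𝟙 _ := rfl

lemma hom_mul (g h : G) : hom (g * h) = hom h ≫ hom g := rfl

/-- The module underlying a representation. -/
abbrev Carrier (N : CatMod R (BCat G)) : ModuleCat.{u} R := N.obj (star G)

/-- The action of a group element. -/
def act (N : CatMod R (BCat G)) (g : G) : Carrier N →ₗ[R] Carrier N := (N.map (hom g)).hom

lemma act_one (N : CatMod R (BCat G)) (n : Carrier N) : act N 1 n = n := by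
  rw [act, hom_one, N.map_id]; rfl

lemma act_mul (N : CatMod R (BCat G)) (g h : G) (n : Carrier N) :
    act N (g * h) n = act N g (act N h n) := by
  rw [act, hom_mul, N.map_comp]; rfl

lemma app_act {N N' : CatMod R (BCat G)} (f : N ⟶ N') (g : G) (n : Carrier N) :
    (f.app (star G)).hom (act N g n) = act N' g ((f.app (star G)).hom n) :=
  congrArg (fun k => k.hom n) (f.naturality (hom g))

/-- A representation as a functor. -/
def ofAction {V : Type u} [AddCommGroup V] [Module R V] (ρ : G →* Module.End R V) :
    CatMod R (BCat G) where
  obj _ := ModuleCat.of R V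
  map f := ModuleCat.ofHom (ρ (val f))
  map_id a := by rw [val_id, map_one]; rfl
  map_comp f g := by rw [val_comp, map_mul]; rfl

/-- Equivariant linear maps as natural transformations. -/
def natTrans {N N' : CatMod R (BCat G)} (f : Carrier N →ₗ[R] Carrier N')
    (hf : ∀ g n, f (act N g n) = act N' g (f n)) : N ⟶ N' where
  app _ := ModuleCat.ofHom f
  naturality _ _ g := by
    ext n
    exact hf (val g) n

lemma natTrans_ext {N N' : CatMod R (BCat G)} {f f' : N ⟶ N'}
    (h : ∀ n, (f.app (star G)).hom n = (f'.app (star G)).hom n) : f = f' := by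
  ext a n
  exact h n

variable {Γ : Type u} [Group Γ]

/-- The functor induced by a group homomorphism. -/
def mapHom (p : Γ →* G) : BCat Γ ⥤ BCat G where
  obj _ := star G
  map f := hom (p (val f))
  map_id _ := p.map_one
  map_comp f g := p.map_mul (val g) (val f)

/-- A representation on which the kernel of a surjection acts trivially. -/
lemma act_eq_of_ker {p : Γ →* G} {N : CatMod R (BCat Γ)}
    (h : ∀ γ ∈ p.ker, ∀ n, act N γ n = n) {γ γ' : Γ} (hγ : p γ = p γ') (n : Carrier N) :
    act N γ n = act N γ' n := by
  have h1 : γ'⁻¹ * γ ∈ p.ker := by rw [MonoidHom.mem_ker, map_mul, map_inv, hγ, inv_mul_cancel]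
  rw [← mul_inv_cancel_left γ' γ, act_mul, h _ h1]

/-- The action of the quotient on a representation on which the kernel acts trivially. -/
def descend {p : Γ →* G} (hp : Function.Surjective p) (N : CatMod R (BCat Γ))
    (h : ∀ γ ∈ p.ker, ∀ n, act N γ n = n) : CatMod R (BCat G) :=
  ofAction (V := Carrier N)
    { toFun := fun g => act N (Function.surjInv hp g)
      map_one' := by
        ext n
        refine (act_eq_of_ker h (γ' := 1) ?_ n).trans (act_one N n)
        rw [Function.surjInv_eq hp, map_one]
      map_mul' := fun g g' => by
        ext n
        refine (act_eq_of_ker h ?_ n).trans (act_mul N _ _ n)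
        rw [map_mul, Function.surjInv_eq hp, Function.surjInv_eq hp, Function.surjInv_eq hp] }

/-- A representation is pulled back along a surjection if and only if the kernel acts
trivially. -/
lemma essImage_mapHom_iff {p : Γ →* G} (hp : Function.Surjective p) (N : CatMod R (BCat Γ)) :
    (upperStar R (mapHom p)).essImage N ↔ ∀ γ ∈ p.ker, ∀ n, act N γ n = n := by
  constructor
  · rintro ⟨N', ⟨e⟩⟩ γ hγ n
    have h1 : (e.hom.app (star Γ)).hom ((e.inv.app (star Γ)).hom n) = n :=
      congrArg (fun k => (k.app (star Γ)).hom n) e.inv_hom_id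
    have h2 (n' : Carrier N') : act N' (p γ) n' = n' := by
      rw [MonoidHom.mem_ker.1 hγ, act_one]
    rw [← h1, ← app_act]
    exact congrArg _ (h2 _)
  · intro h
    have h1 (γ : Γ) (n : Carrier N) :
        act ((upperStar R (mapHom p)).obj (descend hp N h)) γ n = act N γ n :=
      act_eq_of_ker h (Function.surjInv_eq hp _) n
    refine ⟨descend hp N h, ⟨⟨natTrans LinearMap.id h1, natTrans LinearMap.id fun γ n =>
      (h1 γ n).symm, ?_, ?_⟩⟩⟩
    · exact natTrans_ext fun _ => rfl
    · exact natTrans_ext fun _ => rfl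

lemma full_mapHom {p : Γ →* G} (hp : Function.Surjective p) : (upperStar R (mapHom p)).Full where
  map_surjective {N N'} f := by
    refine ⟨natTrans (f.app (star Γ)).hom fun g n => ?_, natTrans_ext fun _ => rfl⟩
    obtain ⟨γ, rfl⟩ := hp g
    exact app_act f γ n

lemma faithful_mapHom (p : Γ →* G) : (upperStar R (mapHom p)).Faithful where
  map_injective {N _} _ _ h := natTrans_ext fun n =>
    congrArg (fun k : (upperStar R (mapHom p)).obj N ⟶ _ => (k.app (star Γ)).hom n) h

/-- If the kernel is perfect, an extension of representations on which it acts trivially has the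
same property. -/
lemma act_eq_of_isPerfectOver {p : Γ →* G} (hperf : IsPerfectOver R p.ker)
    {N' N N'' : CatMod R (BCat Γ)} (f : N' ⟶ N) (g : N ⟶ N'')
    (hf : Function.Injective (f.app (star Γ)).hom)
    (hfg : ∀ n, (g.app (star Γ)).hom n = 0 → ∃ n', (f.app (star Γ)).hom n' = n)
    (h' : ∀ γ ∈ p.ker, ∀ n, act N' γ n = n) (h'' : ∀ γ ∈ p.ker, ∀ n, act N'' γ n = n) :
    ∀ γ ∈ p.ker, ∀ n, act N γ n = n := by
  intro γ hγ n
  have hd (γ : p.ker) : ∃ n', (f.app (star Γ)).hom n' = act N γ n - n := by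
    refine hfg _ ?_
    -- The difference γn − n dies in N'' and so comes from N'. The crossed homomorphism d obtained
    -- in this way is additive because the kernel acts trivially on N'.
    rw [map_sub, app_act, h'' _ γ.2, sub_self]
  choose d hd using hd
  have hdm (γ γ' : p.ker) : d (γ * γ') = d γ + d γ' := by
    refine hf ?_
    rw [map_add, hd, hd, Subgroup.coe_mul, act_mul]
    have h1 : act N γ (act N γ' n) = act N γ n + act N γ (act N γ' n - n) := by
      rw [map_sub, add_sub_cancel]
    rw [h1, ← hd γ', ← app_act, h' _ γ.2, hd γ']
    abel
  let u : p.ker →* Multiplicative (Carrier N') :=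
    MonoidHom.mk' (fun γ => Multiplicative.ofAdd (d γ)) fun γ γ' => by
      rw [hdm]; rfl
  have hu : d ⟨γ, hγ⟩ = 0 := DFunLike.congr_fun (isPerfectOver_iff.1 hperf _ u) ⟨γ, hγ⟩
  have h2 := hd ⟨γ, hγ⟩
  rw [hu, map_zero] at h2
  exact (sub_eq_zero.1 h2.symm)

end BCat

end OmegaRes

end
noncomputable section

namespace OmegaRes

section Exact

variable {R : Type u} [CommRing R] {C D : Type u} [SmallCategory C] [SmallCategory D]

/-! ### Exactness in functor categories -/

lemma exact_of_evaluation {S : ShortComplex (CatMod R C)}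
    (h : ∀ c, (S.map ((evaluation C (ModuleCat.{u} R)).obj c)).Exact) : S.Exact := by
  rw [ShortComplex.exact_iff_isZero_homology]
  refine Functor.isZero _ fun c => ?_
  exact ((ShortComplex.exact_iff_isZero_homology _).1 (h c)).of_iso
    (S.mapHomologyIso ((evaluation C (ModuleCat.{u} R)).obj c)).symm

lemma shortExact_of_evaluation {S : ShortComplex (CatMod R C)}
    (h : ∀ c, (S.map ((evaluation C (ModuleCat.{u} R)).obj c)).ShortExact) : S.ShortExact where
  exact := exact_of_evaluation fun c => (h c).exact
  mono_f := (NatTrans.mono_iff_mono_app _).2 fun c => (h c).mono_f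
  epi_g := (NatTrans.epi_iff_epi_app _).2 fun c => (h c).epi_g

lemma shortExact_evaluation {S : ShortComplex (CatMod R C)} (hS : S.ShortExact) (c : C) :
    (S.map ((evaluation C (ModuleCat.{u} R)).obj c)).ShortExact :=
  hS.map_of_exact _

lemma shortExact_upperStar (θ : C ⥤ D) {S : ShortComplex (CatMod R D)} (hS : S.ShortExact) :
    (S.map (upperStar R θ)).ShortExact :=
  shortExact_of_evaluation fun c => shortExact_evaluation hS (θ.obj c)

lemma shortExact_of_function {S : ShortComplex (CatMod R C)}
    (hf : ∀ c, Function.Injective (S.f.app c).hom)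
    (hfg : ∀ c, ∀ n, (S.g.app c).hom n = 0 → ∃ n', (S.f.app c).hom n' = n)
    (hg : ∀ c, Function.Surjective (S.g.app c).hom) : S.ShortExact :=
  shortExact_of_evaluation fun c =>
    { exact := (ShortComplex.moduleCat_exact_iff _).2 (hfg c)
      mono_f := (ModuleCat.mono_iff_injective _).2 (hf c)
      epi_g := (ModuleCat.epi_iff_surjective _).2 (hg c) }

end Exact

namespace BCat

variable {R : Type u} [CommRing R] {G : Type u} [Group G]

/-! ### Coinduced representations -/

variable (G) in
/-- The representation of all functions from a group to a module. -/
def coinduced (V : Type u) [AddCommGroup V] [Module R V] : CatMod R (BCat G) :=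
  ofAction (V := G → V)
    { toFun := fun g => LinearMap.funLeft R V fun x => x * g
      map_one' := by
        ext a x
        simp [LinearMap.funLeft]
      map_mul' := fun g h => by
        ext a x
        simp [LinearMap.funLeft, mul_assoc] }

/-- Coinduction is right adjoint to forgetting the action: an equivariant map to functions on G is
determined by its value at 1, a linear map to the injective V. -/
instance injective_coinduced (V : Type u) [AddCommGroup V] [Module R V]
    [Injective (ModuleCat.of R V)] : Injective (coinduced (R := R) G V) where
  factors {Y Z} g f _ := by
    have : Mono (f.app (star G)) := inferInstance
    let e : Carrier (coinduced (R := R) G V) →ₗ[R] V := LinearMap.proj (1 : G)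
    let k := Injective.factorThru (J := ModuleCat.of R V)
      (ModuleCat.ofHom (e ∘ₗ (g.app (star G)).hom)) (f.app (star G))
    have hk (y : Carrier Y) : k.hom ((f.app (star G)).hom y) = e ((g.app (star G)).hom y) :=
      congrArg (fun k => k.hom y) (Injective.comp_factorThru (J := ModuleCat.of R V)
        (ModuleCat.ofHom (e ∘ₗ (g.app (star G)).hom)) (f.app (star G)))
    refine ⟨natTrans (N := Z) (N' := coinduced (R := R) G V)
      (LinearMap.pi fun x => k.hom ∘ₗ act Z x) fun x z => funext fun y => ?_,
      natTrans_ext fun y => funext fun x => ?_⟩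
    · exact congrArg k.hom (act_mul Z y x z).symm
    · refine (congrArg k.hom (app_act f x y).symm).trans ((hk _).trans ?_)
      rw [app_act]
      exact congrArg ((g.app (star G)).hom y : G → V) (one_mul x)

/-! ### The extension given by a homomorphism on the kernel -/

section Twist

variable {Γ : Type u} [Group Γ] {p : Γ →* G} {V : Type u} [AddCommGroup V] [Module R V]
  (u : p.ker →* Multiplicative V) (X : CatMod R (BCat G)) (l : Carrier X →ₗ[R] R)

/-- The module underlying the extension. -/
def twistModule : Submodule R ((Γ → V) × Carrier X) where
  -- For x = 0 the condition says that a factors through p, giving the coinduced part. For general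
  -- x, an element h of the kernel moves (a, x) by changing a(1) by l(x)u(h).
  carrier := Set.ofPred fun m => ∀ (h : p.ker) (γ : Γ),
    m.1 (h * γ) = m.1 γ + l (act X (p γ) m.2) • (u h).toAdd
  add_mem' {m m'} hm hm' h γ := by
    simp only [Prod.fst_add, Prod.snd_add, Pi.add_apply, hm h γ, hm' h γ, map_add, add_smul]
    abel
  zero_mem' h γ := by simp
  smul_mem' r m hm h γ := by
    simp only [Prod.smul_fst, Prod.smul_snd, Pi.smul_apply, hm h γ, map_smul, smul_add,
      smul_smul, smul_eq_mul]

variable {X l} in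
lemma mem_twistModule {m : (Γ → V) × Carrier X} : m ∈ twistModule u X l ↔
    ∀ (h : p.ker) (γ : Γ), m.1 (h * γ) = m.1 γ + l (act X (p γ) m.2) • (u h).toAdd := Iff.rfl

/-- The representation underlying the extension. -/
def twist : CatMod R (BCat Γ) :=
  ofAction (V := twistModule u X l)
    { toFun := fun γ => LinearMap.restrict
        (LinearMap.prodMap (LinearMap.funLeft R V fun x => x * γ) (act X (p γ)))
        fun m hm => (mem_twistModule u).2 fun h γ' => by
          have := (mem_twistModule u).1 hm h (γ' * γ)
          rw [map_mul, act_mul, ← mul_assoc] at this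
          exact this
      map_one' := by
        ext m x
        · simp [LinearMap.funLeft]
        · simp [act_one]
      map_mul' := fun γ γ' => by
        ext m x
        · simp [LinearMap.funLeft, mul_assoc]
        · simp [act_mul] }

/-- With a set-theoretic section s of p, take a(γ) = l(γx) u(γ s(pγ)⁻¹). Since s(pγ) is constant on
cosets of the kernel, replacing γ by hγ adds exactly l(γx) u(h). -/
lemma exists_mem_twistModule (hp : Function.Surjective p) (x : Carrier X) :
    ∃ a, (a, x) ∈ twistModule u X l := by
  have hs (γ : Γ) : γ * (Function.surjInv hp (p γ))⁻¹ ∈ p.ker := by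
    rw [MonoidHom.mem_ker, map_mul, map_inv, Function.surjInv_eq hp, mul_inv_cancel]
  refine ⟨fun γ => l (act X (p γ) x) • (u ⟨_, hs γ⟩).toAdd, (mem_twistModule u).2 fun h γ => ?_⟩
  have h1 : p (h * γ) = p γ := by rw [map_mul, MonoidHom.mem_ker.1 h.2, one_mul]
  have h2 : (⟨_, hs (h * γ)⟩ : p.ker) = h * ⟨_, hs γ⟩ := by
    ext
    simp only [h1, Subgroup.coe_mul, mul_assoc]
  simp only [h1] at h2 ⊢
  rw [h2, map_mul, toAdd_mul, smul_add, add_comm]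

/-- The inclusion of the coinduced module into the extension. -/
def twistInl : (upperStar R (mapHom p)).obj (coinduced G V) ⟶ twist u X l :=
  natTrans (N' := twist u X l) (show (G → V) →ₗ[R] twistModule u X l from LinearMap.codRestrict _
    ((LinearMap.inl R (Γ → V) (Carrier X)) ∘ₗ LinearMap.funLeft R V p)
    fun a => (mem_twistModule u).2 fun h γ => by
      simp [LinearMap.funLeft, MonoidHom.mem_ker.1 h.2]) fun γ a => by
    refine Subtype.ext (Prod.ext (funext fun x => ?_) ?_)
    · exact congrArg a (p.map_mul x γ).symm
    · exact (map_zero (act X (p γ))).symm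

/-- The projection from the extension. -/
def twistSnd : twist u X l ⟶ (upperStar R (mapHom p)).obj X :=
  natTrans (N := twist u X l) (show twistModule u X l →ₗ[R] Carrier X from
    LinearMap.snd R (Γ → V) (Carrier X) ∘ₗ (twistModule u X l).subtype) fun _ _ => rfl

/-- The extension given by a homomorphism on the kernel. -/
def twistComplex : ShortComplex (CatMod R (BCat Γ)) where
  f := twistInl u X l
  g := twistSnd u X l
  zero := natTrans_ext fun _ => rfl

lemma shortExact_twistComplex (hp : Function.Surjective p) :
    (twistComplex u X l).ShortExact := by
  refine shortExact_of_function (fun _ a a' h => ?_) (fun _ m hm => ?_) (fun _ x => ?_)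
  · funext x
    obtain ⟨γ, rfl⟩ := hp x
    exact congrFun (congrArg (fun m : twistModule u X l => m.1.1) h) γ
  · let m' : twistModule u X l := m
    have hm' : m'.1.2 = 0 := hm
    have h1 (γ γ' : Γ) (h : p γ = p γ') : m'.1.1 γ = m'.1.1 γ' := by
      have hk : γ * γ'⁻¹ ∈ p.ker := by
        rw [MonoidHom.mem_ker, map_mul, map_inv, h, mul_inv_cancel]
      have := (mem_twistModule u).1 m'.2 ⟨_, hk⟩ γ'
      rw [hm', map_zero, map_zero, zero_smul, add_zero, inv_mul_cancel_right] at this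
      exact this
    refine ⟨fun x : G => m'.1.1 (Function.surjInv hp x), Subtype.ext (Prod.ext
      (funext fun γ => ?_) hm'.symm)⟩
    exact h1 _ _ (Function.surjInv_eq hp _)
  · obtain ⟨a, ha⟩ := exists_mem_twistModule u X l hp x
    exact ⟨(⟨(a, x), ha⟩ : twistModule u X l), rfl⟩

lemma not_essImage_twist (hp : Function.Surjective p) (hu : u ≠ 1) {x : Carrier X} (hx : l x = 1) :
    ¬ (upperStar R (mapHom p)).essImage (twist u X l) := by
  rw [essImage_mapHom_iff hp]
  intro h
  refine hu (MonoidHom.ext fun γ => ?_)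
  obtain ⟨a, ha⟩ := exists_mem_twistModule u X l hp x
  let m : twistModule u X l := ⟨(a, x), ha⟩
  have h1 : a (1 * γ) = a 1 := congrFun (congrArg (fun m : twistModule u X l => m.1.1)
    (h γ γ.2 m)) 1
  have h2 := (mem_twistModule u).1 ha γ 1
  simp only [map_one, act_one, hx, one_smul, mul_one] at h2
  rw [one_mul, h2, add_eq_left] at h1
  exact h1

end Twist

end BCat

end OmegaRes

end
noncomputable section

namespace OmegaRes

universe v₁ u₁ v₂ u₂

section Abelian

variable {A : Type u₁} [Category.{v₁} A] [Abelian A]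

/-! ### Exactness in abelian categories -/

/-- The pushout of a short exact sequence. -/
abbrev pushoutComplex (S : ShortComplex A) {Y : A} (k : S.X₁ ⟶ Y) : ShortComplex A where
  f := pushout.inl k S.f
  g := pushout.desc 0 S.g (by rw [comp_zero, S.zero])
  zero := pushout.inl_desc _ _ _

lemma shortExact_pushoutComplex {S : ShortComplex A} (hS : S.ShortExact) {Y : A} (k : S.X₁ ⟶ Y) :
    (pushoutComplex S k).ShortExact := by
  have := hS.epi_g
  have := hS.mono_f
  have hd : pushout.inr k S.f ≫ pushout.desc 0 S.g (by rw [comp_zero, S.zero]) = S.g :=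
    pushout.inr_desc _ _ _
  have hepi : Epi (pushoutComplex S k).g := epi_of_epi_fac hd
  refine { mono_f := Abelian.mono_pushout_of_mono_g k S.f, epi_g := hepi, exact := ?_ }
  refine ShortComplex.exact_of_g_is_cokernel _ (CokernelCofork.IsColimit.ofπ' _ _
    fun {T} t ht => ?_)
  have h1 : S.f ≫ pushout.inr k S.f ≫ t = 0 := by
    rw [← Category.assoc, ← pushout.condition, Category.assoc, ht, comp_zero]
  refine ⟨hS.exact.desc (pushout.inr k S.f ≫ t) h1, pushout.hom_ext ?_ ?_⟩
  · rw [ht, pushout.inl_desc_assoc, zero_comp]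
  · rw [pushout.inr_desc_assoc, hS.exact.g_desc]

lemma exact_comp_mono {X₂ X₁ X₀ K : A} {a : X₂ ⟶ X₁} {q : X₁ ⟶ K} {i : K ⟶ X₀} [Mono i]
    {w : a ≫ q = 0} (h : (ShortComplex.mk a q w).Exact) :
    (ShortComplex.mk a (q ≫ i) (by rw [← Category.assoc, w, zero_comp])).Exact :=
  (ShortComplex.exact_iff_of_epi_of_isIso_of_mono (S₁ := ShortComplex.mk a q w)
    (S₂ := ShortComplex.mk a (q ≫ i) (by rw [← Category.assoc, w, zero_comp]))
    { τ₁ := 𝟙 _, τ₂ := 𝟙 _, τ₃ := i }).1 h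

lemma exact_of_comp_mono {X₂ X₁ X₀ K : A} {a : X₂ ⟶ X₁} {q : X₁ ⟶ K} {i : K ⟶ X₀} [Mono i]
    {w : a ≫ q = 0} {w' : a ≫ q ≫ i = 0} (h : (ShortComplex.mk a (q ≫ i) w').Exact) :
    (ShortComplex.mk a q w).Exact :=
  (ShortComplex.exact_iff_of_epi_of_isIso_of_mono (S₁ := ShortComplex.mk a q w)
    (S₂ := ShortComplex.mk a (q ≫ i) w')
    { τ₁ := 𝟙 _, τ₂ := 𝟙 _, τ₃ := i }).2 h

lemma exact_epi_comp {X₂ X₁ X₀ K : A} {q : X₂ ⟶ K} {i : K ⟶ X₁} {b : X₁ ⟶ X₀} [Epi q]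
    {w : i ≫ b = 0} (h : (ShortComplex.mk i b w).Exact) :
    (ShortComplex.mk (q ≫ i) b (by rw [Category.assoc, w, comp_zero])).Exact :=
  (ShortComplex.exact_iff_of_epi_of_isIso_of_mono
    (S₁ := ShortComplex.mk (q ≫ i) b (by rw [Category.assoc, w, comp_zero]))
    (S₂ := ShortComplex.mk i b w) { τ₁ := q, τ₂ := 𝟙 _, τ₃ := 𝟙 _ }).2 h

/-- If `X₂ ⟶ X₁ ⟶ X₀` is exact, `X₁ ⟶ X₀` factors through an epimorphism that kills `X₂`, then the
other factor is a monomorphism. -/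
lemma mono_of_exact {X₂ X₁ X₀ K : A} {a : X₂ ⟶ X₁} {q : X₁ ⟶ K} {i : K ⟶ X₀} [Epi q]
    (w : a ≫ q = 0) {w' : a ≫ q ≫ i = 0} (h : (ShortComplex.mk a (q ≫ i) w').Exact) : Mono i := by
  refine Preadditive.mono_of_cancel_zero _ fun {T} t ht => ?_
  obtain ⟨T', e, _, x, hx⟩ := surjective_up_to_refinements_of_epi q t
  obtain ⟨T'', e', _, y, hy⟩ := h.exact_up_to_refinements x (by
    change x ≫ q ≫ i = 0
    rw [← Category.assoc, ← hx, Category.assoc, ht, comp_zero])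
  have hy' : e' ≫ x = y ≫ a := hy
  rw [← cancel_epi e, ← cancel_epi e', hx, ← Category.assoc, hy', Category.assoc, w]
  simp

/-- The short exact sequence given by the kernel of an epimorphism. -/
abbrev kernelComplex {X Y : A} (f : X ⟶ Y) : ShortComplex A :=
  ShortComplex.mk (kernel.ι f) f (kernel.condition f)

lemma shortExact_kernelComplex {X Y : A} (f : X ⟶ Y) [Epi f] : (kernelComplex f).ShortExact where
  exact := ShortComplex.exact_of_f_is_kernel _ (kernelIsKernel f)
  mono_f := inferInstanceAs (Mono (kernel.ι f))
  epi_g := inferInstanceAs (Epi f)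

lemma epi_kernel_lift {X₁ X₀ Y : A} {d : X₁ ⟶ X₀} {f : X₀ ⟶ Y} {w : d ≫ f = 0}
    (h : (ShortComplex.mk d f w).Exact) : Epi (kernel.lift f d w) :=
  ShortComplex.exact_iff_epi_kernel_lift _ |>.1 h

end Abelian

section Adjunction

variable {A : Type u₁} [Category.{v₁} A] [Abelian A] {B : Type u₂} [Category.{v₂} B] [Abelian B]
  {F : A ⥤ B} {G : B ⥤ A} (adj : F ⊣ G)

/-! ### Reflective subcategories closed under extensions -/

include adj in
omit [Abelian B] in
/-- If the essential image of the right adjoint is closed under extensions, the left adjoint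
preserves kernels of maps to it. -/
theorem mono_map_of_isClosedUnderExtensions [G.Full] [G.Faithful] [EnoughInjectives B]
    [G.essImage.IsClosedUnderExtensions] {S : ShortComplex A} (hS : S.ShortExact)
    (h₃ : G.essImage S.X₃) : Mono (F.map S.f) := by
  -- Push out along the transpose of an embedding of F X₁ in an injective object. The resulting
  -- extension is in the image of G, and it splits off the injective already in B, so k extends over
  -- X₂.
  let k := adj.homEquiv _ _ (Injective.ι (F.obj S.X₁))
  have hT := shortExact_pushoutComplex hS k
  obtain ⟨N, ⟨e⟩⟩ := G.essImage.prop_X₂_of_shortExact hT (G.obj_mem_essImage _) h₃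
  have := hT.mono_f
  let i : Injective.under (F.obj S.X₁) ⟶ N := G.preimage ((pushoutComplex S k).f ≫ e.inv)
  have hi : G.map i = (pushoutComplex S k).f ≫ e.inv := G.map_preimage _
  have : Mono i := by
    have : Mono (G.map i) := by rw [hi]; infer_instance
    exact G.mono_of_mono_map this
  let r := Injective.factorThru (𝟙 (Injective.under (F.obj S.X₁))) i
  have hr : i ≫ r = 𝟙 _ := Injective.comp_factorThru _ _
  let t : S.X₂ ⟶ G.obj (Injective.under (F.obj S.X₁)) := pushout.inr k S.f ≫ e.inv ≫ G.map r
  have ht : S.f ≫ t = k := by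
    have h1 : k ≫ G.map i ≫ G.map r = k := by rw [← G.map_comp, hr, G.map_id, Category.comp_id]
    rw [hi] at h1
    refine Eq.trans ?_ h1
    simp only [t, pushoutComplex, Category.assoc, pushout.condition_assoc]
  have h2 : F.map S.f ≫ (adj.homEquiv _ _).symm t = Injective.ι (F.obj S.X₁) := by
    rw [← Adjunction.homEquiv_naturality_left_symm, ht, Equiv.symm_apply_apply]
  exact mono_of_mono_fac h2

include adj in
lemma exact_map_of_epi [F.Additive] {S : ShortComplex A} (hS : S.Exact) (h : Epi S.g) :
    (S.map F).Exact := by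
  have := adj.isLeftAdjoint
  exact hS.map_of_epi_of_preservesCokernel F h inferInstance

include adj in
/-- The vanishing of the first left derived functor. -/
theorem isZero_leftDerived_one [EnoughProjectives A] [F.Additive] {Y : A}
    (h : ∀ S : ShortComplex A, S.ShortExact → S.X₃ = Y → Mono (F.map S.f)) :
    IsZero ((F.leftDerived 1).obj Y) := by
  have := adj.isLeftAdjoint
  let P : ProjectiveResolution Y := projectiveResolution Y
  refine IsZero.of_iso ?_ (P.isoLeftDerivedObj F 1)
  refine (HomologicalComplex.exactAt_iff_isZero_homology _ _).1 ?_
  rw [HomologicalComplex.exactAt_iff' _ 2 1 0 (by simp) (by simp)]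
  -- Let K be the kernel of f. F keeps P₂ → P₁ → K → 0 exact, and F K → F P₀ is mono, so the complex
  -- stays exact at F P₁.
  let f := P.π.f 0
  have hf : Epi f := inferInstance
  have hK := shortExact_kernelComplex f
  have : Mono (F.map (kernel.ι f)) := h _ hK rfl
  let q : P.complex.X 1 ⟶ kernel f := kernel.lift f (P.complex.d 1 0) P.complex_d_comp_π_f_zero
  have hq : q ≫ kernel.ι f = P.complex.d 1 0 := kernel.lift_ι _ _ _
  have : Epi q := epi_kernel_lift P.exact₀
  have h1 : P.complex.d 2 1 ≫ q = 0 := by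
    rw [← cancel_mono (kernel.ι f), Category.assoc, hq, zero_comp, P.complex.d_comp_d]
  have h2 : (ShortComplex.mk (P.complex.d 2 1) q h1).Exact := by
    have h3 := P.exact_succ 0
    refine exact_of_comp_mono (i := kernel.ι f) (w' := by rw [hq, P.complex.d_comp_d]) ?_
    convert! h3
  have h4 := exact_map_of_epi adj h2 this
  have h5 := exact_comp_mono (i := F.map (kernel.ι f)) h4
  have h6 : F.map q ≫ F.map (kernel.ι f) = F.map (P.complex.d 1 0) := by rw [← F.map_comp, hq]
  have h7 : (ShortComplex.mk (F.map (P.complex.d 2 1)) (F.map (P.complex.d 1 0)) (by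
      rw [← F.map_comp, P.complex.d_comp_d, F.map_zero])).Exact := by
    convert! h5 using 2
    exact h6.symm
  exact h7

end Adjunction

end OmegaRes

end
noncomputable section

namespace OmegaRes

universe v₁ u₁ v₂ u₂

/-! ### Homology of spliced complexes and of augmentations -/

section Abelian

variable {A : Type u₁} [Category.{v₁} A] [Abelian A]

lemma exact_epi_comp_mono {X₂ X₁ X₀ K K' : A} {q : X₂ ⟶ K} {i : K ⟶ X₁} {b : X₁ ⟶ K'}
    {j : K' ⟶ X₀} (_ : Epi q) (_ : Mono j) {w : i ≫ b = 0} (h : (ShortComplex.mk i b w).Exact)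
    {d₂ : X₂ ⟶ X₁} {d₁ : X₁ ⟶ X₀} (hd₂ : d₂ = q ≫ i) (hd₁ : d₁ = b ≫ j) (w' : d₂ ≫ d₁ = 0) :
    (ShortComplex.mk d₂ d₁ w').Exact := by
  subst hd₂ hd₁
  exact exact_comp_mono (exact_epi_comp h)

/-- Composing with an epimorphism and a monomorphism does not change the homology. -/
lemma nonempty_homology_iso {X₂ X₁ X₀ K K' : A} {q : X₂ ⟶ K} {i : K ⟶ X₁} {b : X₁ ⟶ K'}
    {j : K' ⟶ X₀} (_ : Epi q) (_ : Mono j) (w : i ≫ b = 0)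
    {d₂ : X₂ ⟶ X₁} {d₁ : X₁ ⟶ X₀} (hd₂ : d₂ = q ≫ i) (hd₁ : d₁ = b ≫ j) (w' : d₂ ≫ d₁ = 0) :
    Nonempty ((ShortComplex.mk d₂ d₁ w').homology ≅ (ShortComplex.mk i b w).homology) := by
  subst hd₂ hd₁
  let S : ShortComplex A := ShortComplex.mk (q ≫ i) b (by rw [Category.assoc, w, comp_zero])
  let φ : S ⟶ ShortComplex.mk (q ≫ i) (b ≫ j) w' := { τ₁ := 𝟙 _, τ₂ := 𝟙 _, τ₃ := j }
  let ψ : S ⟶ ShortComplex.mk i b w := { τ₁ := q, τ₂ := 𝟙 _, τ₃ := 𝟙 _ }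
  have : Epi φ.τ₁ := inferInstanceAs (Epi (𝟙 _))
  have : IsIso φ.τ₂ := inferInstanceAs (IsIso (𝟙 _))
  have : Mono φ.τ₃ := inferInstanceAs (Mono j)
  have : Epi ψ.τ₁ := inferInstanceAs (Epi q)
  have : IsIso ψ.τ₂ := inferInstanceAs (IsIso (𝟙 _))
  have : Mono ψ.τ₃ := inferInstanceAs (Mono (𝟙 _))
  have hφ := ShortComplex.quasiIso_of_epi_of_isIso_of_mono φ
  have hψ := ShortComplex.quasiIso_of_epi_of_isIso_of_mono ψ
  exact ⟨(asIso (ShortComplex.homologyMap φ)).symm ≪≫ asIso (ShortComplex.homologyMap ψ)⟩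

/-- The homology at the target of a kernel inclusion into a kernel. -/
lemma nonempty_homology_kernel_iso {P B L : A} (p : P ⟶ B) (κ : kernel p ⟶ L) [Epi κ]
    (w : (kernel.ι κ ≫ kernel.ι p) ≫ p = 0) :
    Nonempty ((ShortComplex.mk (kernel.ι κ ≫ kernel.ι p) p w).homology ≅ L) := by
  let S := ShortComplex.mk (kernel.ι κ ≫ kernel.ι p) p w
  have hl : (kernelIsKernel p).lift (KernelFork.ofι S.f S.zero) = kernel.ι κ := by
    rw [← cancel_mono (kernel.ι p)]
    exact (kernelIsKernel p).fac _ WalkingParallelPair.zero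
  have wπ : (kernelIsKernel p).lift (KernelFork.ofι S.f S.zero) ≫ κ = 0 := by
    rw [hl, kernel.condition]
  have hκ : (kernelComplex κ).ShortExact := shortExact_kernelComplex κ
  let h : S.LeftHomologyData :=
    { K := kernel p
      H := L
      i := kernel.ι p
      π := κ
      wi := kernel.condition p
      hi := kernelIsKernel p
      wπ := wπ
      hπ := CokernelCofork.IsColimit.ofπ' _ _ fun {T} t ht =>
        ⟨hκ.exact.desc t (by rw [← ht, hl]), hκ.exact.g_desc _ _⟩ }
  exact ⟨h.homologyIso⟩

/-- In degree 0 the homology is the cokernel of the differential. The map it induces to Y is epi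
exactly when ε is, and mono by exactness at P₀. -/
lemma isIso_homologyZeroDesc_iff (P : ChainComplex A ℕ) {Y : A} (ε : P.X 0 ⟶ Y)
    (w : P.d 1 0 ≫ ε = 0) :
    IsIso (homologyZeroDesc P ε w) ↔ Epi ε ∧ (ShortComplex.mk (P.d 1 0) ε w).Exact := by
  let δ := P.descOpcycles ε 1 (by simp) w
  have hδ : P.pOpcycles 0 ≫ δ = ε := P.p_descOpcycles _ _ _ _
  have hc : (ShortComplex.mk (P.d 1 0) (P.pOpcycles 0) (by simp)).Exact :=
    ShortComplex.exact_of_g_is_cokernel _ (P.opcyclesIsCokernel 1 0 (by simp))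
  have h1 : IsIso (homologyZeroDesc P ε w) ↔ IsIso δ :=
    isIso_comp_left_iff (P.homologyι 0) δ
  rw [h1]
  constructor
  · intro h
    constructor
    · rw [← hδ]
      infer_instance
    · have := exact_comp_mono (i := δ) hc
      convert! this using 2
      exact hδ.symm
  · rintro ⟨h, h'⟩
    have : Epi (P.pOpcycles 0 ≫ δ) := by rw [hδ]; exact h
    have : Epi δ := epi_of_epi (P.pOpcycles 0) δ
    have : Mono δ := by
      refine mono_of_exact (a := P.d 1 0) (q := P.pOpcycles 0) (i := δ) (by simp)
        (w' := by rw [hδ, w]) ?_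
      convert! h' using 2
    exact isIso_of_mono_of_epi δ

end Abelian

section Adjunction

variable {A : Type u₁} [Category.{v₁} A] [Abelian A] {B : Type u₂} [Category.{v₂} B] [Abelian B]
  {F : A ⥤ B} {G : B ⥤ A} (adj : F ⊣ G)

/-! ### Consequences of the existence of a resolution -/

/-- F P₁ → F(ker ε) is epi and kills F P₂, so exactness of the image complex at F P₁ forces F(ker ε)
→ F P₀ to be mono. Of the exactness of the image complex, only that in this degree is used. -/
lemma HasOmegaResolution.exists_mono [F.Additive] {X : B} (h : HasOmegaResolution F G X)
    (adj : F ⊣ G) :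
    ∃ (P : A) (ε : P ⟶ G.obj X), Projective P ∧ Epi ε ∧ Mono (F.map (kernel.ι ε)) := by
  obtain ⟨P, ε, w, h⟩ := h
  obtain ⟨hε, hex⟩ := (isIso_homologyZeroDesc_iff P ε w).1 h.isIso_homologyZero
  refine ⟨P.X 0, ε, h.projective 0, hε, ?_⟩
  have := adj.isLeftAdjoint
  let q : P.X 1 ⟶ kernel ε := kernel.lift ε (P.d 1 0) w
  have hq : q ≫ kernel.ι ε = P.d 1 0 := kernel.lift_ι _ _ _
  have : Epi q := epi_kernel_lift hex
  have h1 : P.d 2 1 ≫ q = 0 := by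
    rw [← cancel_mono (kernel.ι ε), Category.assoc, hq, zero_comp, P.d_comp_d]
  have h2 := h.exact_map 2
  rw [HomologicalComplex.exactAt_iff' _ 3 2 1 (by simp) (by simp)] at h2
  have h3 : (ShortComplex.mk (F.map (P.d 2 1)) (F.map (P.d 1 0))
    (by rw [← F.map_comp, P.d_comp_d, F.map_zero])).Exact := h2
  refine mono_of_exact (a := F.map (P.d 2 1)) (q := F.map q)
    (by rw [← F.map_comp, h1, F.map_zero])
    (w' := by rw [← F.map_comp, ← F.map_comp, hq, P.d_comp_d, F.map_zero]) ?_
  convert! h3 using 2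
  rw [← F.map_comp, hq]

/-- If `X` has a resolution, extensions of `G X` by an injective object come from `B`. -/
theorem HasOmegaResolution.essImage_of_shortExact [F.Additive] [G.Additive] (adj : F ⊣ G) {X I : B}
    [Injective I] (h : HasOmegaResolution F G X) {M : A} {f : G.obj I ⟶ M} {g : M ⟶ G.obj X}
    {w : f ≫ g = 0} (hS : (ShortComplex.mk f g w).ShortExact) : G.essImage M := by
  obtain ⟨P, ε, hP, hε, hm⟩ := h.exists_mono adj
  have : Epi g := hS.epi_g
  have : Mono f := hS.mono_f
  let l := Projective.factorThru ε g
  have hl : l ≫ g = ε := Projective.factorThru_comp _ _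
  let κ : kernel ε ⟶ G.obj I := hS.exact.lift (kernel.ι ε ≫ l) (by
    change (kernel.ι ε ≫ l) ≫ g = 0
    rw [Category.assoc, hl, kernel.condition])
  have hκ : κ ≫ f = kernel.ι ε ≫ l := hS.exact.lift_f _ _
  -- The obstruction κ to descending l to a section extends over P: its transpose has injective
  -- target and F(ker ε) → F P is mono. Subtracting the extension from l gives a splitting.
  let t := Injective.factorThru ((adj.homEquiv _ _).symm κ) (F.map (kernel.ι ε))
  have ht : F.map (kernel.ι ε) ≫ t = (adj.homEquiv _ _).symm κ := Injective.comp_factorThru _ _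
  have ht' : kernel.ι ε ≫ adj.homEquiv _ _ t = κ := by
    rw [← Adjunction.homEquiv_naturality_left, ht, Equiv.apply_symm_apply]
  have hεS := shortExact_kernelComplex ε
  let s : G.obj X ⟶ M := hεS.exact.desc (l - adj.homEquiv _ _ t ≫ f) (by
    change kernel.ι ε ≫ _ = 0
    rw [Preadditive.comp_sub, ← Category.assoc, ht', hκ, sub_self])
  have hs : ε ≫ s = l - adj.homEquiv _ _ t ≫ f := hεS.exact.g_desc _ _
  have hsg : s ≫ g = 𝟙 _ := by
    rw [← cancel_epi ε, ← Category.assoc, hs, Preadditive.sub_comp, Category.assoc, w, comp_zero,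
      sub_zero, hl, Category.comp_id]
  let sp := ShortComplex.Splitting.ofExactOfSection _ hS.exact s hsg hS.mono_f
  have := preservesBinaryBiproducts_of_preservesBiproducts G
  exact ⟨I ⊞ X, ⟨G.mapBiprod I X ≪≫ sp.isoBinaryBiproduct.symm⟩⟩

/-! ### Existence of resolutions -/

-- The image of the unit is a subobject of G F M, hence of the form G N. By universality of the unit
-- the inclusion of N into F M is a split epimorphism, so the image is everything.
omit [Abelian B] in
lemma epi_unit [G.Full] [G.Faithful] [G.essImage.IsClosedUnderSubobjects] (M : A) :
    Epi (adj.unit.app M) := by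
  obtain ⟨N, ⟨e⟩⟩ := ObjectProperty.IsClosedUnderSubobjects.prop_of_mono (P := G.essImage)
    (Abelian.image.ι (adj.unit.app M)) (G.obj_mem_essImage _)
  let e' : M ⟶ G.obj N := Abelian.factorThruImage (adj.unit.app M) ≫ e.inv
  let n : N ⟶ F.obj M := G.preimage (e.hom ≫ Abelian.image.ι (adj.unit.app M))
  have hn : e' ≫ G.map n = adj.unit.app M := by simp [e', n]
  have h1 : (adj.homEquiv _ _).symm e' ≫ n = 𝟙 _ := by
    apply (adj.homEquiv _ _).injective
    rw [Adjunction.homEquiv_naturality_right, Equiv.apply_symm_apply, hn, Adjunction.homEquiv_unit,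
      G.map_id]
    exact (Category.comp_id _).symm
  have : Epi (G.map n) := by
    have h2 : G.map ((adj.homEquiv _ _).symm e') ≫ G.map n = 𝟙 _ := by
      rw [← G.map_comp, h1, G.map_id]
    exact epi_of_epi_fac h2
  have : Epi e' := epi_comp _ _
  rw [← hn]
  exact epi_comp _ _

variable (F G) in
/-- One step in the construction of a resolution. -/
structure ResolutionStep (Y : A) where
  /-- The projective object. -/
  P : A
  /-- The next object to be covered. -/
  next : A
  /-- The projection. -/
  p : P ⟶ Y
  /-- The inclusion. -/
  i : next ⟶ P
  zero : i ≫ p = 0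
  projective_P : Projective P
  epi_p : Epi p
  mono_i : Mono i
  projective_next : Projective (F.obj next)
  mono_map : Mono (F.map i)
  exact_map : ∀ w, (ShortComplex.mk (F.map i) (F.map p) w).Exact
  homology_mem : G.essImage (ShortComplex.mk i p zero).homology

include adj in
lemma map_π_surjective [F.Additive] {X Y Z : A} {f : X ⟶ Y} {g : Y ⟶ Z} {w : f ≫ g = 0} [Epi g]
    (h : (ShortComplex.mk f g w).Exact) : (ShortComplex.mk (F.map f) (F.map g)
      (by rw [← F.map_comp, w, F.map_zero])).Exact ∧ Epi (F.map g) :=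
  ⟨exact_map_of_epi adj h ‹_›, by have := adj.isLeftAdjoint; infer_instance⟩

/-- A projective cover by a projective object splits, so its kernel is projective. -/
lemma projective_kernel {X Y : B} (f : X ⟶ Y) [Epi f] [Projective X] [Projective Y] :
    Projective (kernel f) := by
  have hS := shortExact_kernelComplex f
  let s := Projective.factorThru (𝟙 Y) f
  have hs : s ≫ f = 𝟙 _ := Projective.factorThru_comp _ _
  let r : X ⟶ kernel f := kernel.lift f (𝟙 X - f ≫ s) (by
    rw [Preadditive.sub_comp, Category.assoc, hs, Category.id_comp, Category.comp_id, sub_self])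
  have hr : r ≫ kernel.ι f = 𝟙 X - f ≫ s := kernel.lift_ι _ _ _
  have h : kernel.ι f ≫ r = 𝟙 _ := by
    rw [← cancel_mono (kernel.ι f), Category.assoc, hr, Preadditive.comp_sub, ← Category.assoc,
      kernel.condition, zero_comp, sub_zero, Category.comp_id, Category.id_comp]
  exact Retract.projective { i := kernel.ι f, r := r, retract := h }

open scoped ZeroObject in
include adj in
/-- The first step of a resolution of an object in the image of the right adjoint. -/
lemma exists_resolutionStep_of_mem [F.Additive] [G.Additive] [G.PreservesEpimorphisms]
    [EnoughProjectives A]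
    (hm : ∀ S : ShortComplex A, S.ShortExact → G.essImage S.X₃ → Mono (F.map S.f))
    {Y : A} (hY : G.essImage Y) [Projective (F.obj Y)] :
    ∃ T : ResolutionStep F G Y, (ShortComplex.mk T.i T.p T.zero).Exact := by
  let p := Projective.π Y
  have hS := shortExact_kernelComplex p
  -- Since Y is in the image, F is already exact on the kernel sequence and nothing has to be cut
  -- away.
  have hm' : Mono (F.map (kernel.ι p)) := hm _ hS hY
  obtain ⟨hF, hep⟩ := map_π_surjective adj hS.exact
  have : Projective (F.obj (Projective.over Y)) := adj.map_projective _ inferInstance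
  have hFS : (ShortComplex.mk (F.map (kernel.ι p)) (F.map p)
    (by rw [← F.map_comp, kernel.condition, F.map_zero])).ShortExact :=
      { exact := hF, mono_f := hm', epi_g := hep }
  have hproj : Projective (F.obj (kernel p)) := by
    refine Projective.of_iso ?_ (projective_kernel (F.map p))
    exact (IsLimit.conePointUniqueUpToIso hFS.fIsKernel (kernelIsKernel (F.map p))).symm
  have hz : IsZero (ShortComplex.mk (kernel.ι p) p (kernel.condition p)).homology :=
    (ShortComplex.exact_iff_isZero_homology _).1 hS.exact
  have hz' : IsZero (G.obj 0) := G.map_isZero (isZero_zero B)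
  exact ⟨{  P := Projective.over Y
            next := kernel p
            p := p
            i := kernel.ι p
            zero := kernel.condition p
            projective_P := inferInstance
            epi_p := inferInstance
            mono_i := inferInstance
            projective_next := hproj
            mono_map := hm'
            exact_map := fun _ => hF
            homology_mem := ⟨0, ⟨hz'.iso hz⟩⟩ }, hS.exact⟩

include adj in
/-- The inductive step in the construction of a resolution. -/
lemma exists_resolutionStep [F.Additive] [G.Additive] [G.Full] [G.Faithful]
    [G.PreservesEpimorphisms] [EnoughProjectives A]
    (hm : ∀ S : ShortComplex A, S.ShortExact → G.essImage S.X₃ → Mono (F.map S.f))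
    (hu : ∀ M, Epi (adj.unit.app M)) (Y : A) [Projective (F.obj Y)] :
    Nonempty (ResolutionStep F G Y) := by
  let p := Projective.π Y
  have hS := shortExact_kernelComplex p
  obtain ⟨hF, hep⟩ := map_π_surjective adj hS.exact
  have : Projective (F.obj (Projective.over Y)) := adj.map_projective _ inferInstance
  have : Projective (kernel (F.map p)) := projective_kernel _
  have hw : F.map (kernel.ι p) ≫ F.map p = 0 := by
    rw [← F.map_comp, kernel.condition, F.map_zero]
  -- F is only right exact, so e is epi but possibly not mono; ker e is the error. It is a direct
  -- summand of F(ker p), because ker(F p) is projective.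
  let e : F.obj (kernel p) ⟶ kernel (F.map p) := kernel.lift _ (F.map (kernel.ι p)) hw
  have he : e ≫ kernel.ι (F.map p) = F.map (kernel.ι p) := kernel.lift_ι _ _ _
  have : Epi e := epi_kernel_lift hF
  let s := Projective.factorThru (𝟙 (kernel (F.map p))) e
  have hs : s ≫ e = 𝟙 _ := Projective.factorThru_comp _ _
  let ρ : F.obj (kernel p) ⟶ kernel e := kernel.lift e (𝟙 _ - e ≫ s) (by
    rw [Preadditive.sub_comp, Category.assoc, hs, Category.id_comp, Category.comp_id, sub_self])
  have hρ : ρ ≫ kernel.ι e = 𝟙 _ - e ≫ s := kernel.lift_ι _ _ _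
  have hιρ : kernel.ι e ≫ ρ = 𝟙 _ := by
    rw [← cancel_mono (kernel.ι e), Category.assoc, hρ, Preadditive.comp_sub, ← Category.assoc,
      kernel.condition, zero_comp, sub_zero, Category.comp_id, Category.id_comp]
  have hsρ : s ≫ ρ = 0 := by
    rw [← cancel_mono (kernel.ι e), Category.assoc, hρ, Preadditive.comp_sub, ← Category.assoc,
      hs, Category.id_comp, Category.comp_id, sub_self, zero_comp]
  have : Epi ρ := epi_of_epi_fac hιρ
  -- The quotient G(ker e) of ker p absorbs the error: the next object is ker κ, and the homology
  -- created at P is G(ker e), which is allowed.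
  let κ : kernel p ⟶ G.obj (kernel e) := adj.unit.app _ ≫ G.map ρ
  have := hu (kernel p)
  have : Epi κ := epi_comp _ _
  have hκρ : F.map κ ≫ adj.counit.app (kernel e) = ρ := by
    have h1 := adj.homEquiv_counit (X := kernel p) (Y := kernel e) (g := κ)
    rw [← h1]
    apply (adj.homEquiv _ _).injective
    rw [Equiv.apply_symm_apply, Adjunction.homEquiv_unit]
    rfl
  have hT := shortExact_kernelComplex κ
  have ha : Mono (F.map (kernel.ι κ)) := hm _ hT (G.obj_mem_essImage _)
  obtain ⟨hFT, -⟩ := map_π_surjective adj hT.exact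
  have haρ : F.map (kernel.ι κ) ≫ ρ = 0 := by
    rw [← hκρ, ← Category.assoc, ← F.map_comp, kernel.condition, F.map_zero, zero_comp]
  have hex : (ShortComplex.mk (F.map (kernel.ι κ)) ρ haρ).Exact := by
    have := exact_comp_mono (i := adj.counit.app (kernel e)) hFT
    convert! this using 2
    exact hκρ.symm
  -- F(ker κ) is the kernel of ρ, a complement of ker e, so e maps it isomorphically onto ker(F p).
  let z := F.map (kernel.ι κ) ≫ e
  have hmono : Mono z := by
    refine Preadditive.mono_of_cancel_zero _ fun {T} t ht => ?_
    have h1 : (t ≫ F.map (kernel.ι κ)) ≫ e = 0 := by rw [Category.assoc]; exact ht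
    have h2 : kernel.lift e _ h1 = 0 := by
      rw [← Category.comp_id (kernel.lift e _ h1), ← hιρ, ← Category.assoc, kernel.lift_ι,
        Category.assoc, haρ, comp_zero]
    have h3 : t ≫ F.map (kernel.ι κ) = 0 := by
      rw [← kernel.lift_ι e _ h1, h2, zero_comp]
    exact zero_of_comp_mono _ h3
  have hsplit : hex.lift s hsρ ≫ z = 𝟙 _ := by
    rw [← Category.assoc, hex.lift_f, hs]
  have hepi : Epi z := epi_of_epi_fac hsplit
  have hiso : IsIso z := isIso_of_mono_of_epi z
  have hzi : z ≫ kernel.ι (F.map p) = F.map (kernel.ι κ ≫ kernel.ι p) := by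
    rw [Category.assoc, he, F.map_comp]
  have hZ := shortExact_kernelComplex (F.map p)
  have w : (kernel.ι κ ≫ kernel.ι p) ≫ p = 0 := by rw [Category.assoc, kernel.condition, comp_zero]
  obtain ⟨eh⟩ := nonempty_homology_kernel_iso p κ w
  refine ⟨{  P := Projective.over Y
             next := kernel κ
             p := p
             i := kernel.ι κ ≫ kernel.ι p
             zero := w
             projective_P := inferInstance
             epi_p := inferInstance
             mono_i := mono_comp _ _
             projective_next := Projective.of_iso (asIso z).symm inferInstance
             mono_map := by rw [← hzi]; exact mono_comp _ _
             exact_map := fun w' => ?_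
             homology_mem := ⟨kernel e, ⟨eh.symm⟩⟩ }⟩
  have := exact_epi_comp (q := z) hZ.exact
  convert! this using 2
  exact hzi.symm

/-! ### Splicing the steps into a chain complex -/

section Construction

variable {Y : A} (T₀ : ResolutionStep F G Y)
  (next : ∀ Z : A, Projective (F.obj Z) → ResolutionStep F G Z)

/-- The steps of a resolution, obtained by iteration. -/
def resolutionSteps (n : ℕ) : Σ Z : A, ResolutionStep F G Z :=
  Nat.rec ⟨Y, T₀⟩ (fun _ T => ⟨T.2.next, next T.2.next T.2.projective_next⟩) n

/-- The step in a given degree. -/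
def resolutionStep (n : ℕ) : ResolutionStep F G (resolutionSteps T₀ next n).1 :=
  (resolutionSteps T₀ next n).2

/-- The projection in positive degrees. -/
def resolutionProj (n : ℕ) :
    (resolutionStep T₀ next (n + 1)).P ⟶ (resolutionStep T₀ next n).next :=
  (resolutionStep T₀ next (n + 1)).p

lemma epi_resolutionProj (n : ℕ) : Epi (resolutionProj T₀ next n) :=
  (resolutionStep T₀ next (n + 1)).epi_p

include adj in
lemma epi_map_resolutionProj (n : ℕ) : Epi (F.map (resolutionProj T₀ next n)) := by
  have := adj.isLeftAdjoint
  have := epi_resolutionProj T₀ next n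
  infer_instance

lemma i_resolutionProj (n : ℕ) :
    (resolutionStep T₀ next (n + 1)).i ≫ resolutionProj T₀ next n = 0 :=
  (resolutionStep T₀ next (n + 1)).zero

lemma resolution_comp (n : ℕ) :
    (resolutionProj T₀ next (n + 1) ≫ (resolutionStep T₀ next (n + 1)).i) ≫
      resolutionProj T₀ next n ≫ (resolutionStep T₀ next n).i = 0 := by
  rw [Category.assoc, ← Category.assoc (resolutionStep T₀ next (n + 1)).i, i_resolutionProj,
    zero_comp, comp_zero]

/-- The chain complex obtained by iterating steps. -/
def resolution : ChainComplex A ℕ :=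
  ChainComplex.of (fun n => (resolutionStep T₀ next n).P)
    (fun n => resolutionProj T₀ next n ≫ (resolutionStep T₀ next n).i)
    (resolution_comp T₀ next)

lemma resolution_d (n : ℕ) : (resolution T₀ next).d (n + 1) n =
    resolutionProj T₀ next n ≫ (resolutionStep T₀ next n).i :=
  ChainComplex.of_d (fun n => (resolutionStep T₀ next n).P)
    (fun n => resolutionProj T₀ next n ≫ (resolutionStep T₀ next n).i) n

lemma exact_map_resolutionProj [F.Additive] (n : ℕ) :
    (ShortComplex.mk (F.map (resolutionStep T₀ next (n + 1)).i) (F.map (resolutionProj T₀ next n))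
      (by rw [← F.map_comp, i_resolutionProj, F.map_zero])).Exact :=
  (resolutionStep T₀ next (n + 1)).exact_map _

lemma resolution_d_comp : (resolution T₀ next).d 1 0 ≫ T₀.p = 0 := by
  rw [resolution_d]
  refine (Category.assoc _ _ _).trans ?_
  exact (congrArg (resolutionProj T₀ next 0 ≫ ·) T₀.zero).trans comp_zero

end Construction

include adj in
/-- Iterating steps gives a resolution. -/
theorem isOmegaResolution_resolution [F.Additive] {X : B} (T₀ : ResolutionStep F G (G.obj X))
    (next : ∀ Z : A, Projective (F.obj Z) → ResolutionStep F G Z)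
    (h₀ : (ShortComplex.mk T₀.i T₀.p T₀.zero).Exact) :
    IsOmegaResolution F G X (resolution T₀ next) T₀.p (resolution_d_comp T₀ next) := by
  have := adj.isLeftAdjoint
  have := T₀.epi_p
  have hz : IsIso (homologyZeroDesc (resolution T₀ next) T₀.p (resolution_d_comp T₀ next)) := by
    refine (isIso_homologyZeroDesc_iff _ _ _).2 ⟨T₀.epi_p, ?_⟩
    exact exact_epi_comp_mono (epi_resolutionProj T₀ next 0) (inferInstanceAs (Mono (𝟙 _))) h₀
      (resolution_d T₀ next 0) (Category.comp_id _).symm _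
  refine ⟨fun n => (resolutionStep T₀ next n).projective_P, fun n => ?_, fun n => ?_, hz⟩
  -- Augmentation shifts degrees: degree 0 is F G X and degree n + 1 is F Pₙ.
  · rcases n with _ | _ | n
    · rw [HomologicalComplex.exactAt_iff' _ 1 0 0 (by simp) (by simp)]
      refine (ShortComplex.exact_iff_epi _ ?_).2 (inferInstanceAs (Epi (F.map T₀.p)))
      change F.map (((resolution T₀ next).augment T₀.p _).d 0 0) = 0
      rw [HomologicalComplex.shape _ _ _ (by simp), F.map_zero]
    · rw [HomologicalComplex.exactAt_iff' _ 2 1 0 (by simp) (by simp)]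
      exact exact_epi_comp_mono (epi_map_resolutionProj adj T₀ next 0)
        (inferInstanceAs (Mono (𝟙 _)))
        (T₀.exact_map (by rw [← F.map_comp, T₀.zero, F.map_zero]))
        ((congrArg F.map (resolution_d T₀ next 0)).trans (F.map_comp _ _))
        (Category.comp_id _).symm _
    · rw [HomologicalComplex.exactAt_iff' _ (n + 3) (n + 2) (n + 1) (by simp) (by simp)]
      exact exact_epi_comp_mono (epi_map_resolutionProj adj T₀ next (n + 1))
        (resolutionStep T₀ next n).mono_map (exact_map_resolutionProj T₀ next n)
        ((congrArg F.map (resolution_d T₀ next (n + 1))).trans (F.map_comp _ _))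
        ((congrArg F.map (resolution_d T₀ next n)).trans (F.map_comp _ _)) _
  · rcases n with _ | n
    · exact ⟨X, ⟨(asIso (homologyZeroDesc (resolution T₀ next) T₀.p
        (resolution_d_comp T₀ next))).symm⟩⟩
    · obtain ⟨N, ⟨e⟩⟩ := (resolutionStep T₀ next (n + 1)).homology_mem
      obtain ⟨e'⟩ := nonempty_homology_iso (epi_resolutionProj T₀ next (n + 1))
        (resolutionStep T₀ next n).mono_i (i_resolutionProj T₀ next n)
        (resolution_d T₀ next (n + 1)) (resolution_d T₀ next n)
        ((resolution T₀ next).d_comp_d _ _ _)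
      exact ⟨N, ⟨e ≪≫ e'.symm ≪≫ ShortComplex.homologyMapIso
        ((resolution T₀ next).isoSc' (n + 2) (n + 1) n (by simp) (by simp)).symm⟩⟩

include adj in
/-- Existence of resolutions. -/
theorem hasOmegaResolution_of_projective [F.Additive] [G.Additive] [G.Full] [G.Faithful]
    [G.PreservesEpimorphisms] [EnoughProjectives A]
    (hm : ∀ S : ShortComplex A, S.ShortExact → G.essImage S.X₃ → Mono (F.map S.f))
    [G.essImage.IsClosedUnderSubobjects] (X : B) [Projective X] : HasOmegaResolution F G X := by
  have hu := epi_unit adj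
  have : Projective (F.obj (G.obj X)) := Projective.of_iso (asIso (adj.counit.app X)).symm ‹_›
  obtain ⟨T₀, h₀⟩ := exists_resolutionStep_of_mem adj hm (G.obj_mem_essImage X)
  exact ⟨_, _, _, isOmegaResolution_resolution adj T₀
    (fun Z _ => (exists_resolutionStep adj hm hu Z).some) h₀⟩

end Adjunction

end OmegaRes

end
noncomputable section

namespace OmegaRes

/-! ### Injective and projective modules over a group -/

lemma isPerfectOver_of_mulEquiv (R : Type u) [CommRing R] {G G' : Type u} [Group G] [Group G']
    (e : G ≃* G') (h : IsPerfectOver R G) : IsPerfectOver R G' := by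
  rw [isPerfectOver_iff] at h ⊢
  intro V _ _ u
  ext g
  obtain ⟨g, rfl⟩ := e.surjective g
  exact DFunLike.congr_fun (h V (u.comp e.toMonoidHom)) g

lemma isPerfectOver_iff_of_mulEquiv (R : Type u) [CommRing R] {G G' : Type u} [Group G] [Group G']
    (e : G ≃* G') : IsPerfectOver R G ↔ IsPerfectOver R G' :=
  ⟨isPerfectOver_of_mulEquiv R e, isPerfectOver_of_mulEquiv R e.symm⟩

/-- A group that is not perfect has a nontrivial homomorphism to an injective module. -/
lemma exists_ne_one_of_not_isPerfectOver {R : Type u} [CommRing R] {G : Type u} [Group G]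
    (h : ¬ IsPerfectOver R G) : ∃ (V : ModuleCat.{u} R) (_ : Injective V)
      (u : G →* Multiplicative V), u ≠ 1 := by
  rw [isPerfectOver_iff] at h
  push Not at h
  obtain ⟨V, _, _, u, hu⟩ := h
  let j := Injective.ι (ModuleCat.of R V)
  refine ⟨Injective.under (ModuleCat.of R V), inferInstance,
    (AddMonoidHom.toMultiplicative j.hom.toAddMonoidHom).comp u, fun h => hu ?_⟩
  ext g
  refine (ModuleCat.mono_iff_injective j).1 inferInstance ?_
  exact (DFunLike.congr_fun h g).trans (map_zero j.hom).symm

instance preservesEpimorphisms_upperStar (R : Type u) [CommRing R] {C D : Type u}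
    [SmallCategory C] [SmallCategory D] (θ : C ⥤ D) : (upperStar R θ).PreservesEpimorphisms where
  preserves f _ := (NatTrans.epi_iff_epi_app _).2 fun c =>
    inferInstanceAs (Epi (f.app (θ.obj c)))

instance enoughInjectives_catMod (R : Type u) [CommRing R] (G : Type u) [Group G] :
    EnoughInjectives (CatMod R (BCat G)) where
  presentation N := by
    let J : ModuleCat.{u} R := Injective.under (BCat.Carrier N)
    let j : BCat.Carrier N ⟶ J := Injective.ι (BCat.Carrier N)
    have : Injective (ModuleCat.of R J) := inferInstanceAs (Injective J)
    let f : N ⟶ BCat.coinduced (R := R) G J :=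
      BCat.natTrans (LinearMap.pi fun x => j.hom ∘ₗ BCat.act N x) fun g n =>
        funext fun x => congrArg j.hom (BCat.act_mul N x g n).symm
    have hf : Function.Injective (f.app (BCat.star G)).hom := fun n n' h => by
      have h1 : j.hom (BCat.act N 1 n) = j.hom (BCat.act N 1 n') := congrFun h (1 : G)
      rw [BCat.act_one, BCat.act_one] at h1
      exact (ModuleCat.mono_iff_injective j).1 inferInstance h1
    exact ⟨⟨_, inferInstance, f, (NatTrans.mono_iff_mono_app _).2 fun _ =>
      (ModuleCat.mono_iff_injective _).2 hf⟩⟩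

/-- The representable functor is projective among sets with an action by the Yoneda lemma, and the
free module functor is left adjoint to a functor preserving epimorphisms. -/
lemma projective_groupRing (R : Type u) [CommRing R] (G : Type u) [Group G] :
    Projective (groupRing R G) := by
  let adj := (ModuleCat.adj R).whiskerRight (BCat G)
  have : ((Functor.whiskeringRight (BCat G) (ModuleCat.{u} R) (Type u)).obj
      (forget (ModuleCat.{u} R))).PreservesEpimorphisms :=
    { preserves := fun f _ => (NatTrans.epi_iff_epi_app _).2 fun c =>
        inferInstanceAs (Epi ((forget (ModuleCat.{u} R)).map (f.app c))) }
  refine adj.map_projective (coyoneda.obj (Opposite.op (BCat.star G))) ⟨fun {E X} f e _ => ?_⟩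
  obtain ⟨y, hy⟩ := (epi_iff_surjective (e.app (BCat.star G))).1 inferInstance (coyonedaEquiv f)
  refine ⟨coyonedaEquiv.symm y, coyonedaEquiv.injective ?_⟩
  rw [coyonedaEquiv_comp, Equiv.apply_symm_apply]
  exact hy

/-! ### Modules over C compared with Γ-modules -/

section Core

variable (R : Type u) [CommRing R] {C : Type u} [SmallCategory C] {Γ π : Type u} [Group Γ] [Group π]
  (ι : C ⥤ BCat Γ) (p : Γ →* π)

lemma full_upperStar [ι.IsLocalization ⊤] (hp : Function.Surjective p) :
    (upperStar R (ι ⋙ BCat.mapHom p)).Full := by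
  have := Localization.full_whiskeringLeft ι ⊤ (ModuleCat.{u} R)
  have := BCat.full_mapHom (R := R) hp
  exact inferInstanceAs (upperStar R (BCat.mapHom p) ⋙ upperStar R ι).Full

lemma faithful_upperStar [ι.IsLocalization ⊤] :
    (upperStar R (ι ⋙ BCat.mapHom p)).Faithful := by
  have := Localization.faithful_whiskeringLeft ι ⊤ (ModuleCat.{u} R)
  have := BCat.faithful_mapHom (R := R) p
  exact inferInstanceAs (upperStar R (BCat.mapHom p) ⋙ upperStar R ι).Faithful

variable {R ι p}

lemma essImage_of_isIso [ι.IsLocalization ⊤] {M : CatMod R C}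
    (h : ∀ {c d : C} (f : c ⟶ d), IsIso (M.map f)) : ∃ N, Nonempty ((upperStar R ι).obj N ≅ M) :=
  ⟨Localization.lift M (W := ⊤) (fun _ _ f _ => h f) ι,
    ⟨Localization.fac M (W := ⊤) (fun _ _ f _ => h f) ι⟩⟩

lemma isIso_of_essImage {D : Type u} [SmallCategory D] {θ : C ⥤ D}
    (hD : ∀ {a b : D} (f : a ⟶ b), IsIso f) {M : CatMod R C} (h : (upperStar R θ).essImage M)
    {c d : C} (f : c ⟶ d) : IsIso (M.map f) := by
  obtain ⟨N, ⟨e⟩⟩ := h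
  have := hD (θ.map f)
  exact (NatIso.isIso_map_iff e f).1 (inferInstanceAs (IsIso (N.map (θ.map f))))

lemma essImage_upperStar_iff [ι.IsLocalization ⊤] (hp : Function.Surjective p)
    (N : CatMod R (BCat Γ)) :
    (upperStar R (ι ⋙ BCat.mapHom p)).essImage ((upperStar R ι).obj N) ↔
      ∀ γ ∈ p.ker, ∀ n, BCat.act N γ n = n := by
  have := Localization.full_whiskeringLeft ι ⊤ (ModuleCat.{u} R)
  have := Localization.faithful_whiskeringLeft ι ⊤ (ModuleCat.{u} R)
  rw [← BCat.essImage_mapHom_iff hp]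
  constructor
  · rintro ⟨N', ⟨e⟩⟩
    exact ⟨N', ⟨(upperStar R ι).preimageIso (X := (upperStar R (BCat.mapHom p)).obj N') e⟩⟩
  · rintro ⟨N', ⟨e⟩⟩
    exact ⟨N', ⟨(upperStar R ι).mapIso e⟩⟩

lemma exists_of_essImage [ι.IsLocalization ⊤] (hp : Function.Surjective p) {M : CatMod R C}
    (h : (upperStar R (ι ⋙ BCat.mapHom p)).essImage M) :
    ∃ N, (∀ γ ∈ p.ker, ∀ n, BCat.act N γ n = n) ∧ Nonempty ((upperStar R ι).obj N ≅ M) := by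
  obtain ⟨N, ⟨e⟩⟩ := h
  exact ⟨(upperStar R (BCat.mapHom p)).obj N,
    (BCat.essImage_mapHom_iff hp _).1 (Functor.obj_mem_essImage _ _), ⟨e⟩⟩

variable [ι.IsLocalization ⊤] (hp : Function.Surjective p)
include hp

/-- If the kernel is perfect, the essential image is closed under extensions. -/
theorem isClosedUnderExtensions_essImage (c₀ : C) (hperf : IsPerfectOver R p.ker) :
    (upperStar R (ι ⋙ BCat.mapHom p)).essImage.IsClosedUnderExtensions where
  prop_X₂_of_shortExact {S} hS h₁ h₃ := by
    have := Localization.full_whiskeringLeft ι ⊤ (ModuleCat.{u} R)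
    -- By the five lemma the middle term inverts all morphisms, so it comes from a Γ-module.
    have hM {c d : C} (f : c ⟶ d) : IsIso (S.X₂.map f) := by
      let φ : S.map ((evaluation C (ModuleCat.{u} R)).obj c) ⟶
          S.map ((evaluation C (ModuleCat.{u} R)).obj d) :=
        { τ₁ := S.X₁.map f, τ₂ := S.X₂.map f, τ₃ := S.X₃.map f
          comm₁₂ := S.f.naturality f, comm₂₃ := S.g.naturality f }
      exact ShortComplex.isIso₂_of_shortExact_of_isIso₁₃' φ (shortExact_evaluation hS c)
        (shortExact_evaluation hS d)
        (isIso_of_essImage (fun _ => inferInstance) h₁ f)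
        (isIso_of_essImage (fun _ => inferInstance) h₃ f)
    obtain ⟨N₁, h₁, ⟨e₁⟩⟩ := exists_of_essImage hp h₁
    obtain ⟨N₃, h₃, ⟨e₃⟩⟩ := exists_of_essImage hp h₃
    obtain ⟨N, ⟨e⟩⟩ := essImage_of_isIso (ι := ι) hM
    refine Functor.essImage.ofIso e ((essImage_upperStar_iff hp N).2 ?_)
    let f : N₁ ⟶ N := (upperStar R ι).preimage (e₁.hom ≫ S.f ≫ e.inv)
    let g : N ⟶ N₃ := (upperStar R ι).preimage (e.hom ≫ S.g ≫ e₃.inv)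
    have hf : f.app (BCat.star Γ) = e₁.hom.app c₀ ≫ S.f.app c₀ ≫ e.inv.app c₀ :=
      congrArg (fun k => k.app c₀) ((upperStar R ι).map_preimage (e₁.hom ≫ S.f ≫ e.inv))
    have hg : g.app (BCat.star Γ) = e.hom.app c₀ ≫ S.g.app c₀ ≫ e₃.inv.app c₀ :=
      congrArg (fun k => k.app c₀) ((upperStar R ι).map_preimage (e.hom ≫ S.g ≫ e₃.inv))
    have hSc := shortExact_evaluation hS c₀
    refine BCat.act_eq_of_isPerfectOver hperf f g ?_ (fun n hn => ?_) h₁ h₃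
    · have : Mono (S.f.app c₀) := hSc.mono_f
      rw [← ModuleCat.mono_iff_injective, hf]
      exact mono_comp' (inferInstanceAs (Mono (e₁.hom.app c₀)))
        (mono_comp' this (inferInstanceAs (Mono (e.inv.app c₀))))
    · rw [hg] at hn
      have hn' : (S.g.app c₀).hom ((e.hom.app c₀).hom n) = 0 :=
        (ModuleCat.mono_iff_injective (e₃.inv.app c₀)).1 inferInstance
          (hn.trans (map_zero (e₃.inv.app c₀).hom).symm)
      obtain ⟨x, hx⟩ := (ShortComplex.moduleCat_exact_iff _).1 hSc.exact _ hn'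
      refine ⟨(e₁.inv.app c₀).hom x, ?_⟩
      rw [hf]
      have h4 : (e₁.hom.app c₀).hom ((e₁.inv.app c₀).hom x) = x :=
        congrArg (fun k => (k.app c₀).hom x) e₁.inv_hom_id
      have h5 : (e.inv.app c₀).hom ((e.hom.app c₀).hom n) = n :=
        congrArg (fun k => (k.app c₀).hom n) e.hom_inv_id
      refine Eq.trans (congrArg (fun z => (e.inv.app c₀).hom ((S.f.app c₀).hom z)) h4) ?_
      exact (congrArg (e.inv.app c₀).hom hx).trans h5

/-- If all morphisms are invertible, the essential image is closed under subobjects. -/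
theorem isClosedUnderSubobjects_essImage (c₀ : C) (hC : ∀ {c d : C} (f : c ⟶ d), IsIso f) :
    (upperStar R (ι ⋙ BCat.mapHom p)).essImage.IsClosedUnderSubobjects where
  prop_of_mono {M M'} m _ h := by
    have := Localization.full_whiskeringLeft ι ⊤ (ModuleCat.{u} R)
    obtain ⟨N', h', ⟨e'⟩⟩ := exists_of_essImage hp h
    -- Every functor on a groupoid inverts all morphisms, so the subobject is itself a Γ-module.
    obtain ⟨N, ⟨e⟩⟩ := essImage_of_isIso (ι := ι) (M := M) fun f => by
      have := hC f
      infer_instance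
    refine Functor.essImage.ofIso e ((essImage_upperStar_iff hp N).2 fun γ hγ n => ?_)
    let f : N ⟶ N' := (upperStar R ι).preimage (e.hom ≫ m ≫ e'.inv)
    have hf : f.app (BCat.star Γ) = e.hom.app c₀ ≫ m.app c₀ ≫ e'.inv.app c₀ :=
      congrArg (fun k => k.app c₀) ((upperStar R ι).map_preimage (e.hom ≫ m ≫ e'.inv))
    have hinj : Function.Injective (f.app (BCat.star Γ)).hom := by
      rw [← ModuleCat.mono_iff_injective, hf]
      exact mono_comp' (inferInstanceAs (Mono (e.hom.app c₀)))
        (mono_comp' (inferInstanceAs (Mono (m.app c₀))) (inferInstanceAs (Mono (e'.inv.app c₀))))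
    refine hinj ?_
    rw [BCat.app_act, h' γ hγ]

/-- The extension given by a nontrivial homomorphism on the kernel. -/
lemma not_essImage_upperStar_twist {V : Type u} [AddCommGroup V] [Module R V]
    {u : p.ker →* Multiplicative V} (hu : u ≠ 1) (X : CatMod R (BCat π))
    (l : BCat.Carrier X →ₗ[R] R) {x : BCat.Carrier X} (hx : l x = 1) :
    ¬ (upperStar R (ι ⋙ BCat.mapHom p)).essImage ((upperStar R ι).obj (BCat.twist u X l)) := by
  rw [essImage_upperStar_iff hp, ← BCat.essImage_mapHom_iff hp]
  exact BCat.not_essImage_twist u X l hp hu hx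

/-- The trivial module R with the identity as functional already gives a twisted extension outside
the image. -/
theorem not_isClosedUnderExtensions_essImage (h : ¬ IsPerfectOver R p.ker) :
    ¬ (upperStar R (ι ⋙ BCat.mapHom p)).essImage.IsClosedUnderExtensions := by
  intro hcl
  obtain ⟨V, _, u, hu⟩ := exists_ne_one_of_not_isPerfectOver h
  let X : CatMod R (BCat π) := BCat.ofAction (V := R) 1
  let l : BCat.Carrier X →ₗ[R] R := LinearMap.id
  refine not_essImage_upperStar_twist (ι := ι) hp hu X l (x := (1 : R)) rfl ?_
  exact ObjectProperty.prop_X₂_of_shortExact _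
    (shortExact_upperStar ι (BCat.shortExact_twistComplex u X l hp))
    (Functor.obj_mem_essImage (upperStar R (ι ⋙ BCat.mapHom p)) (BCat.coinduced π V))
    (Functor.obj_mem_essImage (upperStar R (ι ⋙ BCat.mapHom p)) X)

/-- A resolution would put extensions of X by injectives into the image, and the module coinduced
from an injective V is injective. Freeness supplies a coordinate functional taking the value 1,
which makes the twisted extension a counterexample. -/
theorem not_hasOmegaResolution (h : ¬ IsPerfectOver R p.ker) (X : CatMod R (BCat π))
    (hX : ¬ IsZero X) (hfree : Module.Free R (BCat.Carrier X)) :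
    ¬ HasOmegaResolution (lowerStar R (ι ⋙ BCat.mapHom p)) (upperStar R (ι ⋙ BCat.mapHom p)) X := by
  intro hres
  obtain ⟨V, hV, u, hu⟩ := exists_ne_one_of_not_isPerfectOver h
  have : Injective (ModuleCat.of R V) := hV
  let b := Module.Free.chooseBasis R (BCat.Carrier X)
  have hne : Nonempty (Module.Free.ChooseBasisIndex R (BCat.Carrier X)) := by
    by_contra hemp
    rw [not_nonempty_iff] at hemp
    have : Subsingleton (BCat.Carrier X) := b.repr.toEquiv.subsingleton
    exact hX (Functor.isZero _ fun a => ModuleCat.isZero_iff_subsingleton.2 this)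
  obtain ⟨i⟩ := hne
  refine not_essImage_upperStar_twist (ι := ι) hp hu X (b.coord i) (x := b i) (by simp) ?_
  exact hres.essImage_of_shortExact (I := BCat.coinduced π V) (starAdj R (ι ⋙ BCat.mapHom p))
    (shortExact_upperStar ι (BCat.shortExact_twistComplex u X (b.coord i) hp))

end Core

end OmegaRes

end
noncomputable section

namespace OmegaRes

/-! ### Subobjects over EI-categories -/

section EI

variable {C : Type u} [SmallCategory C]

/-- In a connected EI-category with non-isomorphic objects, some morphism cannot be reversed. -/
lemma exists_isEmpty_hom [IsConnected C] (hEI : IsEI C) {x y : C} (hxy : IsEmpty (x ≅ y)) :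
    ∃ (a b : C) (_ : a ⟶ b), IsEmpty (b ⟶ a) := by
  by_contra! h
  refine hxy.false (Classical.choice ?_)
  -- If each morphism has some morphism back, both composites are automorphisms, so every morphism
  -- is invertible and connectedness makes all objects isomorphic.
  have hiso {a b : C} (f : a ⟶ b) : IsIso f := by
    obtain ⟨g⟩ := h a b f
    have := hEI a (f ≫ g)
    have := hEI b (g ≫ f)
    have : IsSplitMono f := ⟨⟨⟨g ≫ inv (f ≫ g), by rw [← Category.assoc, IsIso.hom_inv_id]⟩⟩⟩
    have : Epi f := by
      have h2 : (inv (g ≫ f) ≫ g) ≫ f = 𝟙 b := by rw [Category.assoc, IsIso.inv_hom_id]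
      exact epi_of_epi_fac h2
    exact isIso_of_epi_of_isSplitMono f
  refine induct_on_objects (Set.ofPred fun z : C => Nonempty (x ≅ z)) (j₀ := x)
    ⟨Iso.refl x⟩ (fun {j₁ j₂} f => ?_) y
  have := hiso f
  exact ⟨fun ⟨e⟩ => ⟨e ≪≫ asIso f⟩, fun ⟨e⟩ => ⟨e ≪≫ (asIso f).symm⟩⟩

variable (R : Type u) [CommRing R]

/-- The ring on the objects below `b`, and zero elsewhere. -/
def cosieveModule (b c : C) : Submodule R R where
  carrier := Set.ofPred fun r => IsEmpty (b ⟶ c) → r = 0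
  add_mem' h h' hc := by rw [h hc, h' hc, add_zero]
  zero_mem' _ := rfl
  smul_mem' r s h hc := by rw [h hc, smul_zero]

/-- The subobject of the constant functor supported on the objects below `b`. -/
def cosieveFunctor (b : C) : CatMod R C where
  obj c := ModuleCat.of R (cosieveModule R b c)
  map f := ModuleCat.ofHom (Submodule.inclusion fun _ hr hd =>
    hr ⟨fun g => hd.false (g ≫ f)⟩)
  map_id _ := rfl
  map_comp _ _ := rfl

variable {R}

lemma not_isIso_cosieveFunctor_map [Nontrivial R] {a b : C} (f : a ⟶ b) (h : IsEmpty (b ⟶ a)) :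
    ¬ IsIso ((cosieveFunctor R b).map f) := by
  intro hiso
  have hs : Function.Surjective ((cosieveFunctor R b).map f).hom :=
    (ModuleCat.epi_iff_surjective _).1 inferInstance
  obtain ⟨r, hr⟩ := hs (⟨1, fun hb => (hb.false (𝟙 b)).elim⟩ : cosieveModule R b b)
  have h1 : (r : cosieveModule R b a).1 = 1 := congrArg (fun z : cosieveModule R b b => z.1) hr
  exact zero_ne_one (((r : cosieveModule R b a).2 h).symm.trans h1)

/-- Objects of the image invert every morphism. The subfunctor of the constant functor R supported
on the targets of morphisms from b does not: it vanishes at a but not at b. -/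
theorem not_isClosedUnderSubobjects_essImage [Nontrivial R] [IsConnected C] (hEI : IsEI C)
    {x y : C} (hxy : IsEmpty (x ≅ y)) {π : Type u} [Group π] (θ : C ⥤ BCat π) :
    ¬ (upperStar R θ).essImage.IsClosedUnderSubobjects := by
  intro hcl
  obtain ⟨a, b, f, hf⟩ := exists_isEmpty_hom hEI hxy
  let X : CatMod R (BCat π) := BCat.ofAction (V := R) 1
  let m : cosieveFunctor R b ⟶ (upperStar R θ).obj X :=
    { app := fun c => ModuleCat.ofHom (cosieveModule R b c).subtype
      naturality := fun _ _ _ => rfl }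
  have : Mono m := (NatTrans.mono_iff_mono_app _).2 fun c =>
    (ModuleCat.mono_iff_injective _).2 (Submodule.subtype_injective (cosieveModule R b c))
  have h := ObjectProperty.IsClosedUnderSubobjects.prop_of_mono (P := (upperStar R θ).essImage) m
    (Functor.obj_mem_essImage _ X)
  exact not_isIso_cosieveFunctor_map f hf (isIso_of_essImage (fun _ => inferInstance) h f)

end EI

lemma isIso_of_equivalence {C : Type u} [SmallCategory C] {G : Type u} [Group G]
    (e : C ≌ BCat G) {c d : C} (f : c ⟶ d) : IsIso f :=
  isIso_of_reflects_iso f e.functor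

/-- The functor `θ` is the composite of a localization and the functor induced by a
homomorphism. -/
lemma exists_isLocalization_comp {C : Type u} [SmallCategory C] {π : Type u} [Group π]
    (θ : C ⥤ BCat π) (hθ : IsCategoryOver θ) (c₀ : C) :
    ∃ (Γ : Type u) (_ : Group Γ) (ι : C ⥤ BCat Γ) (p : Γ →* π), ι.IsLocalization ⊤ ∧
      Function.Surjective p ∧ θ = ι ⋙ BCat.mapHom p ∧
      Nonempty (p.ker ≃* (piOneMap θ c₀).ker) := by
  obtain ⟨Γ, _, ι, p, h1, h2, h3, h4⟩ := exists_isLocalization θ hθ c₀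
  exact ⟨Γ, _, ι, p, h1, h2, CategoryTheory.Functor.hext (fun _ => rfl)
    fun _ _ f => heq_of_eq (h3 f).symm, h4⟩

end OmegaRes

end
-- Assembly of the proposition
theorem proposition3p11 {R : Type u} [CommRing R] {C : Type u} [SmallCategory C]
    {π : Type u} [Group π] (θ : C ⥤ OmegaRes.BCat π) (hθ : OmegaRes.IsCategoryOver θ) (c₀ : C) :
    OmegaRes.IsOmegaSystem (OmegaRes.starAdj R θ) ∧
    -- case where the kernel `H` of `π₁(|θ|)` is `R`-perfect
    (OmegaRes.IsPerfectOver R (OmegaRes.piOneMap θ c₀).ker →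
      (∀ X : OmegaRes.CatMod R (OmegaRes.BCat π),
        IsZero (((OmegaRes.lowerStar R θ).leftDerived 1).obj ((OmegaRes.upperStar R θ).obj X))) ∧
      (OmegaRes.upperStar R θ).essImage.IsClosedUnderExtensions ∧
      (∀ (G : Type u) [Group G], Nonempty (C ≌ OmegaRes.BCat G) →
        ∀ X : OmegaRes.CatMod R (OmegaRes.BCat π), Projective X →
          OmegaRes.HasOmegaResolution (OmegaRes.lowerStar R θ) (OmegaRes.upperStar R θ) X)) ∧
    -- closure under subobjects
    (∀ (G : Type u) [Group G], Nonempty (C ≌ OmegaRes.BCat G) →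
      (OmegaRes.upperStar R θ).essImage.IsClosedUnderSubobjects) ∧
    (Nontrivial R → OmegaRes.IsEI C → (∃ x y : C, IsEmpty (x ≅ y)) →
      ¬ (OmegaRes.upperStar R θ).essImage.IsClosedUnderSubobjects) ∧
    -- case where the kernel `H` is not `R`-perfect
    (¬ OmegaRes.IsPerfectOver R (OmegaRes.piOneMap θ c₀).ker →
      ¬ (OmegaRes.upperStar R θ).essImage.IsClosedUnderExtensions ∧
      Projective (OmegaRes.groupRing R π) ∧
      ¬ OmegaRes.HasOmegaResolution (OmegaRes.lowerStar R θ) (OmegaRes.upperStar R θ)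
          (OmegaRes.groupRing R π) ∧
      ∀ X : OmegaRes.CatMod R (OmegaRes.BCat π), ¬ IsZero X → Projective X →
        Module.Free R (X.obj (OmegaRes.BCat.star π)) →
        ¬ OmegaRes.HasOmegaResolution (OmegaRes.lowerStar R θ) (OmegaRes.upperStar R θ) X) := by
  obtain ⟨Γ, _, ι, p, _, hp, rfl, ⟨e⟩⟩ := OmegaRes.exists_isLocalization_comp θ hθ c₀
  rw [← OmegaRes.isPerfectOver_iff_of_mulEquiv R e]
  have := hθ.isConnected
  have := OmegaRes.full_upperStar R ι p hp
  have := OmegaRes.faithful_upperStar R ι p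
  refine ⟨⟨inferInstance, inferInstance, inferInstance, inferInstance⟩, fun h => ?_,
    fun G _ ⟨e'⟩ => OmegaRes.isClosedUnderSubobjects_essImage hp c₀
      (OmegaRes.isIso_of_equivalence e'),
    fun _ hEI ⟨x, y, hxy⟩ => OmegaRes.not_isClosedUnderSubobjects_essImage hEI hxy _,
    fun h => ⟨OmegaRes.not_isClosedUnderExtensions_essImage hp h,
      OmegaRes.projective_groupRing R π, ?_,
      fun X hX _ hfree => OmegaRes.not_hasOmegaResolution hp h X hX hfree⟩⟩
  · have := OmegaRes.isClosedUnderExtensions_essImage (R := R) (ι := ι) hp c₀ h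
    have hm : ∀ S : ShortComplex (OmegaRes.CatMod R C), S.ShortExact →
        (OmegaRes.upperStar R (ι ⋙ OmegaRes.BCat.mapHom p)).essImage S.X₃ →
        Mono ((OmegaRes.lowerStar R (ι ⋙ OmegaRes.BCat.mapHom p)).map S.f) := fun S hS h₃ =>
      OmegaRes.mono_map_of_isClosedUnderExtensions (OmegaRes.starAdj R _) hS h₃
    refine ⟨fun X => OmegaRes.isZero_leftDerived_one (OmegaRes.starAdj R _) fun S hS h₃ =>
      hm S hS ?_, this, fun G _ ⟨e'⟩ X _ => ?_⟩
    · rw [h₃]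
      exact Functor.obj_mem_essImage _ X
    · have := OmegaRes.isClosedUnderSubobjects_essImage (R := R) (ι := ι) hp c₀
        (OmegaRes.isIso_of_equivalence e')
      exact OmegaRes.hasOmegaResolution_of_projective (OmegaRes.starAdj R _) hm X
  · refine OmegaRes.not_hasOmegaResolution hp h _ (fun hz => h ?_) ?_
    -- If Rπ were zero, R would be the zero ring, over which every group is perfect.
    · have := ModuleCat.isZero_iff_subsingleton.1 (hz.obj (OmegaRes.BCat.star π))
      have : Subsingleton ((OmegaRes.BCat.star π ⟶ OmegaRes.BCat.star π) →₀ R) := this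
      have : Subsingleton R := ⟨fun r s => Finsupp.single_injective (𝟙 (OmegaRes.BCat.star π))
        (Subsingleton.elim _ _)⟩
      rw [OmegaRes.isPerfectOver_iff]
      intro V _ _ u
      have := Module.subsingleton R V
      ext g
      exact Subsingleton.elim (α := V) _ _
    · exact inferInstanceAs (Module.Free R
        ((OmegaRes.BCat.star π ⟶ OmegaRes.BCat.star π) →₀ R))
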